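/- **Definitions.** A *name* of a real number $x$ is a sequence $(x_n)_{n\in\mathbb N}$ of rational numbers with $|x_n-x_{n+1}|\le 2^{-n}$ for all $n$ and $x_n\to x$; $x$ is *computable* if it has a computable name. A function $f:[0,1]\to\mathbb R$ is *computable* if some Turing machine transforms every name of every $x\in[0,1]$ into a name of $f(x)$; a function $f:[0,1]\to\mathbb R^2$ is computable if its two components are. A *simple curve* is a set $C\subseteq\mathbb R^2$ that is the range of an injective continuous function $g:[0,1]\to\mathbb R^2$. Its *length* $l(C)\in[0,\infty]$ is the supremum of $\sum_{i<n}|g(a_i)-g(a_{i+1})|$ over all partitions $0=a_0<\dots<a_n=1$ (this does not depend on $g$), and $C$ is *rectifiable* if $l(C)<\infty$. A rational neighborhood is an open square $\{(x,y): |x-a|<\varepsilon,\ |y-b|<\varepsilon\}$ with rational $a,b$ and rational $\varepsilon>0$; the Hausdorff distance $d_H$ is taken with respect to such square neighborhoods. A simple curve $C$ is * *$K$-computable* if there is a computable sequence $(Q_n)$ of finite sets of rational neighborhoods with $C\subseteq\bigcup Q_n$ and $d_H(\bigcup Q_n, C)<2^{-n}$ for all $n$; * *$R$-computable* if $C=f([0,1])$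 for some computable $f:[0,1]\to\mathbb R^2$; * *$M$-computable* if $C=f([0,1])$ for some injective computable $f:[0,1]\to\mathbb R^2$; * *$N$-computable* if $C$ is rectifiable and $C=f([0,1])$ for some computable $f:[0,1]\to\mathbb R^2$ such that for all $t\in[0,1]$ the segment $f([0,t])$ has length $t\cdot l(C)$. Let $\mathbf C_R$ and $\mathbf C_N$ be the classes of $R$-computable and of $N$-computable rectifiable simple curves, and let $\mathbf C_C$ be the class of rectifiable simple curves whose length is a computable real number and which are $K$-, $R$-, $M$- or $N$-computable. A class $\mathbf C$ of curves is *point-separable* from a class $\mathbf B$ of curves if there is a point that lies on some curve of $\mathbf C$ but on no curve of $\mathbf B$. **Theorem.** There are an $N$-computable curve $K$ and a point on $K$ that lies on no curve of $\mathbf C_C$. That is, $\mathbf C_N$ is point-separable from $\mathbf C_C$. In particular, $\mathbf C_R$ is point-separable from $\mathbf C_C$: some point lies on an $R$-computable simple curve of finite length, but on no computable simple curve of computable length (in any of the four versions of computability). This answers a question of Gu, Lutz and Mayordomo. -/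

import Mathlib

open Set Filter Topology
open scoped ENNReal

namespace CompCurve

/-! ### Rational numbers, names, computable reals and computable real functions -/

/-- A finite description of a rational number: `(a, b)` stands for the fraction `a / (b + 1)`. -/
abbrev RatCode : Type := ℤ × ℕ

/-- The real number described by a code of a rational number. -/
noncomputable def RatCode.val (p : RatCode) : ℝ := (p.1 : ℝ) / ((p.2 : ℝ) + 1)

/-- `a` is a name of the real number `x`: a sequence of rationals with
`|a n - a (n + 1)| ≤ 2 ^ (-n)` for all `n` that converges to `x`. -/
def IsName (a : ℕ → RatCode) (x : ℝ) : Prop :=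
  (∀ n, |(a n).val - (a (n + 1)).val| ≤ (1 / 2 : ℝ) ^ n) ∧
    Tendsto (fun n => (a n).val) atTop (𝓝 x)

/-- A real number is computable if it has a computable name. -/
def ComputableReal (x : ℝ) : Prop :=
  ∃ a : ℕ → RatCode, Computable a ∧ IsName a x

/-- The list of the first `k` terms of a sequence. -/
def initialPart (a : ℕ → RatCode) (k : ℕ) : List RatCode := (List.range k).map a

/-- A function `f : [0, 1] → ℝ` is computable if there is a machine that transforms every name of
every `x ∈ [0, 1]` into a name of `f x`.

The machine with the name `a` on its input tape is given by a computable function `M`: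
`M σ n = some q` says that the machine, asked for the `n`-th term of its output and having access
to the finite part `σ` of the input only, answers `q`; `M σ n = none` says that it needs more
input (or time).  On the input `a` the `n`-th term of the output is the answer that the machine
gives on some initial part of `a`; it gives no two different answers on initial parts of `a`. -/
def ComputableOnUnit (f : ℝ → ℝ) : Prop :=
  ∃ M : List RatCode → ℕ → Option RatCode, Computable₂ M ∧
    ∀ x ∈ Icc (0 : ℝ) 1, ∀ a : ℕ → RatCode, IsName a x →
      ∃ b : ℕ → RatCode, IsName b (f x) ∧
        ∀ n, (∃ k, M (initialPart a k) n = some (b n)) ∧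
          ∀ k q, M (initialPart a k) n = some q → q = b n

/-- The Euclidean plane. -/
abbrev Plane : Type := EuclideanSpace ℝ (Fin 2)

/-- A function `[0, 1] → ℝ²` is computable if its two components are. -/
def ComputablePath (f : ℝ → Plane) : Prop :=
  ∀ i : Fin 2, ComputableOnUnit (fun t => f t i)

/-! ### Simple curves and their lengths -/

/-- `f`, restricted to `[0, 1]`, is an injective continuous parametrization of the set `C`. -/
def IsInjParam (f : ℝ → Plane) (C : Set Plane) : Prop :=
  ContinuousOn f (Icc 0 1) ∧ InjOn f (Icc 0 1) ∧ f '' Icc 0 1 = C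

/-- A simple (open) plane curve: a set with an injective continuous parametrization. -/
def IsSimpleCurve (C : Set Plane) : Prop := ∃ f, IsInjParam f C

/-- The length of a simple curve: the length (supremum of the lengths of inscribed polygons) of
an injective parametrization.  All injective parametrizations have the same length
(`curveLength_eq`), so the infimum is over a set with one element. -/
noncomputable def curveLength (C : Set Plane) : ℝ≥0∞ :=
  ⨅ (f : ℝ → Plane) (_ : IsInjParam f C), eVariationOn f (Icc 0 1)

theorem eVariationOn_eq_of_isInjParam {f g : ℝ → Plane} {C : Set Plane}
    (hf : IsInjParam f C) (hg : IsInjParam g C) :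
    eVariationOn f (Icc 0 1) = eVariationOn g (Icc 0 1) := by
  obtain ⟨fc, fi, fr⟩ := hf
  obtain ⟨gc, gi, gr⟩ := hg
  have hsub : ∀ t ∈ Icc (0 : ℝ) 1, f t ∈ g '' Icc 0 1 := by
    intro t ht
    rw [gr, ← fr]
    exact mem_image_of_mem f ht
  set φ : ℝ → ℝ := fun t => Function.invFunOn g (Icc 0 1) (f t) with hφ
  have hmem : ∀ t ∈ Icc (0 : ℝ) 1, φ t ∈ Icc (0 : ℝ) 1 :=
    fun t ht => Function.invFunOn_mem (hsub t ht)
  have heq : ∀ t ∈ Icc (0 : ℝ) 1, g (φ t) = f t :=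
    fun t ht => Function.invFunOn_eq (hsub t ht)
  have himg : φ '' Icc 0 1 = Icc 0 1 := by
    apply Subset.antisymm
    · rintro _ ⟨t, ht, rfl⟩
      exact hmem t ht
    · intro s hs
      have : g s ∈ f '' Icc 0 1 := by
        rw [fr, ← gr]
        exact mem_image_of_mem g hs
      obtain ⟨t, ht, hts⟩ := this
      exact ⟨t, ht, gi (hmem t ht) hs ((heq t ht).trans hts)⟩
  have hinj : InjOn φ (Icc 0 1) := by
    intro s hs t ht hst
    apply fi hs ht
    rw [← heq s hs, ← heq t ht, hst]
  have hcont : ContinuousOn φ (Icc 0 1) := by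
    have hemb : IsClosedEmbedding ((Icc (0 : ℝ) 1).domRestrict g) :=
      (continuousOn_iff_continuous_domRestrict.1 gc).isClosedEmbedding (injOn_iff_injective.1 gi)
    have h1 : Continuous (fun t : Icc (0 : ℝ) 1 => (⟨φ t, hmem t t.2⟩ : Icc (0 : ℝ) 1)) := by
      rw [hemb.isInducing.continuous_iff]
      refine (continuousOn_iff_continuous_domRestrict.1 fc).congr fun t => ?_
      exact (heq t t.2).symm
    rw [continuousOn_iff_continuous_domRestrict]
    exact continuous_subtype_val.comp h1
  have hvar : eVariationOn f (Icc 0 1) = eVariationOn (g ∘ φ) (Icc 0 1) :=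
    eVariationOn.congr fun t ht => (heq t ht).symm
  rw [hvar]
  rcases hcont.strictMonoOn_of_injOn_Icc' zero_le_one hinj with h | h
  · rw [eVariationOn.comp_eq_of_monotoneOn g φ h.monotoneOn, himg]
  · rw [eVariationOn.comp_eq_of_antitoneOn g φ h.antitoneOn, himg]

theorem curveLength_eq {f : ℝ → Plane} {C : Set Plane} (hf : IsInjParam f C) :
    curveLength C = eVariationOn f (Icc 0 1) := by
  apply le_antisymm
  · exact iInf₂_le f hf
  · exact le_iInf₂ fun g hg => (eVariationOn_eq_of_isInjParam hf hg).le

/-- A curve is rectifiable if it has finite length. -/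
def Rectifiable (C : Set Plane) : Prop := curveLength C ≠ ∞

/-! ### Neighborhoods and the Hausdorff distance -/

/-- The (open, square) `ε`-neighborhood of a point of the plane. -/
def nbhd (ε : ℝ) (z : Plane) : Set Plane := {w | |w 0 - z 0| < ε ∧ |w 1 - z 1| < ε}

/-- The `ε`-neighborhood of a set. -/
def setNbhd (ε : ℝ) (A : Set Plane) : Set Plane := ⋃ z ∈ A, nbhd ε z

/-- The Hausdorff distance of two (non-empty bounded) sets. -/
noncomputable def hausdorffDistance (A B : Set Plane) : ℝ :=
  sInf {ε : ℝ | A ⊆ setNbhd ε B ∧ B ⊆ setNbhd ε A}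

/-- A description of a rational neighborhood: the two coordinates of its center, and its
radius. -/
abbrev NbhdCode : Type := (RatCode × RatCode) × RatCode

/-- The rational neighborhood with a given description. -/
noncomputable def NbhdCode.toSet (N : NbhdCode) : Set Plane :=
  nbhd (RatCode.val N.2) !₂[RatCode.val N.1.1, RatCode.val N.1.2]

/-- The union of a finite list of rational neighborhoods. -/
noncomputable def coverUnion (Q : List NbhdCode) : Set Plane := ⋃ N ∈ Q, NbhdCode.toSet N

/-! ### The four versions of computable curves -/

/-- `K`-computable curves: simple curves that can be computed as compact sets. -/
def KComputable (C : Set Plane) : Prop :=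
  IsSimpleCurve C ∧
    ∃ Q : ℕ → List NbhdCode, Computable Q ∧ (∀ n, ∀ N ∈ Q n, 0 < RatCode.val N.2) ∧
      ∀ n, C ⊆ coverUnion (Q n) ∧ hausdorffDistance (coverUnion (Q n)) C < (1 / 2 : ℝ) ^ n

/-- `R`-computable curves: simple curves with a computable parametrization. -/
def RComputable (C : Set Plane) : Prop :=
  IsSimpleCurve C ∧ ∃ f : ℝ → Plane, ComputablePath f ∧ f '' Icc 0 1 = C

/-- `M`-computable curves: simple curves with an injective computable parametrization. -/
def MComputable (C : Set Plane) : Prop :=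
  IsSimpleCurve C ∧
    ∃ f : ℝ → Plane, ComputablePath f ∧ InjOn f (Icc 0 1) ∧ f '' Icc 0 1 = C

/-- `N`-computable curves: simple curves of finite length with a computable parametrization `f`
such that the segment `f ([0, t])` has the length `t * l(C)` for all `t`.  (For `t = 0` the
segment is a point, and there is nothing to require.) -/
def NComputable (C : Set Plane) : Prop :=
  IsSimpleCurve C ∧ Rectifiable C ∧
    ∃ f : ℝ → Plane, ComputablePath f ∧ f '' Icc 0 1 = C ∧
      ∀ t ∈ Ioc (0 : ℝ) 1, curveLength (f '' Icc 0 t) = ENNReal.ofReal t * curveLength C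

/-- The class of rectifiable `R`-computable simple curves. -/
def classR : Set (Set Plane) := {C | RComputable C ∧ Rectifiable C}

/-- The class of rectifiable `N`-computable simple curves. -/
def classN : Set (Set Plane) := {C | NComputable C ∧ Rectifiable C}

/-- The class of computable simple curves of computable length, where a curve may be computable
in any of the four versions. -/
def classC : Set (Set Plane) :=
  {C | (KComputable C ∨ RComputable C ∨ MComputable C ∨ NComputable C) ∧
    Rectifiable C ∧ ComputableReal (curveLength C).toReal}

/-! ### Point-separability -/

/-- A point is reachable by a class of curves if it lies on some curve of the class. -/
def Reachable (𝒞 : Set (Set Plane)) (x : Plane) : Prop := ∃ C ∈ 𝒞, x ∈ C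

/-- The class `𝒞` is point-separable from the class `ℬ` if some point is reachable by `𝒞`, but
not by `ℬ`. -/
def PointSeparable (𝒞 ℬ : Set (Set Plane)) : Prop := ∃ x, Reachable 𝒞 x ∧ ¬ Reachable ℬ x

end CompCurve

/-!
Let `H` be a semidecidable set of natural numbers whose complement is not semidecidable.

The curve `K` is a zigzag curve: a segment is replaced with the two legs of an isosceles triangle,
so are the legs, and so on, where the slope of the legs in step `k` is `2 ^ (-j - 2)` if `k`
encodes a number `j` together with its first witness for `j ∈ H`, and `0` otherwise.  The slopes
are computable and have the sum at most `1 / 2`.  Hence the limit curve is injective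
(`zigLim_injOn`) and computable (`computablePath_zigPath`), and its parametrization has the
constant speed `L = ∏ √(1 + aₖ ^ 2)` (`variation_zigPath`), so that it is `N`-computable.  Its
corners, the points with dyadic parameters, are rational (`exists_zigPath_eq_pt`).  If upper bounds
of `L` could be enumerated, then so could the complement of `H`: as soon as `L` is known to be so
close to a finite part of the product that a factor with slope `2 ^ (-j - 2)` no longer fits, `j`
can enter `H` no more (`semidec_not_of_semidec_speedLim`).

A curve `C` in `classC` has finite length and is, in each of the four cases, effectively compact and
overt: its finite rational covers and the rational neighborhoods that meet it can be enumerated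
(`exists_param_of_mem_classC`).  In the case of `K`-computability this uses that a curve of finite
length has no interior points, so that tight covers consist of small neighborhoods
(`radius_tendsto`).

The heart of the proof is that, for such an arc `C` of computable length `l`, upper bounds for the
length of every subarc with rational end points can be enumerated (`semidec_arcLen_lt`).  If a
function on `C` is locally Lipschitz with constant nearly `1`, with respect to the distance in the
plane, then it cannot climb more on a piece of `C` than the length of the piece.  If moreover it
climbs nearly `l` on all of `C`, then the length of a subarc is nearly the difference of its values
at the end points, for the rest of `C` does not suffice to make up a larger deficit
(`arcLen_lt_height_sub`).  Such functions exist (`exists_potential`), and finite rational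
approximations of them can be recognized by means of the finite covers of `C`.  The local condition
concerns the distance of points in the plane, so no parametrization of `C` has to be known.

Finally, there are only countably many curves in `classC`, all closed.  If every point of `K` were on
one of them, then, by the category theorem of Baire, one of them would contain a piece of `K`
between two consecutive dyadic parameters (`exists_dyadic_subset`).  This piece would be a subarc
with rational end points (`exists_subarc`) and its length is a known rational multiple of `L`, so
that upper bounds of `L` could be enumerated.
-/

namespace CompCurve

/-! ### Semidecidable predicates -/

section Semidec

variable {α β : Type*} [Primcodable α] [Primcodable β]

/-- A predicate is semidecidable if it is the projection of a primitive recursive relation. -/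
def Semidec (p : α → Prop) : Prop :=
  ∃ R : α → ℕ → Prop, PrimrecRel R ∧ ∀ a, p a ↔ ∃ k, R a k

theorem Semidec.of_iff {p q : α → Prop} (h : Semidec p) (H : ∀ a, q a ↔ p a) : Semidec q := by
  obtain ⟨R, hR, hp⟩ := h
  exact ⟨R, hR, fun a => (H a).trans (hp a)⟩

theorem _root_.PrimrecPred.semidec {p : α → Prop} (h : PrimrecPred p) : Semidec p :=
  ⟨fun a _ => p a, h.comp Primrec.fst, fun a => by simp⟩

theorem Semidec.comp {p : β → Prop} (h : Semidec p) {f : α → β} (hf : Primrec f) :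
    Semidec fun a => p (f a) := by
  obtain ⟨R, hR, hp⟩ := h
  exact ⟨fun a k => R (f a) k, hR.comp (hf.comp Primrec.fst) Primrec.snd, fun a => hp _⟩

theorem Semidec.and {p q : α → Prop} (hp : Semidec p) (hq : Semidec q) :
    Semidec fun a => p a ∧ q a := by
  obtain ⟨R, hR, hp⟩ := hp
  obtain ⟨S, hS, hq⟩ := hq
  refine ⟨fun a k => R a k.unpair.1 ∧ S a k.unpair.2, ?_, fun a => ?_⟩
  · exact (hR.comp Primrec.fst (Primrec.fst.comp (Primrec.unpair.comp Primrec.snd))).and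
      (hS.comp Primrec.fst (Primrec.snd.comp (Primrec.unpair.comp Primrec.snd)))
  · beta_reduce
    rw [hp, hq]
    constructor
    · rintro ⟨⟨k, hk⟩, l, hl⟩
      exact ⟨Nat.pair k l, by simpa using ⟨hk, hl⟩⟩
    · rintro ⟨k, hk, hl⟩
      exact ⟨⟨_, hk⟩, _, hl⟩

theorem Semidec.exists_nat {p : α → ℕ → Prop} (h : Semidec fun x : α × ℕ => p x.1 x.2) :
    Semidec fun a => ∃ n, p a n := by
  obtain ⟨R, hR, hp⟩ := h
  refine ⟨fun a k => R (a, k.unpair.1) k.unpair.2, ?_, fun a => ?_⟩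
  · exact hR.comp (Primrec.fst.pair (Primrec.fst.comp (Primrec.unpair.comp Primrec.snd)))
      (Primrec.snd.comp (Primrec.unpair.comp Primrec.snd))
  · constructor
    · rintro ⟨n, hn⟩
      obtain ⟨k, hk⟩ := (hp (a, n)).1 hn
      exact ⟨Nat.pair n k, by simpa using hk⟩
    · rintro ⟨k, hk⟩
      exact ⟨_, (hp (a, k.unpair.1)).2 ⟨_, hk⟩⟩

theorem Semidec.exists {p : α → β → Prop} (h : Semidec fun x : α × β => p x.1 x.2) :
    Semidec fun a => ∃ b, p a b := by
  obtain ⟨R, hR, hp⟩ := h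
  classical
  have key : Semidec fun x : (α × ℕ) × ℕ =>
      ∃ b, Encodable.decode (α := β) x.1.2 = some b ∧ R (x.1.1, b) x.2 := by
    refine PrimrecPred.semidec (p := fun x : (α × ℕ) × ℕ =>
      ∃ b, Encodable.decode (α := β) x.1.2 = some b ∧ R (x.1.1, b) x.2) ?_
    have h1 : Primrec fun x : (α × ℕ) × ℕ =>
        ((Encodable.decode (α := β) x.1.2).map fun b => decide (R (x.1.1, b) x.2)) :=
      Primrec.option_map (Primrec.decode.comp (Primrec.snd.comp Primrec.fst))
        (hR.decide.comp
          ((Primrec.fst.comp (Primrec.fst.comp Primrec.fst)).pair Primrec.snd)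
          (Primrec.snd.comp Primrec.fst)).to₂
    refine (Primrec.eq.comp h1 (Primrec.const (some true))).of_eq fun x => ?_
    simp
  have key' := Semidec.exists_nat (p := fun (x : α × ℕ) k =>
    ∃ b, Encodable.decode (α := β) x.2 = some b ∧ R (x.1, b) k) key
  refine (Semidec.exists_nat (p := fun a n => ∃ k,
    ∃ b, Encodable.decode (α := β) n = some b ∧ R (a, b) k) key').of_iff fun a => ?_
  constructor
  · rintro ⟨b, hb⟩
    obtain ⟨k, hk⟩ := (hp (a, b)).1 hb
    exact ⟨Encodable.encode b, k, b, by simp, hk⟩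
  · rintro ⟨n, k, b, -, hb⟩
    exact ⟨b, (hp (a, b)).2 ⟨k, hb⟩⟩

theorem Semidec.exists_mem {p : α → β → Prop} (h : Semidec fun x : α × β => p x.1 x.2)
    {l : α → List β} (hl : Primrec l) : Semidec fun a => ∃ b ∈ l a, p a b := by
  classical
  have hmem : PrimrecPred fun x : α × β => x.2 ∈ l x.1 := by
    have := (PrimrecRel.exists_mem_list (R := fun a b : β => a = b) Primrec.eq).comp
      (hl.comp (Primrec.fst (α := α) (β := β))) Primrec.snd
    exact this.of_eq fun x => by simp
  exact Semidec.exists (p := fun a b => b ∈ l a ∧ p a b) (hmem.semidec.and h)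

/-- Witnesses for the finitely many members of a list have a common bound. -/
theorem Semidec.forall_mem {p : α → β → Prop} (h : Semidec fun x : α × β => p x.1 x.2)
    {l : α → List β} (hl : Primrec l) : Semidec fun a => ∀ b ∈ l a, p a b := by
  obtain ⟨R, hR, hp⟩ := h
  have h1 : PrimrecRel fun (n : ℕ) (y : β × α) => ∃ k < n, R (y.2, y.1) k :=
    ((PrimrecRel.exists_mem_list (R := fun k (y : β × α) => R (y.2, y.1) k)
      (hR.comp ((Primrec.snd.comp Primrec.snd).pair (Primrec.fst.comp Primrec.snd))
        Primrec.fst)).comp (Primrec.list_range.comp Primrec.fst) Primrec.snd).of_eq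
      fun x => by simp
  have h2 : PrimrecRel fun (L : List β) (y : ℕ × α) => ∀ b ∈ L, ∃ k < y.1, R (y.2, b) k :=
    PrimrecRel.forall_mem_list (R := fun b (y : ℕ × α) => ∃ k < y.1, R (y.2, b) k)
      (h1.comp (Primrec.fst.comp Primrec.snd)
        (Primrec.fst.pair (Primrec.snd.comp Primrec.snd)))
  refine ⟨fun a n => ∀ b ∈ l a, ∃ k < n, R (a, b) k,
    h2.comp (hl.comp Primrec.fst) (Primrec.snd.pair Primrec.fst), fun a => ?_⟩
  constructor
  · intro H
    have H' : ∀ b ∈ l a, ∃ k, R (a, b) k := fun b hb => (hp (a, b)).1 (H b hb)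
    clear H
    beta_reduce
    generalize l a = L at H' ⊢
    induction L with
    | nil => exact ⟨0, by simp⟩
    | cons b L ih =>
      obtain ⟨n, hn⟩ := ih fun b hb => H' b (List.mem_cons_of_mem _ hb)
      obtain ⟨k, hk⟩ := H' b List.mem_cons_self
      refine ⟨max n (k + 1), fun c hc => ?_⟩
      rcases List.mem_cons.1 hc with rfl | hc
      · exact ⟨k, by simp, hk⟩
      · obtain ⟨m, hm, hR⟩ := hn c hc
        exact ⟨m, lt_max_of_lt_left hm, hR⟩
  · rintro ⟨n, hn⟩ b hb
    obtain ⟨k, -, hk⟩ := hn b hb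
    exact (hp (a, b)).2 ⟨k, hk⟩

/-- The graph of a computable function is semidecidable: the primitive recursive relation bounds
the running time. -/
theorem Semidec.graph {f : α → β} (hf : Computable f) :
    Semidec fun x : α × β => f x.1 = x.2 := by
  obtain ⟨c, hc⟩ := Nat.Partrec.Code.exists_code.1 hf
  classical
  refine ⟨fun x k => Nat.Partrec.Code.evaln k c (Encodable.encode x.1)
    = some (Encodable.encode x.2), ?_, fun x => ?_⟩
  · exact Primrec.eq.comp (Nat.Partrec.Code.primrec_evaln.comp
      (((Primrec.snd).pair (Primrec.const c)).pair
        (Primrec.encode.comp (Primrec.fst.comp Primrec.fst))))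
      (Primrec.option_some.comp (Primrec.encode.comp (Primrec.snd.comp Primrec.fst)))
  · have h1 : Nat.Partrec.Code.eval c (Encodable.encode x.1) =
        Part.some (Encodable.encode (f x.1)) := by
      rw [hc]; simp
    beta_reduce
    rw [← Encodable.encode_inj (a := f x.1)]
    constructor
    · intro h
      have : Encodable.encode x.2 ∈ Nat.Partrec.Code.eval c (Encodable.encode x.1) := by
        rw [h1, h]; simp
      exact Nat.Partrec.Code.evaln_complete.1 this
    · rintro ⟨k, hk⟩
      have := Nat.Partrec.Code.evaln_sound (Option.mem_def.2 hk)
      rw [h1] at this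
      exact (Part.mem_some_iff.1 this).symm

theorem Semidec.rePred {p : α → Prop} (h : Semidec p) : REPred p := by
  obtain ⟨R, hR, hp⟩ := h
  classical
  have : Partrec fun a => Nat.rfind fun k => (Part.some (decide (R a k)) : Part Bool) :=
    Partrec.rfind (p := fun a k => Part.some (decide (R a k))) hR.decide.to_comp
  refine this.dom_re.of_eq fun a => ?_
  rw [hp]
  refine Nat.rfind_dom.trans ⟨?_, ?_⟩
  · rintro ⟨n, hn, -⟩
    exact ⟨n, by simpa using hn⟩
  · rintro ⟨n, hn⟩
    exact ⟨n, by simpa using hn, fun _ => trivial⟩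

variable (α) in
/-- There are only countably many semidecidable predicates, as there are only countably many
programs. -/
theorem countable_semidec : {p : α → Prop | Semidec p}.Countable := by
  have : ∀ p : {p : α → Prop | Semidec p}, ∃ c : Nat.Partrec.Code,
      ∀ a, p.1 a ↔ (Nat.Partrec.Code.eval c (Encodable.encode a)).Dom := by
    rintro ⟨p, hp⟩
    obtain ⟨c, hc⟩ := Nat.Partrec.Code.exists_code.1 hp.rePred
    exact ⟨c, fun a => by rw [hc]; simp [Part.assert]⟩
  choose c hc using this
  have hinj : Function.Injective c := by
    intro p q hpq
    ext a
    rw [hc, hc, hpq]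
  exact hinj.countable

end Semidec

/-! ### Primitive recursive rational arithmetic -/

section Arith

theorem encode_int (z : ℤ) :
    Encodable.encode z = if 0 ≤ z then 2 * z.toNat else 2 * (-z - 1).toNat + 1 := by
  cases z with
  | ofNat n => simp; rfl
  | negSucc n =>
    have h : ¬ (0 : ℤ) ≤ Int.negSucc n := by simp
    rw [if_neg h]
    have : (-(Int.negSucc n) - 1).toNat = n := by simp [Int.negSucc_eq]
    rw [this]; rfl

theorem primrec_int_natSub : Primrec₂ fun m n : ℕ => (m : ℤ) - n := by
  rw [← Primrec₂.encode_iff]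
  have : Primrec fun p : ℕ × ℕ => if p.2 ≤ p.1 then 2 * (p.1 - p.2) else 2 * (p.2 - p.1 - 1) + 1 :=
    Primrec.ite (Primrec.nat_le.comp Primrec.snd Primrec.fst)
      (Primrec.nat_double.comp (Primrec.nat_sub.comp Primrec.fst Primrec.snd))
      (Primrec.nat_double_succ.comp (Primrec.nat_sub.comp
        (Primrec.nat_sub.comp Primrec.snd Primrec.fst) (Primrec.const 1)))
  refine this.of_eq fun p => ?_
  beta_reduce
  rw [encode_int]
  split_ifs <;> omega

theorem primrec_int_toNat : Primrec Int.toNat := by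
  have : Primrec fun z : ℤ => if (Encodable.encode z).bodd then 0 else (Encodable.encode z).div2 :=
    Primrec.ite (Primrec.eq.comp (Primrec.nat_bodd.comp Primrec.encode) (Primrec.const true))
      (Primrec.const 0) (Primrec.nat_div2.comp Primrec.encode)
  refine this.of_eq fun z => ?_
  rw [encode_int]
  by_cases h : 0 ≤ z
  · simp [h, Nat.div2_val]
  · simp [h]; omega

theorem primrec_int_neg : Primrec fun z : ℤ => -z := by
  have : Primrec fun z : ℤ => if (Encodable.encode z).bodd then
      (((Encodable.encode z).div2 + 1 : ℕ) : ℤ) - (0 : ℕ)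
      else ((0 : ℕ) : ℤ) - ((Encodable.encode z).div2 : ℕ) :=
    Primrec.ite (Primrec.eq.comp (Primrec.nat_bodd.comp Primrec.encode) (Primrec.const true))
      (primrec_int_natSub.comp (Primrec.succ.comp (Primrec.nat_div2.comp Primrec.encode))
        (Primrec.const 0))
      (primrec_int_natSub.comp (Primrec.const 0) (Primrec.nat_div2.comp Primrec.encode))
  refine this.of_eq fun z => ?_
  rw [encode_int]
  by_cases h : 0 ≤ z
  · simp [h, Nat.div2_val]
  · simp [h, Nat.div2_val]; omega

theorem primrec_int_negPart : Primrec fun z : ℤ => (-z).toNat :=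
  primrec_int_toNat.comp primrec_int_neg

theorem primrec_int_add : Primrec₂ fun z w : ℤ => z + w := by
  have : Primrec fun p : ℤ × ℤ => ((p.1.toNat + p.2.toNat : ℕ) : ℤ)
      - ((-p.1).toNat + (-p.2).toNat : ℕ) :=
    primrec_int_natSub.comp
      (Primrec.nat_add.comp (primrec_int_toNat.comp Primrec.fst)
        (primrec_int_toNat.comp Primrec.snd))
      (Primrec.nat_add.comp (primrec_int_negPart.comp Primrec.fst)
        (primrec_int_negPart.comp Primrec.snd))
  refine this.of_eq fun p => ?_
  beta_reduce
  omega

theorem primrec_int_mul : Primrec₂ fun z w : ℤ => z * w := by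
  have : Primrec fun p : ℤ × ℤ =>
      ((p.1.toNat * p.2.toNat + (-p.1).toNat * (-p.2).toNat : ℕ) : ℤ)
      - (p.1.toNat * (-p.2).toNat + (-p.1).toNat * p.2.toNat : ℕ) := by
    have h1 := primrec_int_toNat.comp (Primrec.fst (α := ℤ) (β := ℤ))
    have h2 := primrec_int_toNat.comp (Primrec.snd (α := ℤ) (β := ℤ))
    have h3 := primrec_int_negPart.comp (Primrec.fst (α := ℤ) (β := ℤ))
    have h4 := primrec_int_negPart.comp (Primrec.snd (α := ℤ) (β := ℤ))
    exact primrec_int_natSub.comp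
      (Primrec.nat_add.comp (Primrec.nat_mul.comp h1 h2) (Primrec.nat_mul.comp h3 h4))
      (Primrec.nat_add.comp (Primrec.nat_mul.comp h1 h4) (Primrec.nat_mul.comp h3 h2))
  refine this.of_eq fun p => ?_
  have e1 : p.1 = (p.1.toNat : ℤ) - ((-p.1).toNat : ℤ) := by omega
  have e2 : p.2 = (p.2.toNat : ℤ) - ((-p.2).toNat : ℤ) := by omega
  conv_rhs => rw [e1, e2]
  push_cast
  ring

theorem primrec_int_cast : Primrec fun n : ℕ => (n : ℤ) :=
  (primrec_int_natSub.comp Primrec.id (Primrec.const 0)).of_eq fun n => by simp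

theorem primrecRel_int_lt : PrimrecRel fun z w : ℤ => z < w := by
  have : PrimrecPred fun p : ℤ × ℤ => p.1.toNat + (-p.2).toNat < p.2.toNat + (-p.1).toNat :=
    Primrec.nat_lt.comp
      (Primrec.nat_add.comp (primrec_int_toNat.comp Primrec.fst)
        (primrec_int_negPart.comp Primrec.snd))
      (Primrec.nat_add.comp (primrec_int_toNat.comp Primrec.snd)
        (primrec_int_negPart.comp Primrec.fst))
  exact this.of_eq fun p => by omega

variable {α β : Type*} [Primcodable α] [Primcodable β]

/-- A real-valued function is primitive recursive with rational values if a primitive recursive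
function computes codes of its values.  Working with the values in `ℝ` keeps the arithmetic of
codes, which are not reduced fractions, out of the statements. -/
def PrimrecRat (F : α → ℝ) : Prop := ∃ f : α → RatCode, Primrec f ∧ ∀ a, F a = (f a).val

theorem PrimrecRat.of_eq {F G : α → ℝ} (hF : PrimrecRat F) (h : ∀ a, G a = F a) :
    PrimrecRat G := by
  rwa [show G = F from funext h]

theorem primrecRat_val {f : α → RatCode} (hf : Primrec f) : PrimrecRat fun a => (f a).val :=
  ⟨f, hf, fun _ => rfl⟩

theorem PrimrecRat.comp {F : β → ℝ} (hF : PrimrecRat F) {g : α → β} (hg : Primrec g) :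
    PrimrecRat fun a => F (g a) := by
  obtain ⟨f, hf, h⟩ := hF
  exact ⟨fun a => f (g a), hf.comp hg, fun a => h _⟩

theorem PrimrecRat.const (z : ℤ) : PrimrecRat fun _ : α => (z : ℝ) :=
  ⟨fun _ => (z, 0), Primrec.const _, fun _ => by simp [RatCode.val]⟩

theorem PrimrecRat.ofNat (n : ℕ) [n.AtLeastTwo] : PrimrecRat fun _ : α => (OfNat.ofNat n : ℝ) :=
  (PrimrecRat.const (n : ℤ)).of_eq fun _ => by simp; rfl

theorem PrimrecRat.one : PrimrecRat fun _ : α => (1 : ℝ) :=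
  (PrimrecRat.const 1).of_eq fun _ => by simp

theorem PrimrecRat.zero : PrimrecRat fun _ : α => (0 : ℝ) :=
  (PrimrecRat.const 0).of_eq fun _ => by simp

theorem PrimrecRat.natCast {f : α → ℕ} (hf : Primrec f) : PrimrecRat fun a => (f a : ℝ) :=
  ⟨fun a => ((f a : ℤ), 0), (primrec_int_cast.comp hf).pair (Primrec.const 0),
    fun _ => by simp [RatCode.val]⟩

theorem PrimrecRat.inv_succ {f : α → ℕ} (hf : Primrec f) :
    PrimrecRat fun a => (1 : ℝ) / (f a + 1) :=
  ⟨fun a => (1, f a), (Primrec.const 1).pair hf, fun _ => by simp [RatCode.val]⟩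

theorem primrec_add_mul_succ : Primrec fun p : ℕ × ℕ => p.1 * p.2 + p.1 + p.2 :=
  Primrec.nat_add.comp (Primrec.nat_add.comp
    (Primrec.nat_mul.comp Primrec.fst Primrec.snd) Primrec.fst) Primrec.snd

theorem PrimrecRat.mul {F G : α → ℝ} (hF : PrimrecRat F) (hG : PrimrecRat G) :
    PrimrecRat fun a => F a * G a := by
  obtain ⟨f, hf, hF⟩ := hF
  obtain ⟨g, hg, hG⟩ := hG
  refine ⟨fun a => ((f a).1 * (g a).1, (f a).2 * (g a).2 + (f a).2 + (g a).2), ?_, fun a => ?_⟩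
  · exact (primrec_int_mul.comp (Primrec.fst.comp hf) (Primrec.fst.comp hg)).pair
      (primrec_add_mul_succ.comp ((Primrec.snd.comp hf).pair (Primrec.snd.comp hg)))
  · beta_reduce
    rw [hF, hG]
    simp only [RatCode.val]
    push_cast
    have h1 : ((f a).2 : ℝ) + 1 ≠ 0 := by positivity
    have h2 : ((g a).2 : ℝ) + 1 ≠ 0 := by positivity
    have h3 : ((f a).2 : ℝ) * (g a).2 + (f a).2 + (g a).2 + 1
      = (((f a).2 : ℝ) + 1) * ((g a).2 + 1) := by ring
    rw [h3]
    field_simp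

theorem PrimrecRat.add {F G : α → ℝ} (hF : PrimrecRat F) (hG : PrimrecRat G) :
    PrimrecRat fun a => F a + G a := by
  obtain ⟨f, hf, hF⟩ := hF
  obtain ⟨g, hg, hG⟩ := hG
  refine ⟨fun a => ((f a).1 * (((g a).2 + 1 : ℕ) : ℤ) + (g a).1 * (((f a).2 + 1 : ℕ) : ℤ),
    (f a).2 * (g a).2 + (f a).2 + (g a).2), ?_, fun a => ?_⟩
  · exact (primrec_int_add.comp
      (primrec_int_mul.comp (Primrec.fst.comp hf)
        (primrec_int_cast.comp (Primrec.succ.comp (Primrec.snd.comp hg))))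
      (primrec_int_mul.comp (Primrec.fst.comp hg)
        (primrec_int_cast.comp (Primrec.succ.comp (Primrec.snd.comp hf))))).pair
      (primrec_add_mul_succ.comp ((Primrec.snd.comp hf).pair (Primrec.snd.comp hg)))
  · beta_reduce
    rw [hF, hG]
    simp only [RatCode.val]
    push_cast
    have h1 : ((f a).2 : ℝ) + 1 ≠ 0 := by positivity
    have h2 : ((g a).2 : ℝ) + 1 ≠ 0 := by positivity
    have h3 : ((f a).2 : ℝ) * (g a).2 + (f a).2 + (g a).2 + 1
      = (((f a).2 : ℝ) + 1) * ((g a).2 + 1) := by ring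
    rw [h3]
    field_simp

theorem PrimrecRat.neg {F : α → ℝ} (hF : PrimrecRat F) : PrimrecRat fun a => -F a :=
  ((PrimrecRat.const (-1)).mul hF).of_eq fun a => by simp

theorem PrimrecRat.sub {F G : α → ℝ} (hF : PrimrecRat F) (hG : PrimrecRat G) :
    PrimrecRat fun a => F a - G a :=
  (hF.add hG.neg).of_eq fun _ => sub_eq_add_neg _ _

theorem PrimrecRat.lt {F G : α → ℝ} (hF : PrimrecRat F) (hG : PrimrecRat G) :
    PrimrecPred fun a => F a < G a := by
  obtain ⟨h, hh, H⟩ := hG.sub hF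
  refine (primrecRel_int_lt.comp (Primrec.const 0) (Primrec.fst.comp hh)).of_eq fun a => ?_
  have h1 : G a - F a = (h a).val := H a
  rw [← sub_pos (a := G a), h1, RatCode.val, div_pos_iff_of_pos_right (by positivity)]
  simp

theorem PrimrecRat.le {F G : α → ℝ} (hF : PrimrecRat F) (hG : PrimrecRat G) :
    PrimrecPred fun a => F a ≤ G a :=
  (hG.lt hF).not.of_eq fun _ => not_lt

theorem PrimrecRat.abs_lt {F G : α → ℝ} (hF : PrimrecRat F) (hG : PrimrecRat G) :
    PrimrecPred fun a => |F a| < G a :=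
  ((hG.neg.lt hF).and (hF.lt hG)).of_eq fun _ => _root_.abs_lt.symm

theorem PrimrecRat.ite {c : α → Prop} [DecidablePred c] (hc : PrimrecPred c) {F G : α → ℝ}
    (hF : PrimrecRat F) (hG : PrimrecRat G) : PrimrecRat fun a => if c a then F a else G a := by
  obtain ⟨f, hf, hF⟩ := hF
  obtain ⟨g, hg, hG⟩ := hG
  refine ⟨fun a => if c a then f a else g a, Primrec.ite hc hf hg, fun a => ?_⟩
  beta_reduce
  split_ifs
  · exact hF a
  · exact hG a

theorem PrimrecRat.abs {F : α → ℝ} (hF : PrimrecRat F) : PrimrecRat fun a => |F a| := by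
  classical
  refine (PrimrecRat.ite (hF.lt PrimrecRat.zero) hF.neg hF).of_eq fun a => ?_
  split_ifs with h
  · exact abs_of_neg h
  · exact abs_of_nonneg (not_lt.1 h)

theorem PrimrecRat.half_pow {f : α → ℕ} (hf : Primrec f) :
    PrimrecRat fun a => (1 / 2 : ℝ) ^ f a := by
  have h2 : Primrec fun n : ℕ => 2 ^ n := by
    refine (Primrec.nat_rec₁ (f := fun _ m => 2 * m) 1
      (Primrec.nat_double.comp Primrec.snd).to₂).of_eq fun n => ?_
    induction n with
    | zero => rfl
    | succ n ih => simp only [ih, pow_succ]; ring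
  refine (PrimrecRat.inv_succ (f := fun a => 2 ^ f a - 1)
    (Primrec.nat_sub.comp (h2.comp hf) (Primrec.const 1))).of_eq fun a => ?_
  have : ((2 ^ f a - 1 : ℕ) : ℝ) + 1 = 2 ^ f a := by
    have : 1 ≤ 2 ^ f a := Nat.one_le_two_pow
    push_cast [Nat.cast_sub this]; ring
  rw [this]; simp

/-- Rational numbers with a code are dense. -/
theorem exists_ratCode_near (x : ℝ) {ε : ℝ} (hε : 0 < ε) : ∃ q : RatCode, |q.val - x| < ε := by
  obtain ⟨q, hq⟩ := exists_rat_near x hε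
  refine ⟨(q.num, q.den - 1), ?_⟩
  have : RatCode.val (q.num, q.den - 1) = q := by
    have h1 : ((q.den - 1 : ℕ) : ℝ) + 1 = q.den := by
      have := q.den_pos
      rw [Nat.cast_sub this]; simp
    rw [RatCode.val, h1]
    exact (Rat.cast_def q).symm
  rw [this, abs_sub_comm]
  exact hq

end Arith

/-! ### Height functions along an arc -/

section Heights

variable {E : Type*} [MetricSpace E] {g : ℝ → E}

/-- If `h` is a relation between parameters and heights such that heights of points at distance at
most `ρ` differ by at most `τ`, then an arc of length at most `n * ρ` climbs at most `(n + 1) * τ`: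
the arc is traversed in hops of size `ρ`. -/
theorem abs_height_sub_le_of_variation_le (hg : ContinuousOn g (Icc 0 1)) {ρ τ : ℝ} (hρ : 0 < ρ)
    {R : ℝ → ℝ → Prop} (hR : ∀ s ∈ Icc (0 : ℝ) 1, ∃ h, R s h)
    (hloc : ∀ s ∈ Icc (0 : ℝ) 1, ∀ t ∈ Icc (0 : ℝ) 1, ∀ h k, R s h → R t k →
      dist (g s) (g t) ≤ ρ → |h - k| ≤ τ) (n : ℕ) :
    ∀ s t h k, 0 ≤ s → s ≤ t → t ≤ 1 →
      eVariationOn g (Icc s t) ≤ ENNReal.ofReal (n * ρ) → R s h → R t k →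
      |h - k| ≤ (n + 1) * τ := by
  induction n with
  | zero =>
    intro s t h k hs hst ht hv hsh htk
    have h1 := (eVariationOn.edist_le g (left_mem_Icc.2 hst) (right_mem_Icc.2 hst)).trans hv
    have h2 : dist (g s) (g t) ≤ ρ := by
      have : edist (g s) (g t) = 0 := by simpa using h1
      rw [edist_eq_zero] at this
      rw [this, dist_self]; exact hρ.le
    have := hloc s ⟨hs, hst.trans ht⟩ t ⟨hs.trans hst, ht⟩ h k hsh htk h2
    simpa using this
  | succ n ih =>
    intro s t h k hs hst ht hv hsh htk
    have hsI : s ∈ Icc (0 : ℝ) 1 := ⟨hs, hst.trans ht⟩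
    have htI : t ∈ Icc (0 : ℝ) 1 := ⟨hs.trans hst, ht⟩
    have hτ : 0 ≤ τ := (abs_nonneg _).trans
      (hloc s hsI s hsI h h hsh hsh (by rw [dist_self]; exact hρ.le))
    rcases le_total (dist (g s) (g t)) ρ with hd | hd
    · have := hloc s hsI t htI h k hsh htk hd
      have h3 : 0 ≤ ((n : ℝ) + 1) * τ := by positivity
      push_cast
      nlinarith
    · have hc : ContinuousOn (fun r => dist (g s) (g r)) (Icc s t) :=
        continuous_dist.comp_continuousOn
          (continuousOn_const.prodMk (hg.mono (Icc_subset_Icc hs ht)))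
      obtain ⟨r, ⟨hsr, hrt⟩, hr⟩ := intermediate_value_Icc hst hc
        (show ρ ∈ Icc _ _ from ⟨by rw [dist_self]; exact hρ.le, hd⟩)
      have hr : dist (g s) (g r) = ρ := hr
      have hrI : r ∈ Icc (0 : ℝ) 1 := ⟨hs.trans hsr, hrt.trans ht⟩
      obtain ⟨m, hm⟩ := hR r hrI
      have h1 := hloc s hsI r hrI h m hsh hm hr.le
      have hadd := eVariationOn.Icc_add_Icc g (s := univ) hsr hrt (mem_univ _)
      simp only [univ_inter] at hadd
      have h2 : ENNReal.ofReal ρ ≤ eVariationOn g (Icc s r) := by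
        rw [← hr, ← edist_dist]
        exact eVariationOn.edist_le g (left_mem_Icc.2 hsr) (right_mem_Icc.2 hsr)
      have h3 : eVariationOn g (Icc r t) ≤ ENNReal.ofReal (n * ρ) := by
        have h4 : ENNReal.ofReal ρ + eVariationOn g (Icc r t)
            ≤ ENNReal.ofReal ρ + ENNReal.ofReal (n * ρ) := by
          rw [← ENNReal.ofReal_add hρ.le (by positivity)]
          refine (add_le_add_left h2 _).trans ?_
          rw [hadd]
          refine hv.trans (ENNReal.ofReal_le_ofReal ?_)
          push_cast; linarith
        exact (ENNReal.add_le_add_iff_left ENNReal.ofReal_ne_top).1 h4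
      have h5 := ih r t m k (hs.trans hsr) hrt ht h3 hm htk
      have h6 := abs_sub_le h m k
      push_cast
      linarith

/-- The length of the arc between two parameters, as a real number. -/
noncomputable def arcLen (g : ℝ → E) (s t : ℝ) : ℝ := (eVariationOn g (Icc s t)).toReal

theorem arcLen_nonneg (s t : ℝ) : 0 ≤ arcLen g s t := ENNReal.toReal_nonneg

theorem variation_Icc_ne_top (hv : eVariationOn g (Icc 0 1) ≠ ∞) {s t : ℝ} (hs : 0 ≤ s)
    (ht : t ≤ 1) : eVariationOn g (Icc s t) ≠ ∞ :=
  ne_top_of_le_ne_top hv (eVariationOn.mono _ (Icc_subset_Icc hs ht))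

theorem arcLen_add (hv : eVariationOn g (Icc 0 1) ≠ ∞) {r s t : ℝ} (hr : 0 ≤ r) (hrs : r ≤ s)
    (hst : s ≤ t) (ht : t ≤ 1) : arcLen g r s + arcLen g s t = arcLen g r t := by
  have hadd := eVariationOn.Icc_add_Icc g (s := univ) hrs hst (mem_univ _)
  simp only [univ_inter] at hadd
  rw [arcLen, arcLen, arcLen, ← hadd, ENNReal.toReal_add]
  · exact variation_Icc_ne_top hv hr (hst.trans ht)
  · exact variation_Icc_ne_top hv (hr.trans hrs) ht

/-- Heights that satisfy an approximate Lipschitz condition at the scale `ρ` grow at most as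
fast as the arc length, up to an error of order `ε`. -/
theorem abs_height_sub_le (hg : ContinuousOn g (Icc 0 1)) (hv : eVariationOn g (Icc 0 1) ≠ ∞)
    {ρ ε : ℝ} (hρ : 0 < ρ) (hρε : ρ ≤ ε) (hε : ε ≤ 1)
    {R : ℝ → ℝ → Prop} (hR : ∀ s ∈ Icc (0 : ℝ) 1, ∃ h, R s h)
    (hloc : ∀ s ∈ Icc (0 : ℝ) 1, ∀ t ∈ Icc (0 : ℝ) 1, ∀ h k, R s h → R t k →
      dist (g s) (g t) ≤ ρ → |h - k| ≤ ρ * (1 + ε)) {s t h k : ℝ} (hs : 0 ≤ s) (hst : s ≤ t)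
    (ht : t ≤ 1) (hsh : R s h) (htk : R t k) :
    |h - k| ≤ arcLen g s t + ε * (arcLen g 0 1 + 4) := by
  set v := arcLen g s t with hvdef
  set l := arcLen g 0 1 with hldef
  have hv0 : 0 ≤ v := arcLen_nonneg _ _
  have hvl : v ≤ l := by
    have h1 := arcLen_add hv le_rfl (hs.trans hst) ht le_rfl
    have h2 := arcLen_add hv le_rfl hs hst ht
    have h3 := arcLen_nonneg (g := g) 0 s
    have h4 := arcLen_nonneg (g := g) t 1
    linarith
  have hn := Nat.le_ceil (v / ρ)
  have hn' := Nat.ceil_lt_add_one (div_nonneg hv0 hρ.le)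
  set n := ⌈v / ρ⌉₊
  have hvn : v ≤ n * ρ := (div_le_iff₀ hρ).1 hn
  have h1 := abs_height_sub_le_of_variation_le hg hρ hR hloc n s t h k hs hst ht
    (by rw [← ENNReal.ofReal_toReal (variation_Icc_ne_top hv hs ht)]
        exact ENNReal.ofReal_le_ofReal hvn) hsh htk
  have h2 : (n : ℝ) * ρ ≤ v + ρ := by
    have : (n : ℝ) * ρ < (v / ρ + 1) * ρ := by gcongr
    rw [add_mul, div_mul_cancel₀ _ hρ.ne'] at this
    linarith
  have hε0 : 0 < ε := hρ.trans_le hρε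
  calc |h - k| ≤ (n + 1) * (ρ * (1 + ε)) := h1
    _ = (n * ρ + ρ) * (1 + ε) := by ring
    _ ≤ (v + 2 * ρ) * (1 + ε) := by
        apply mul_le_mul_of_nonneg_right _ (by linarith)
        linarith
    _ = v + v * ε + 2 * ρ + 2 * ρ * ε := by ring
    _ ≤ v + l * ε + 2 * ε + 2 * ε := by
        have : v * ε ≤ l * ε := by gcongr
        have : ρ * ε ≤ ε * 1 := by gcongr
        linarith
    _ = v + ε * (l + 4) := by ring

/-- If approximately Lipschitz heights along an arc span nearly the whole length `l` of the arc,
then the length of a subarc is at most the difference of the heights of its end points, up to an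
error of order `ε`: the two other pieces of the arc cannot climb more than their lengths. -/
theorem arcLen_lt_height_sub (hg : ContinuousOn g (Icc 0 1))
    (hv : eVariationOn g (Icc 0 1) ≠ ∞)
    {ρ ε : ℝ} (hρ : 0 < ρ) (hρε : ρ ≤ ε) (hε : ε ≤ 1)
    {R : ℝ → ℝ → Prop} (hR : ∀ s ∈ Icc (0 : ℝ) 1, ∃ h, R s h)
    (hloc : ∀ s ∈ Icc (0 : ℝ) 1, ∀ t ∈ Icc (0 : ℝ) 1, ∀ h k, R s h → R t k →
      dist (g s) (g t) ≤ ρ → |h - k| ≤ ρ * (1 + ε))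
    {a b s t x y h k : ℝ} (ha : 0 ≤ a) (hab : a ≤ b) (hb : b ≤ 1) (hax : R a x) (hby : R b y)
    (hs : s ∈ Icc (0 : ℝ) 1) (ht : t ∈ Icc (0 : ℝ) 1) (hsh : R s h) (htk : R t k)
    (hl : arcLen g 0 1 < |h - k| + ε) :
    arcLen g a b < |x - y| + (4 * arcLen g 0 1 + 19) * ε := by
  set l := arcLen g 0 1 with hldef
  set V : ℝ → ℝ := fun r => arcLen g 0 r with hV
  have hVsub : ∀ r q, 0 ≤ r → r ≤ q → q ≤ 1 → arcLen g r q = V q - V r := by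
    intro r q h1 h2 h3
    have := arcLen_add hv le_rfl h1 h2 h3
    simp only [hV]; linarith
  have hV0 : ∀ r, 0 ≤ V r := fun r => arcLen_nonneg _ _
  have hVl : ∀ r ∈ Icc (0 : ℝ) 1, V r ≤ l := by
    intro r hr
    have h1 := hVsub r 1 hr.1 hr.2 le_rfl
    have h2 : V 1 = l := rfl
    have h3 := arcLen_nonneg (g := g) r 1
    linarith
  have key : ∀ r ∈ Icc (0 : ℝ) 1, ∀ q ∈ Icc (0 : ℝ) 1, ∀ u w, R r u → R q w →
      |u - w| ≤ |V r - V q| + ε * (l + 4) := by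
    intro r hr q hq u w hu hw
    rcases le_total r q with h | h
    · have h1 := abs_height_sub_le hg hv hρ hρε hε hR hloc hr.1 h hq.2 hu hw
      rw [hVsub r q hr.1 h hq.2] at h1
      have := neg_abs_le (V r - V q)
      linarith
    · have h1 := abs_height_sub_le hg hv hρ hρε hε hR hloc hq.1 h hr.2 hw hu
      rw [hVsub q r hq.1 h hr.2] at h1
      have := le_abs_self (V r - V q)
      rw [abs_sub_comm]
      linarith
  have haI : a ∈ Icc (0 : ℝ) 1 := ⟨ha, hab.trans hb⟩
  have hbI : b ∈ Icc (0 : ℝ) 1 := ⟨ha.trans hab, hb⟩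
  have hVab : arcLen g a b = V b - V a := hVsub a b ha hab hb
  have hVab0 : 0 ≤ V b - V a := hVab ▸ arcLen_nonneg _ _
  rw [hVab]
  have k1 := key s hs t ht h k hsh htk
  have hε0 : 0 < ε := hρ.trans_le hρε
  have hVa := hV0 a
  have hVb := hVl b hbI
  have hVs := hV0 s
  have hVt := hV0 t
  have hVs' := hVl s hs
  have hVt' := hVl t ht
  rcases le_total (V s) (V t) with hst | hst
  · have k2 := key s hs a haI h x hsh hax
    have k3 := key b hbI t ht y k hby htk
    have k4 : |h - k| ≤ |h - x| + (|x - y| + |y - k|) :=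
      (abs_sub_le h x k).trans (add_le_add_right (abs_sub_le x y k) _)
    rw [abs_of_nonpos (by linarith : V s - V t ≤ 0)] at k1
    have k5 : |V s - V a| ≤ V a + (ε + ε * (l + 4)) := abs_le.2 ⟨by linarith, by linarith⟩
    have k6 : |V b - V t| ≤ (l - V b) + (ε + ε * (l + 4)) := abs_le.2 ⟨by linarith, by linarith⟩
    linarith
  · have k2 := key s hs b hbI h y hsh hby
    have k3 := key a haI t ht x k hax htk
    have k4 : |h - k| ≤ |h - y| + (|y - x| + |x - k|) :=
      (abs_sub_le h y k).trans (add_le_add_right (abs_sub_le y x k) _)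
    rw [abs_sub_comm y x] at k4
    rw [abs_of_nonneg (by linarith : 0 ≤ V s - V t)] at k1
    have k5 : |V s - V b| ≤ (l - V b) + (ε + ε * (l + 4)) := abs_le.2 ⟨by linarith, by linarith⟩
    have k6 : |V a - V t| ≤ V a + (ε + ε * (l + 4)) := abs_le.2 ⟨by linarith, by linarith⟩
    linarith

/-- Points of an arc that are close in space are close on the arc. -/
theorem exists_dist_lt_imp_abs_sub_lt (hg : ContinuousOn g (Icc 0 1)) (hi : InjOn g (Icc 0 1))
    {η : ℝ} (hη : 0 < η) : ∃ ρ > 0, ∀ u ∈ Icc (0 : ℝ) 1, ∀ v ∈ Icc (0 : ℝ) 1,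
      dist (g u) (g v) < ρ → |u - v| < η := by
  set K : Set (ℝ × ℝ) := (Icc 0 1 ×ˢ Icc 0 1) ∩ {p | η ≤ |p.1 - p.2|} with hK
  have hKc : IsCompact K := (isCompact_Icc.prod isCompact_Icc).inter_right
    (isClosed_le continuous_const (by fun_prop))
  rcases K.eq_empty_or_nonempty with h | h
  · refine ⟨1, one_pos, fun u hu v hv _ => ?_⟩
    by_contra hcon
    have : (u, v) ∈ K := ⟨⟨hu, hv⟩, not_lt.1 hcon⟩
    rw [h] at this; exact this
  · have hc : ContinuousOn (fun p : ℝ × ℝ => dist (g p.1) (g p.2)) K := by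
      refine continuous_dist.comp_continuousOn (ContinuousOn.prodMk ?_ ?_)
      · exact hg.comp continuousOn_fst fun p hp => hp.1.1
      · exact hg.comp continuousOn_snd fun p hp => hp.1.2
    obtain ⟨p, hp, hmin⟩ := hKc.exists_isMinOn h hc
    refine ⟨dist (g p.1) (g p.2), ?_, fun u hu v hv hd => ?_⟩
    · refine dist_pos.2 fun heq => ?_
      have := hi hp.1.1 hp.1.2 heq
      have h2 : η ≤ |p.1 - p.2| := hp.2
      rw [this, sub_self, abs_zero] at h2
      exact absurd hη (not_lt.2 h2)
    · by_contra hcon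
      exact absurd hd (not_lt.2 (hmin (show (u, v) ∈ K from ⟨⟨hu, hv⟩, not_lt.1 hcon⟩)))

/-- A potential for the piece of an arc between the parameters `s` and `t`: a function that climbs
from `0` to `c` on this piece, is constant near and beyond its end points, and is
`1`-Lipschitz, with respect to the distance in space, at some small scale. -/
def HasPotential (g : ℝ → E) (s t c : ℝ) : Prop :=
  ∃ φ : ℝ → ℝ, ∃ η > 0, ∃ ρ > 0, (∀ u ∈ Icc (0 : ℝ) 1, u ≤ s + η → φ u = 0) ∧
    (∀ u ∈ Icc (0 : ℝ) 1, t - η ≤ u → φ u = c) ∧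
    ∀ u ∈ Icc (0 : ℝ) 1, ∀ v ∈ Icc (0 : ℝ) 1, dist (g u) (g v) < ρ →
      |φ u - φ v| ≤ dist (g u) (g v)

/-- Potentials of adjacent pieces add up: near each pair of points that are close in space, one of
the two potentials is constant. -/
theorem HasPotential.add (hg : ContinuousOn g (Icc 0 1)) (hi : InjOn g (Icc 0 1))
    {r s t c d : ℝ} (hrs : r ≤ s) (hst : s ≤ t)
    (h₁ : HasPotential g r s c) (h₂ : HasPotential g s t d) : HasPotential g r t (c + d) := by
  obtain ⟨φ, η₁, hη₁, ρ₁, hρ₁, a₁, b₁, c₁⟩ := h₁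
  obtain ⟨ψ, η₂, hη₂, ρ₂, hρ₂, a₂, b₂, c₂⟩ := h₂
  obtain ⟨ρ₃, hρ₃, h₃⟩ := exists_dist_lt_imp_abs_sub_lt hg hi hη₁
  refine ⟨fun u => φ u + ψ u, min η₁ η₂, lt_min hη₁ hη₂, min ρ₁ (min ρ₂ ρ₃),
    lt_min hρ₁ (lt_min hρ₂ hρ₃), ?_, ?_, ?_⟩
  · intro u hu hus
    have := min_le_left η₁ η₂
    have := min_le_right η₁ η₂
    beta_reduce
    rw [a₁ u hu (by linarith), a₂ u hu (by linarith), add_zero]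
  · intro u hu hus
    have := min_le_left η₁ η₂
    have := min_le_right η₁ η₂
    beta_reduce
    rw [b₁ u hu (by linarith), b₂ u hu (by linarith)]
  · intro u hu v hv huv
    have l₁ : dist (g u) (g v) < ρ₁ := huv.trans_le (min_le_left _ _)
    have l₂ : dist (g u) (g v) < ρ₂ := huv.trans_le ((min_le_right _ _).trans (min_le_left _ _))
    have l₃ := abs_lt.1 (h₃ u hu v hv
      (huv.trans_le ((min_le_right _ _).trans (min_le_right _ _))))
    beta_reduce
    by_cases h : s - η₁ ≤ u ∧ s - η₁ ≤ v
    · rw [b₁ u hu h.1, b₁ v hv h.2, add_sub_add_left_eq_sub]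
      exact c₂ u hu v hv l₂
    · have : u ≤ s + η₂ ∧ v ≤ s + η₂ := by
        rw [not_and_or, not_le, not_le] at h
        rcases h with h | h <;> constructor <;> linarith
      rw [a₂ u hu this.1, a₂ v hv this.2, add_zero, add_zero]
      exact c₁ u hu v hv l₁

/-- The distance from the first end point of a piece, cut off to be constant near both end points
and beyond them, is a potential that climbs nearly as much as the chord is long. -/
theorem hasPotential_piece (hg : ContinuousOn g (Icc 0 1)) (hi : InjOn g (Icc 0 1))
    {s t : ℝ} (hs : 0 ≤ s) (hst : s ≤ t) (ht : t ≤ 1) {θ : ℝ} (hθ : 0 < θ) :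
    ∃ c, dist (g s) (g t) - 2 * θ ≤ c ∧ HasPotential g s t c := by
  have hsI : s ∈ Icc (0 : ℝ) 1 := ⟨hs, hst.trans ht⟩
  have htI : t ∈ Icc (0 : ℝ) 1 := ⟨hs.trans hst, ht⟩
  set c := max (dist (g s) (g t) - 2 * θ) 0 with hc
  -- Flattening by `θ` at both ends keeps the potential locally Lipschitz near the end points.
  set F : ℝ → ℝ := fun u => min (max (dist (g u) (g s) - θ) 0) c with hF
  set P : ℝ → ℝ := fun u => max s (min u t) with hP
  have hPI : ∀ u, P u ∈ Icc s t := fun u => ⟨le_max_left _ _, max_le hst (min_le_right _ _)⟩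
  have hPid : ∀ u, s ≤ u → u ≤ t → P u = u := fun u h1 h2 => by simp [hP, h1, h2]
  have hPs : ∀ u, u ≤ s → P u = s := fun u h1 => by simp [hP, h1, h1.trans hst]
  have hPt : ∀ u, t ≤ u → P u = t := fun u h1 => by simp [hP, h1, hst]
  have hc0 : 0 ≤ c := le_max_right _ _
  have hnear : ∀ q ∈ Icc (0 : ℝ) 1, ∃ η > 0, ∀ u ∈ Icc (0 : ℝ) 1, |u - q| ≤ η →
      dist (g u) (g q) ≤ θ := by
    intro q hq
    obtain ⟨η, hη, h⟩ := Metric.continuousOn_iff.1 hg q hq θ hθ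
    refine ⟨η / 2, by positivity, fun u hu huq => (h u hu ?_).le⟩
    rw [Real.dist_eq]; linarith
  obtain ⟨η₁, hη₁, n₁⟩ := hnear s hsI
  obtain ⟨η₂, hη₂, n₂⟩ := hnear t htI
  have hF0 : ∀ u, dist (g u) (g s) ≤ θ → F u = 0 := by
    intro u hu
    simp only [hF]
    rw [max_eq_right (by linarith), min_eq_left hc0]
  have hFc : ∀ u, dist (g u) (g t) ≤ θ → F u = c := by
    intro u hu
    simp only [hF]
    rw [min_eq_right]
    have h1 := dist_triangle (g s) (g u) (g t)
    rw [dist_comm (g s) (g u)] at h1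
    exact max_le_max (by linarith) le_rfl
  obtain ⟨ρ, hρ, hinj⟩ := exists_dist_lt_imp_abs_sub_lt hg hi (lt_min hη₁ hη₂)
  have hA : ∀ u ∈ Icc (0 : ℝ) 1, u ≤ s + η₁ → F (P u) = 0 := by
    intro u hu hus
    rcases le_total u s with h | h
    · rw [hPs u h]; exact hF0 s (by rw [dist_self]; exact hθ.le)
    · rcases le_total u t with h' | h'
      · rw [hPid u h h']
        exact hF0 u (n₁ u hu (abs_le.2 ⟨by linarith, by linarith⟩))
      · rw [hPt u h']
        exact hF0 t (n₁ t htI (abs_le.2 ⟨by linarith, by linarith⟩))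
  have hB : ∀ u ∈ Icc (0 : ℝ) 1, t - η₂ ≤ u → F (P u) = c := by
    intro u hu hus
    rcases le_total t u with h | h
    · rw [hPt u h]; exact hFc t (by rw [dist_self]; exact hθ.le)
    · rcases le_total s u with h' | h'
      · rw [hPid u h' h]
        exact hFc u (n₂ u hu (abs_le.2 ⟨by linarith, by linarith⟩))
      · rw [hPs u h']
        exact hFc s (n₂ s hsI (abs_le.2 ⟨by linarith, by linarith⟩))
  refine ⟨c, le_max_left _ _, fun u => F (P u), min η₁ η₂, lt_min hη₁ hη₂, ρ, hρ,
    fun u hu h => hA u hu (h.trans (add_le_add_right (min_le_left _ _) _)),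
    fun u hu h => hB u hu (le_trans (sub_le_sub_left (min_le_right _ _) _) h), ?_⟩
  intro u hu v hv huv
  have h1 := hinj u hu v hv huv
  have h2 := abs_lt.1 (h1.trans_le (min_le_left _ _))
  have h3 := abs_lt.1 (h1.trans_le (min_le_right _ _))
  beta_reduce
  by_cases ha : u < s ∨ v < s
  · have : u ≤ s + η₁ ∧ v ≤ s + η₁ := by
      rcases ha with h | h <;> constructor <;> linarith
    rw [hA u hu this.1, hA v hv this.2, sub_self, abs_zero]
    exact dist_nonneg
  · by_cases hb : t < u ∨ t < v
    · have : t - η₂ ≤ u ∧ t - η₂ ≤ v := by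
        rcases hb with h | h <;> constructor <;> linarith
      rw [hB u hu this.1, hB v hv this.2, sub_self, abs_zero]
      exact dist_nonneg
    · rw [not_or, not_lt, not_lt] at ha hb
      rw [hPid u ha.1 hb.1, hPid v ha.2 hb.2]
      refine (abs_min_sub_min_le_max _ _ _ _).trans (max_le ?_ ?_)
      · refine (abs_max_sub_max_le_max _ _ _ _).trans (max_le ?_ ?_)
        · rw [sub_sub_sub_cancel_right]
          exact abs_dist_sub_le _ _ _
        · simp
      · simp

theorem hasPotential_polygon (hg : ContinuousOn g (Icc 0 1)) (hi : InjOn g (Icc 0 1))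
    {u : ℕ → ℝ} (hu : Monotone u) (huI : ∀ i, u i ∈ Icc (0 : ℝ) 1) {θ : ℝ} (hθ : 0 < θ) (n : ℕ) :
    ∃ c, (∑ i ∈ Finset.range n, dist (g (u i)) (g (u (i + 1)))) - n * (2 * θ) ≤ c ∧
      HasPotential g (u 0) (u n) c := by
  induction n with
  | zero => exact ⟨0, by simp, fun _ => 0, 1, one_pos, 1, one_pos, by simp, by simp, by simp⟩
  | succ n ih =>
    obtain ⟨c, hc, hp⟩ := ih
    obtain ⟨d, hd, hq⟩ := hasPotential_piece hg hi (huI n).1 (hu n.le_succ) (huI (n + 1)).2 hθ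
    refine ⟨c + d, ?_, hp.add hg hi (hu n.zero_le) (hu n.le_succ) hq⟩
    rw [Finset.sum_range_succ]
    push_cast
    linarith

/-- An arc carries functions that are locally `1`-Lipschitz with respect to the distance in space
and climb nearly as much as the length of the arc. -/
theorem exists_potential (hg : ContinuousOn g (Icc 0 1)) (hi : InjOn g (Icc 0 1))
    (hv : eVariationOn g (Icc 0 1) ≠ ∞) {ε : ℝ} (hε : 0 < ε) :
    ∃ φ : ℝ → ℝ, ∃ ρ > 0, arcLen g 0 1 - ε < φ 1 - φ 0 ∧
      ∀ u ∈ Icc (0 : ℝ) 1, ∀ v ∈ Icc (0 : ℝ) 1, dist (g u) (g v) < ρ →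
        |φ u - φ v| ≤ dist (g u) (g v) := by
  rcases le_total (arcLen g 0 1) (ε / 2) with h | h
  · exact ⟨fun _ => 0, 1, one_pos, by linarith, by simp⟩
  have h1 : ENNReal.ofReal (arcLen g 0 1 - ε / 2) < eVariationOn g (Icc 0 1) := by
    rw [ENNReal.ofReal_lt_iff_lt_toReal (by linarith) hv]
    change _ < arcLen g 0 1
    linarith
  obtain ⟨⟨n, u, hu, huI⟩, hsum⟩ := lt_iSup_iff.1 h1
  have h2 : arcLen g 0 1 - ε / 2 < ∑ i ∈ Finset.range n, dist (g (u i)) (g (u (i + 1))) := by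
    simp only [edist_dist] at hsum
    rw [← ENNReal.ofReal_sum_of_nonneg (fun _ _ => dist_nonneg)] at hsum
    have := (ENNReal.ofReal_lt_ofReal_iff_of_nonneg (by linarith)).1 hsum
    simpa [dist_comm] using this
  obtain ⟨c, hc, φ, η, hη, ρ, hρ, a, b, hlip⟩ := hasPotential_polygon hg hi hu huI
    (θ := ε / (4 * (n + 1))) (by positivity) n
  refine ⟨φ, ρ, hρ, ?_, hlip⟩
  rw [a 0 (by simp) (by linarith [(huI 0).1]), b 1 (by simp) (by linarith [(huI n).2])]
  have h3 : (n : ℝ) * (2 * (ε / (4 * (n + 1)))) ≤ ε / 2 := by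
    have : (n : ℝ) * (2 * (ε / (4 * (n + 1)))) = ε / 2 * (n / (n + 1)) := by field_simp; norm_num
    rw [this]
    have : (n : ℝ) / (n + 1) ≤ 1 := (div_le_one (by positivity)).2 (by linarith)
    nlinarith
  linarith

end Heights

/-! ### Effective compactness, and upper approximations of the length of a subarc -/

/-- The point of the plane with given rational coordinates. -/
noncomputable def pt (w : RatCode × RatCode) : Plane := !₂[w.1.val, w.2.val]

@[simp] theorem pt_zero (w : RatCode × RatCode) : pt w 0 = w.1.val := rfl

@[simp] theorem pt_one (w : RatCode × RatCode) : pt w 1 = w.2.val := rfl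

theorem dist_sq_plane (z w : Plane) : dist z w ^ 2 = (z 0 - w 0) ^ 2 + (z 1 - w 1) ^ 2 := by
  rw [EuclideanSpace.dist_eq, Real.sq_sqrt (Finset.sum_nonneg fun _ _ => sq_nonneg _)]
  simp [Fin.sum_univ_two, Real.dist_eq, sq_abs]

theorem dist_lt_of_mem_nbhd {δ : ℝ} {z w : Plane} (h : z ∈ nbhd δ w) : dist z w < 2 * δ := by
  have h0 := h.1
  have h1 := h.2
  have hδ : 0 < δ := (abs_nonneg _).trans_lt h0
  refine lt_of_pow_lt_pow_left₀ 2 (by positivity) ?_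
  rw [dist_sq_plane]
  have a := sq_lt_sq.2 (h0.trans_le (le_abs_self δ))
  have b := sq_lt_sq.2 (h1.trans_le (le_abs_self δ))
  nlinarith

theorem mem_nbhd_of_dist_lt {δ : ℝ} {z w : Plane} (h : dist z w < δ) : z ∈ nbhd δ w := by
  have h2 := dist_sq_plane z w
  have h3 : dist z w ^ 2 < δ ^ 2 := by
    have := dist_nonneg (x := z) (y := w)
    gcongr
  have hδ : 0 < δ := dist_nonneg.trans_lt h
  constructor <;> refine abs_lt_of_sq_lt_sq ?_ hδ.le
  · nlinarith [sq_nonneg (z 1 - w 1)]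
  · nlinarith [sq_nonneg (z 0 - w 0)]

theorem exists_ratCode_btwn {a b : ℝ} (h : a < b) : ∃ q : RatCode, a < q.val ∧ q.val < b := by
  obtain ⟨q, hq⟩ := exists_ratCode_near ((a + b) / 2) (ε := (b - a) / 2) (by linarith)
  have := abs_lt.1 hq
  exact ⟨q, by linarith, by linarith⟩

theorem exists_pt_near (z : Plane) {ε : ℝ} (hε : 0 < ε) :
    ∃ w : RatCode × RatCode, dist z (pt w) < ε := by
  obtain ⟨p, hp⟩ := exists_ratCode_near (z 0) (half_pos hε)
  obtain ⟨q, hq⟩ := exists_ratCode_near (z 1) (half_pos hε)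
  have : z ∈ nbhd (ε / 2) (pt (p, q)) := by
    constructor
    · rw [abs_sub_comm]; exact hp
    · rw [abs_sub_comm]; exact hq
  exact ⟨(p, q), by linarith [dist_lt_of_mem_nbhd this]⟩

/-- A set is effectively compact if its finite covers by neighborhoods with rational centers and a
common rational radius can be enumerated. -/
def EffCompact (C : Set Plane) : Prop :=
  Semidec fun x : List (RatCode × RatCode) × RatCode =>
    ∀ z ∈ C, ∃ w ∈ x.1, z ∈ nbhd x.2.val (pt w)

/-- A set is effectively overt if the rational neighborhoods that meet it can be enumerated. -/
def EffOvert (C : Set Plane) : Prop :=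
  Semidec fun x : (RatCode × RatCode) × RatCode => ∃ z ∈ C, z ∈ nbhd x.2.val (pt x.1)

theorem IsName.abs_sub_le {a : ℕ → RatCode} {x : ℝ} (h : IsName a x) (n : ℕ) :
    |(a n).val - x| ≤ 2 * (1 / 2 : ℝ) ^ n := by
  have := dist_le_of_le_geometric_two_of_tendsto (f := fun n => (a n).val) (C := 2) (a := x)
    (fun n => by rw [Real.dist_eq]; simpa using h.1 n) h.2 n
  rw [Real.dist_eq] at this
  simpa [div_eq_mul_inv] using this

theorem ComputableReal.semidec_lt {x : ℝ} (h : ComputableReal x) :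
    Semidec fun q : RatCode => x < q.val := by
  obtain ⟨a, ha, hx⟩ := h
  have h1 : Semidec fun y : (RatCode × ℕ) × RatCode =>
      a y.1.2 = y.2 ∧ y.2.val + 2 * (1 / 2 : ℝ) ^ y.1.2 < y.1.1.val := by
    refine Semidec.and ((Semidec.graph ha).comp
      (f := fun y : (RatCode × ℕ) × RatCode => (y.1.2, y.2))
      ((Primrec.snd.comp Primrec.fst).pair Primrec.snd)) (PrimrecPred.semidec ?_)
    exact PrimrecRat.lt ((primrecRat_val Primrec.snd).add ((PrimrecRat.ofNat 2).mul
      (PrimrecRat.half_pow (Primrec.snd.comp Primrec.fst))))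
      (primrecRat_val (Primrec.fst.comp Primrec.fst))
  have h2 := Semidec.exists (p := fun (y : RatCode × ℕ) p =>
      a y.2 = p ∧ p.val + 2 * (1 / 2 : ℝ) ^ y.2 < y.1.val) h1
  refine (Semidec.exists_nat (p := fun q n => ∃ p,
    a n = p ∧ p.val + 2 * (1 / 2 : ℝ) ^ n < q.val) h2).of_iff fun q => ?_
  constructor
  · intro hq
    obtain ⟨n, hn⟩ := exists_pow_lt_of_lt_one (show 0 < (q.val - x) / 4 by linarith)
      (show (1 / 2 : ℝ) < 1 by norm_num)
    have := abs_le.1 (hx.abs_sub_le n)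
    exact ⟨n, a n, rfl, by linarith⟩
  · rintro ⟨n, p, rfl, hn⟩
    have := abs_le.1 (hx.abs_sub_le n)
    linarith

theorem Semidec.lt_primrecRat {α : Type*} [Primcodable α] {x : ℝ}
    (h : Semidec fun q : RatCode => x < q.val) {F : α → ℝ} (hF : PrimrecRat F) :
    Semidec fun a => x < F a := by
  obtain ⟨f, hf, hF⟩ := hF
  exact (h.comp hf).of_iff fun a => by rw [hF]

/-- `h` is one of the heights that a list of points with heights assigns to the parameter `s`: the
height of a listed point that is within `δ` of `g s`.  A point `(w, h)` with its height is encoded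
like a neighborhood with center `w` and radius `h`, but `h` may have any sign. -/
def heightRel (g : ℝ → Plane) (W : List NbhdCode) (δ s h : ℝ) : Prop :=
  ∃ x ∈ W, g s ∈ nbhd δ (pt x.1) ∧ h = x.2.val

/-- The points with heights `W` satisfy an approximate Lipschitz condition at the scale `ρ`. -/
def LocallyLip (W : List NbhdCode) (ρ δ ε : ℝ) : Prop :=
  ∀ x ∈ W, ∀ y ∈ W, (ρ + 4 * δ) ^ 2 < (pt x.1 0 - pt y.1 0) ^ 2 + (pt x.1 1 - pt y.1 1) ^ 2 ∨
    |x.2.val - y.2.val| ≤ ρ * (1 + ε)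

theorem heightRel_loc {g : ℝ → Plane} {W : List NbhdCode} {ρ δ ε : ℝ} (hW : LocallyLip W ρ δ ε)
    {s t h k : ℝ} (hs : heightRel g W δ s h) (ht : heightRel g W δ t k)
    (hd : dist (g s) (g t) ≤ ρ) : |h - k| ≤ ρ * (1 + ε) := by
  obtain ⟨x, hx, hgx, rfl⟩ := hs
  obtain ⟨y, hy, hgy, rfl⟩ := ht
  refine (hW x hx y hy).resolve_left (not_lt.2 ?_)
  rw [← dist_sq_plane]
  have h1 := dist_lt_of_mem_nbhd hgx
  have h2 := dist_lt_of_mem_nbhd hgy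
  have h3 : dist (pt x.1) (pt y.1) ≤ ρ + 4 * δ := by
    have := dist_triangle4 (pt x.1) (g s) (g t) (pt y.1)
    rw [dist_comm (pt x.1) (g s)] at this
    linarith
  gcongr

/-- Let an arc `C` be effectively compact and overt and let upper bounds of its length be
enumerable.  Then upper bounds of the length of each subarc with rational end points are
enumerable: a bound is certified by a finite set of points with heights that is close to `C`,
satisfies an approximate Lipschitz condition, and spans nearly the whole length of `C`. -/
theorem semidec_arcLen_lt {C : Set Plane} {g : ℝ → Plane} (hgC : IsInjParam g C)
    (hv : eVariationOn g (Icc 0 1) ≠ ∞) (hcov : EffCompact C) (hov : EffOvert C)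
    (hlen : Semidec fun q : RatCode => arcLen g 0 1 < q.val) {a b : ℝ} (ha : 0 ≤ a) (hab : a ≤ b)
    (hb : b ≤ 1) {A B : RatCode × RatCode} (hA : g a = pt A) (hB : g b = pt B) :
    Semidec fun q : RatCode => arcLen g a b < q.val := by
  obtain ⟨hg, hi, himg⟩ := hgC
  set l := arcLen g 0 1 with hl
  obtain ⟨K, hK⟩ := exists_nat_ge (4 * l + 19)
  have hl0 : 0 ≤ l := arcLen_nonneg _ _
  have hgI : ∀ s ∈ Icc (0 : ℝ) 1, g s ∈ C := fun s hs => himg ▸ mem_image_of_mem g hs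
  have haI : a ∈ Icc (0 : ℝ) 1 := ⟨ha, hab.trans hb⟩
  have hbI : b ∈ Icc (0 : ℝ) 1 := ⟨ha.trans hab, hb⟩
  -- A certificate `(W, ρ, δ, ε)` for the bound `q`: the points with heights, the scale, the radius
  -- of the neighborhoods around the points, and the tolerance.
  let P : RatCode → List NbhdCode × RatCode × RatCode × RatCode → Prop := fun q d =>
    (((0 < d.2.1.val ∧ 0 < d.2.2.1.val) ∧ d.2.1.val ≤ d.2.2.2.val ∧ d.2.2.2.val ≤ 1) ∧
    LocallyLip d.1 d.2.1.val d.2.2.1.val d.2.2.2.val) ∧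
    (∀ z ∈ C, ∃ w ∈ d.1.map Prod.fst, z ∈ nbhd d.2.2.1.val (pt w)) ∧
    (∃ x ∈ d.1, ∃ y ∈ d.1, ((∃ z ∈ C, z ∈ nbhd d.2.2.1.val (pt x.1)) ∧
      (∃ z ∈ C, z ∈ nbhd d.2.2.1.val (pt y.1))) ∧ l < |x.2.val - y.2.val| + d.2.2.2.val) ∧
    (∃ x ∈ d.1, ∃ y ∈ d.1, ((|A.1.val - x.1.1.val| < d.2.2.1.val ∧
      |A.2.val - x.1.2.val| < d.2.2.1.val) ∧ (|B.1.val - y.1.1.val| < d.2.2.1.val ∧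
      |B.2.val - y.1.2.val| < d.2.2.1.val)) ∧ |x.2.val - y.2.val| + K * d.2.2.2.val < q.val)
  have hP : Semidec fun x : RatCode × (List NbhdCode × RatCode × RatCode × RatCode) =>
      P x.1 x.2 := by
    have d1 : Primrec fun x : RatCode × (List NbhdCode × RatCode × RatCode × RatCode) => x.2.1 :=
      Primrec.fst.comp Primrec.snd
    have d2 : Primrec fun x : RatCode × (List NbhdCode × RatCode × RatCode × RatCode) =>
      x.2.2.1 := Primrec.fst.comp (Primrec.snd.comp Primrec.snd)
    have d3 : Primrec fun x : RatCode × (List NbhdCode × RatCode × RatCode × RatCode) =>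
      x.2.2.2.1 := Primrec.fst.comp (Primrec.snd.comp (Primrec.snd.comp Primrec.snd))
    have d4 : Primrec fun x : RatCode × (List NbhdCode × RatCode × RatCode × RatCode) =>
      x.2.2.2.2 := Primrec.snd.comp (Primrec.snd.comp (Primrec.snd.comp Primrec.snd))
    -- Projections of the pairs of items that the quantifiers over the list range over.
    have p0 : Primrec fun x : ((RatCode × (List NbhdCode × RatCode × RatCode × RatCode)) ×
      NbhdCode) × NbhdCode => x.1.1 := Primrec.fst.comp Primrec.fst
    have px : Primrec fun x : ((RatCode × (List NbhdCode × RatCode × RatCode × RatCode)) ×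
      NbhdCode) × NbhdCode => x.1.2 := Primrec.snd.comp Primrec.fst
    have py : Primrec fun x : ((RatCode × (List NbhdCode × RatCode × RatCode × RatCode)) ×
      NbhdCode) × NbhdCode => x.2 := Primrec.snd
    have px0 := primrecRat_val (Primrec.fst.comp (Primrec.fst.comp px))
    have px1 := primrecRat_val (Primrec.snd.comp (Primrec.fst.comp px))
    have pxh := primrecRat_val (Primrec.snd.comp px)
    have py0 := primrecRat_val (Primrec.fst.comp (Primrec.fst.comp py))
    have py1 := primrecRat_val (Primrec.snd.comp (Primrec.fst.comp py))
    have pyh := primrecRat_val (Primrec.snd.comp py)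
    have pρ := primrecRat_val (d2.comp p0)
    have pδ := primrecRat_val (d3.comp p0)
    have pε := primrecRat_val (d4.comp p0)
    have pq := primrecRat_val (Primrec.fst.comp p0)
    have cst : ∀ c : RatCode, PrimrecRat fun _ : ((RatCode × (List NbhdCode × RatCode × RatCode ×
        RatCode)) × NbhdCode) × NbhdCode => c.val := fun c => primrecRat_val (Primrec.const c)
    have pK : PrimrecRat fun _ : ((RatCode × (List NbhdCode × RatCode × RatCode × RatCode)) ×
        NbhdCode) × NbhdCode => (K : ℝ) := PrimrecRat.natCast (Primrec.const K)
    refine Semidec.and (Semidec.and (PrimrecPred.semidec ?_) ?_)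
      (Semidec.and ?_ (Semidec.and ?_ ?_))
    · exact ((PrimrecRat.zero.lt (primrecRat_val d2)).and
        (PrimrecRat.zero.lt (primrecRat_val d3))).and
        (((primrecRat_val d2).le (primrecRat_val d4)).and
        ((primrecRat_val d4).le PrimrecRat.one))
    · refine Semidec.forall_mem (p := fun (x : RatCode × (List NbhdCode × RatCode × RatCode ×
        RatCode)) (y : NbhdCode) => ∀ z ∈ x.2.1, (x.2.2.1.val + 4 * x.2.2.2.1.val) ^ 2 <
          (pt y.1 0 - pt z.1 0) ^ 2 + (pt y.1 1 - pt z.1 1) ^ 2 ∨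
        |y.2.val - z.2.val| ≤ x.2.2.1.val * (1 + x.2.2.2.2.val)) ?_ d1
      refine Semidec.forall_mem (p := fun (x : (RatCode × (List NbhdCode × RatCode × RatCode ×
        RatCode)) × NbhdCode) (z : NbhdCode) => (x.1.2.2.1.val + 4 * x.1.2.2.2.1.val) ^ 2 <
          (pt x.2.1 0 - pt z.1 0) ^ 2 + (pt x.2.1 1 - pt z.1 1) ^ 2 ∨
        |x.2.2.val - z.2.val| ≤ x.1.2.2.1.val * (1 + x.1.2.2.2.2.val)) ?_ (d1.comp Primrec.fst)
      simp only [pt_zero, pt_one, sq]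
      have s1 := pρ.add ((PrimrecRat.ofNat 4).mul pδ)
      exact ((PrimrecRat.lt (s1.mul s1) (((px0.sub py0).mul (px0.sub py0)).add
        ((px1.sub py1).mul (px1.sub py1)))).or
        (((pxh.sub pyh).abs).le (pρ.mul (PrimrecRat.one.add pε)))).semidec
    · exact hcov.comp (f := fun x : RatCode × (List NbhdCode × RatCode × RatCode × RatCode) =>
        (x.2.1.map Prod.fst, x.2.2.2.1))
        ((Primrec.list_map d1 (Primrec.fst.comp Primrec.snd).to₂).pair d3)
    · refine Semidec.exists_mem (p := fun (x : RatCode × (List NbhdCode × RatCode × RatCode ×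
        RatCode)) (y : NbhdCode) => ∃ z ∈ x.2.1, ((∃ w ∈ C, w ∈ nbhd x.2.2.2.1.val (pt y.1)) ∧
        (∃ w ∈ C, w ∈ nbhd x.2.2.2.1.val (pt z.1))) ∧
        l < |y.2.val - z.2.val| + x.2.2.2.2.val) ?_ d1
      refine Semidec.exists_mem (p := fun (x : (RatCode × (List NbhdCode × RatCode × RatCode ×
        RatCode)) × NbhdCode) (z : NbhdCode) =>
        ((∃ w ∈ C, w ∈ nbhd x.1.2.2.2.1.val (pt x.2.1)) ∧
        (∃ w ∈ C, w ∈ nbhd x.1.2.2.2.1.val (pt z.1))) ∧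
        l < |x.2.2.val - z.2.val| + x.1.2.2.2.2.val) ?_ (d1.comp Primrec.fst)
      refine Semidec.and (Semidec.and ?_ ?_) ?_
      · exact hov.comp (f := fun x : ((RatCode × (List NbhdCode × RatCode × RatCode × RatCode)) ×
          NbhdCode) × NbhdCode => (x.1.2.1, x.1.1.2.2.2.1))
          ((Primrec.fst.comp px).pair (d3.comp p0))
      · exact hov.comp (f := fun x : ((RatCode × (List NbhdCode × RatCode × RatCode × RatCode)) ×
          NbhdCode) × NbhdCode => (x.2.1, x.1.1.2.2.2.1))
          ((Primrec.fst.comp py).pair (d3.comp p0))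
      · exact hlen.lt_primrecRat ((pxh.sub pyh).abs.add pε)
    · refine Semidec.exists_mem (p := fun (x : RatCode × (List NbhdCode × RatCode × RatCode ×
        RatCode)) (y : NbhdCode) => ∃ z ∈ x.2.1, ((|A.1.val - y.1.1.val| < x.2.2.2.1.val ∧
        |A.2.val - y.1.2.val| < x.2.2.2.1.val) ∧ (|B.1.val - z.1.1.val| < x.2.2.2.1.val ∧
        |B.2.val - z.1.2.val| < x.2.2.2.1.val)) ∧
        |y.2.val - z.2.val| + K * x.2.2.2.2.val < x.1.val) ?_ d1
      refine Semidec.exists_mem (p := fun (x : (RatCode × (List NbhdCode × RatCode × RatCode ×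
        RatCode)) × NbhdCode) (z : NbhdCode) =>
        ((|A.1.val - x.2.1.1.val| < x.1.2.2.2.1.val ∧
        |A.2.val - x.2.1.2.val| < x.1.2.2.2.1.val) ∧ (|B.1.val - z.1.1.val| < x.1.2.2.2.1.val ∧
        |B.2.val - z.1.2.val| < x.1.2.2.2.1.val)) ∧
        |x.2.2.val - z.2.val| + K * x.1.2.2.2.2.val < x.1.1.val) ?_ (d1.comp Primrec.fst)
      exact (((((cst A.1).sub px0).abs_lt pδ).and (((cst A.2).sub px1).abs_lt pδ)).and
        ((((cst B.1).sub py0).abs_lt pδ).and (((cst B.2).sub py1).abs_lt pδ))).and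
        (((pxh.sub pyh).abs.add (pK.mul pε)).lt pq) |>.semidec
  refine (Semidec.exists (p := P) hP).of_iff fun q => ?_
  have hRel : ∀ (W : List NbhdCode) (δ : ℝ),
      (∀ z ∈ C, ∃ w ∈ W.map Prod.fst, z ∈ nbhd δ (pt w)) →
      ∀ s ∈ Icc (0 : ℝ) 1, ∃ h, heightRel g W δ s h := by
    intro W δ hW s hs
    obtain ⟨w, hw, hz⟩ := hW (g s) (hgI s hs)
    obtain ⟨x, hx, rfl⟩ := List.mem_map.1 hw
    exact ⟨_, x, hx, hz, rfl⟩
  constructor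
  · intro hq
    have hε : 0 < min 1 ((q.val - arcLen g a b) / (l + 4 + K)) :=
      lt_min one_pos (div_pos (by linarith) (by positivity))
    obtain ⟨ε, hε0, hε1⟩ := exists_ratCode_btwn hε
    have hε2 : ε.val * (l + 4 + K) < q.val - arcLen g a b :=
      (lt_div_iff₀ (by positivity)).1 (hε1.trans_le (min_le_right _ _))
    have hε1 : ε.val < 1 := hε1.trans_le (min_le_left _ _)
    obtain ⟨φ, ρ₀, hρ₀, hφ, hlip⟩ := exists_potential hg hi hv (half_pos hε0)
    obtain ⟨ρ, hρ0, hρ1⟩ := exists_ratCode_btwn (lt_min hε0 (half_pos hρ₀))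
    have hρ2 : ρ.val < ρ₀ / 2 := hρ1.trans_le (min_le_right _ _)
    have hρ1 : ρ.val < ε.val := hρ1.trans_le (min_le_left _ _)
    obtain ⟨δ, hδ0, hδ1⟩ := exists_ratCode_btwn
      (show 0 < ρ.val * ε.val / 10 from by positivity)
    have hδρ : 10 * δ.val < ρ.val := by nlinarith
    have hδε : 10 * δ.val < ε.val := by linarith
    choose w hw using fun u => exists_pt_near (g u) (half_pos hδ0)
    choose h hh using fun u => exists_ratCode_near (φ u) hδ0
    obtain ⟨T, hTI, hT⟩ := (isCompact_Icc (a := (0 : ℝ)) (b := 1)).elim_nhdsWithin_subcover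
      (fun u => {s | dist (g s) (g u) < δ.val / 2})
      (fun u hu => (hg u hu).eventually (Metric.ball_mem_nhds (g u) (half_pos hδ0)))
    classical
    set S : Finset ℝ := insert 0 (insert 1 (insert a (insert b T))) with hS
    have hSI : ∀ u ∈ S, u ∈ Icc (0 : ℝ) 1 := by
      intro u hu
      simp only [hS, Finset.mem_insert] at hu
      rcases hu with rfl | rfl | rfl | rfl | hu
      · simp
      · simp
      · exact haI
      · exact hbI
      · exact hTI u hu
    set W : List NbhdCode := S.toList.map fun u => (w u, h u) with hWdef
    have hmem : ∀ u ∈ S, (w u, h u) ∈ W := fun u hu =>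
      List.mem_map.2 ⟨u, Finset.mem_toList.2 hu, rfl⟩
    have hlipW : LocallyLip W ρ.val δ.val ε.val := by
      intro x hx y hy
      obtain ⟨u, hu, rfl⟩ := List.mem_map.1 hx
      obtain ⟨v, hv, rfl⟩ := List.mem_map.1 hy
      rw [Finset.mem_toList] at hu hv
      rw [← dist_sq_plane, or_iff_not_imp_left, not_lt]
      intro hle
      have h1 : dist (pt (w u)) (pt (w v)) ≤ ρ.val + 4 * δ.val :=
        le_of_sq_le_sq hle (by positivity)
      have h2 : dist (g u) (g v) ≤ ρ.val + 5 * δ.val := by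
        have := dist_triangle4 (g u) (pt (w u)) (pt (w v)) (g v)
        rw [dist_comm (pt (w v)) (g v)] at this
        linarith [hw u, hw v]
      have h3 := hlip u (hSI u hu) v (hSI v hv) (by linarith)
      have h4 := abs_lt.1 (hh u)
      have h5 := abs_lt.1 (hh v)
      have h6 := abs_le.1 (h3.trans h2)
      change |(h u).val - (h v).val| ≤ _
      rw [abs_le]
      constructor <;> nlinarith
    have hcovW : ∀ z ∈ C, ∃ c ∈ W.map Prod.fst, z ∈ nbhd δ.val (pt c) := by
      intro z hz
      rw [← himg] at hz
      obtain ⟨s, hs, rfl⟩ := hz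
      obtain ⟨u, hu, hsu⟩ := mem_iUnion₂.1 (hT hs)
      have hsu : dist (g s) (g u) < δ.val / 2 := hsu
      refine ⟨w u, List.mem_map.2 ⟨_, hmem u (by simp [hS, hu]), rfl⟩, mem_nbhd_of_dist_lt ?_⟩
      linarith [dist_triangle (g s) (g u) (pt (w u)), hw u]
    have hnear : ∀ u, g u ∈ nbhd δ.val (pt (w u)) := fun u =>
      mem_nbhd_of_dist_lt ((hw u).trans (half_lt_self hδ0))
    have haS : a ∈ S := by simp [hS]
    have hbS : b ∈ S := by simp [hS]
    refine ⟨(W, ρ, δ, ε), ⟨⟨⟨hρ0, hδ0⟩, hρ1.le, hε1.le⟩, hlipW⟩, hcovW, ?_, ?_⟩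
    · refine ⟨_, hmem 0 (by simp [hS]), _, hmem 1 (by simp [hS]), ⟨⟨g 0, hgI 0 (by simp), hnear 0⟩,
        g 1, hgI 1 (by simp), hnear 1⟩, ?_⟩
      have h4 := abs_lt.1 (hh 0)
      have h5 := abs_lt.1 (hh 1)
      have h6 := neg_abs_le ((h 0).val - (h 1).val)
      change l < |(h 0).val - (h 1).val| + ε.val
      linarith
    · have hka := hnear a
      have hkb := hnear b
      rw [hA] at hka
      rw [hB] at hkb
      refine ⟨_, hmem a haS, _, hmem b hbS, ⟨hka, hkb⟩, ?_⟩
      have := abs_height_sub_le hg hv hρ0 hρ1.le hε1.le (hRel W δ.val hcovW)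
        (fun s _ t _ x y hx hy hd => heightRel_loc hlipW hx hy hd) ha hab hb
        ⟨_, hmem a haS, hnear a, rfl⟩ ⟨_, hmem b hbS, hnear b, rfl⟩
      change |(h a).val - (h b).val| + K * ε.val < q.val
      change |(h a).val - (h b).val| ≤ _ at this
      linarith
  · rintro ⟨⟨W, ρ, δ, ε⟩, ⟨⟨⟨hρ, hδ⟩, hρε, hε⟩, hlipW⟩, hcovW,
      ⟨x, hx, y, hy, ⟨⟨z, hz, hzx⟩, z', hz', hzy⟩, hlxy⟩, x', hx', y', hy', ⟨hAx, hBy⟩, hq⟩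
    dsimp only at *
    rw [← himg] at hz hz'
    obtain ⟨s, hs, rfl⟩ := hz
    obtain ⟨t, ht, rfl⟩ := hz'
    have h1 : heightRel g W δ.val a x'.2.val := ⟨x', hx', by rw [hA]; exact hAx, rfl⟩
    have h2 : heightRel g W δ.val b y'.2.val := ⟨y', hy', by rw [hB]; exact hBy, rfl⟩
    have := arcLen_lt_height_sub hg hv hρ hρε hε (hRel W δ.val hcovW)
      (fun s _ t _ x y hx hy hd => heightRel_loc hlipW hx hy hd) ha hab hb h1 h2 hs ht
      ⟨x, hx, hzx, rfl⟩ ⟨y, hy, hzy, rfl⟩ hlxy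
    have hε0 : 0 < ε.val := hρ.trans_le hρε
    have : (4 * l + 19) * ε.val ≤ K * ε.val := by gcongr
    linarith

/-! ### `K`-computable curves -/

/-- Parametrized by arc length, an arc of finite length is a Lipschitz image of a set of reals, so
that its dimension is at most one. -/
theorem dense_compl_of_isInjParam {C : Set Plane} {g : ℝ → Plane} (hgC : IsInjParam g C)
    (hv : eVariationOn g (Icc 0 1) ≠ ∞) : Dense Cᶜ := by
  obtain ⟨-, -, himg⟩ := hgC
  set V : ℝ → ℝ := fun t => arcLen g 0 t with hV
  set ψ : ℝ → ℝ := Function.invFunOn V (Icc 0 1) with hψ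
  have hle : ∀ s ∈ Icc (0 : ℝ) 1, ∀ t ∈ Icc (0 : ℝ) 1, dist (g s) (g t) ≤ |V s - V t| := by
    have key : ∀ s t, 0 ≤ s → s ≤ t → t ≤ 1 → dist (g s) (g t) ≤ V t - V s := by
      intro s t hs hst ht
      have h1 := arcLen_add hv le_rfl hs hst ht
      have h2 : dist (g s) (g t) ≤ arcLen g s t := by
        rw [dist_edist, arcLen]
        exact ENNReal.toReal_mono (variation_Icc_ne_top hv hs ht)
          (eVariationOn.edist_le g (left_mem_Icc.2 hst) (right_mem_Icc.2 hst))
      simp only [hV]; linarith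
    intro s hs t ht
    rcases le_total s t with h | h
    · exact (key s t hs.1 h ht.2).trans ((le_abs_self _).trans (abs_sub_comm _ _).le)
    · rw [dist_comm]
      exact (key t s ht.1 h hs.2).trans (le_abs_self _)
  have hψm : ∀ s ∈ Icc (0 : ℝ) 1, ψ (V s) ∈ Icc (0 : ℝ) 1 := fun s hs =>
    Function.invFunOn_mem ⟨s, hs, rfl⟩
  have hψe : ∀ s ∈ Icc (0 : ℝ) 1, V (ψ (V s)) = V s := fun s hs =>
    Function.invFunOn_eq ⟨s, hs, rfl⟩
  have hlip : LipschitzOnWith 1 (g ∘ ψ) (V '' Icc 0 1) := by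
    refine LipschitzOnWith.of_dist_le_mul ?_
    rintro _ ⟨s, hs, rfl⟩ _ ⟨t, ht, rfl⟩
    have := hle _ (hψm s hs) _ (hψm t ht)
    rw [hψe s hs, hψe t ht] at this
    simpa [Real.dist_eq] using this
  have himg' : C ⊆ (g ∘ ψ) '' (V '' Icc 0 1) := by
    rw [← himg]
    rintro _ ⟨s, hs, rfl⟩
    refine ⟨V s, ⟨s, hs, rfl⟩, ?_⟩
    have := hle _ (hψm s hs) s hs
    rw [hψe s hs, sub_self, abs_zero] at this
    exact dist_le_zero.1 this
  refine dense_compl_of_dimH_lt_finrank ?_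
  calc dimH C ≤ dimH ((g ∘ ψ) '' (V '' Icc 0 1)) := dimH_mono himg'
    _ ≤ dimH (V '' Icc 0 1) := hlip.dimH_image_le
    _ ≤ dimH (univ : Set ℝ) := dimH_mono (subset_univ _)
    _ = 1 := Real.dimH_univ
    _ < (Module.finrank ℝ Plane : ℝ≥0∞) := by
      rw [finrank_euclideanSpace_fin]; norm_num

theorem IsInjParam.isCompact {C : Set Plane} {g : ℝ → Plane} (h : IsInjParam g C) :
    IsCompact C := h.2.2 ▸ isCompact_Icc.image_of_continuousOn h.1

theorem IsInjParam.nonempty {C : Set Plane} {g : ℝ → Plane} (h : IsInjParam g C) :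
    C.Nonempty := h.2.2 ▸ ⟨g 0, mem_image_of_mem g (by simp)⟩

theorem isOpen_nbhd (r : ℝ) (w : Plane) : IsOpen (nbhd r w) := by
  have h0 : Continuous fun z : Plane => |z 0 - w 0| := by fun_prop
  have h1 : Continuous fun z : Plane => |z 1 - w 1| := by fun_prop
  exact (isOpen_lt h0 continuous_const).inter (isOpen_lt h1 continuous_const)

theorem coverUnion_subset_setNbhd {Q : List NbhdCode} {C : Set Plane} (hC : C.Nonempty)
    (hsub : C ⊆ coverUnion Q) {ε : ℝ} (h : hausdorffDistance (coverUnion Q) C < ε) :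
    coverUnion Q ⊆ setNbhd ε C := by
  obtain ⟨z, hz⟩ := hC
  have hbdd : Bornology.IsBounded (coverUnion Q) := by
    have : coverUnion Q = ⋃ N ∈ {N | N ∈ Q}, NbhdCode.toSet N := rfl
    rw [this, Bornology.isBounded_biUnion (List.finite_toSet Q)]
    intro N _
    exact Metric.isBounded_ball.subset fun w hw => dist_lt_of_mem_nbhd hw
  obtain ⟨R, hR0, hR⟩ := hbdd.subset_ball_lt 0 z
  -- The infimum is taken over a nonempty set, as the cover is bounded.
  have hne : {ε : ℝ | coverUnion Q ⊆ setNbhd ε C ∧ C ⊆ setNbhd ε (coverUnion Q)}.Nonempty := by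
    refine ⟨R, fun w hw => mem_iUnion₂.2 ⟨z, hz, mem_nbhd_of_dist_lt (hR hw)⟩,
      fun w hw => mem_iUnion₂.2 ⟨w, hsub hw, mem_nbhd_of_dist_lt ?_⟩⟩
    rwa [dist_self]
  obtain ⟨ε', h1, h2⟩ := exists_lt_of_csInf_lt hne h
  refine h1.1.trans fun w hw => ?_
  obtain ⟨y, hy, hwy⟩ := mem_iUnion₂.1 hw
  exact mem_iUnion₂.2 ⟨y, hy, hwy.1.trans h2, hwy.2.trans h2⟩

theorem center_mem_toSet {N : NbhdCode} (h : 0 < N.2.val) : pt N.1 ∈ NbhdCode.toSet N := by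
  constructor <;> simpa [pt] using h

/-- As an arc of finite length has no interior points, the radii of neighborhoods that cover it
tightly tend to zero. -/
theorem radius_tendsto {C : Set Plane} (hC : IsCompact C) (hd : Dense Cᶜ)
    {Q : ℕ → List NbhdCode} (hpos : ∀ n, ∀ N ∈ Q n, 0 < N.2.val)
    (hQ : ∀ n, coverUnion (Q n) ⊆ setNbhd ((1 / 2 : ℝ) ^ n) C) {δ : ℝ} (hδ : 0 < δ) :
    ∃ m, ∀ n ≥ m, ∀ N ∈ Q n, N.2.val < δ := by
  by_contra! hcon
  choose n hn N hN hr using hcon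
  have hsmall : ∀ m, (1 / 2 : ℝ) ^ n m ≤ (1 / 2 : ℝ) ^ m := fun m =>
    pow_le_pow_of_le_one (by norm_num) (by norm_num) (hn m)
  have hinf : ∀ m, ∀ w ∈ NbhdCode.toSet (N m), Metric.infDist w C ≤ 2 * (1 / 2 : ℝ) ^ m := by
    intro m w hw
    obtain ⟨z, hz, hwz⟩ := mem_iUnion₂.1 (hQ (n m) (mem_iUnion₂.2 ⟨N m, hN m, hw⟩))
    have := dist_lt_of_mem_nbhd hwz
    linarith [Metric.infDist_le_dist_of_mem (x := w) hz, hsmall m]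
  have hne : C.Nonempty := by
    obtain ⟨z, hz, -⟩ := mem_iUnion₂.1
      (hQ (n 0) (mem_iUnion₂.2 ⟨N 0, hN 0, center_mem_toSet (hpos _ _ (hN 0))⟩))
    exact ⟨z, hz⟩
  obtain ⟨c, -, φ, hφ, hlim⟩ := (hC.cthickening (r := 2)).tendsto_subseq
    (x := fun m => pt (N m).1) (fun m => by
      obtain ⟨z, hz, hwz⟩ := mem_iUnion₂.1
        (hQ (n m) (mem_iUnion₂.2 ⟨N m, hN m, center_mem_toSet (hpos _ _ (hN m))⟩))
      refine Metric.mem_cthickening_of_dist_le _ z _ _ hz ?_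
      have h1 := dist_lt_of_mem_nbhd hwz
      have h2 : (1 / 2 : ℝ) ^ n m ≤ 1 := pow_le_one₀ (by norm_num) (by norm_num)
      linarith)
  have hsub : Metric.ball c (δ / 2) ⊆ C := by
    intro w hw
    rw [hC.isClosed.mem_iff_infDist_zero hne]
    refine le_antisymm ?_ Metric.infDist_nonneg
    have h1 : ∀ᶠ m in atTop, Metric.infDist w C ≤ 2 * (1 / 2 : ℝ) ^ φ m := by
      filter_upwards [hlim.eventually (Metric.ball_mem_nhds c (half_pos hδ))] with m hm
      refine hinf (φ m) w ?_
      have h2 : dist w (pt (N (φ m)).1) < (N (φ m)).2.val := by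
        have h3 : dist (pt (N (φ m)).1) c < δ / 2 := hm
        have h4 : dist w c < δ / 2 := hw
        have := dist_triangle_right w (pt (N (φ m)).1) c
        linarith [hr (φ m)]
      exact mem_nbhd_of_dist_lt h2
    have h2 : Tendsto (fun m => 2 * (1 / 2 : ℝ) ^ φ m) atTop (𝓝 (2 * 0)) :=
      ((tendsto_pow_atTop_nhds_zero_of_lt_one (by norm_num) (by norm_num)).comp
        hφ.tendsto_atTop).const_mul 2
    rw [mul_zero] at h2
    exact ge_of_tendsto h2 h1
  obtain ⟨w, hw, hwC⟩ := hd.inter_open_nonempty _ Metric.isOpen_ball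
    ⟨c, Metric.mem_ball_self (half_pos hδ)⟩
  exact hwC (hsub hw)

/-- A cover of a `K`-computable arc is eventually refined by the given approximations, whose
neighborhoods become small, and each neighborhood of such an approximation is close to a point of
the arc. -/
theorem KComputable.effCompact_and_effOvert {C : Set Plane} {g : ℝ → Plane} (hgC : IsInjParam g C)
    (hv : eVariationOn g (Icc 0 1) ≠ ∞) (h : KComputable C) : EffCompact C ∧ EffOvert C := by
  obtain ⟨-, Q, hQc, hpos, hQ⟩ := h
  have hCc := hgC.isCompact
  have hQn := fun n => coverUnion_subset_setNbhd hgC.nonempty (hQ n).1 (hQ n).2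
  have hrad := fun δ (hδ : 0 < δ) =>
    radius_tendsto hCc (dense_compl_of_isInjParam hgC hv) hpos hQn (δ := δ) hδ
  have hpow : ∀ δ > 0, ∃ m, ∀ n ≥ m, (1 / 2 : ℝ) ^ n < δ := by
    intro δ hδ
    obtain ⟨m, hm⟩ := exists_pow_lt_of_lt_one hδ (show (1 / 2 : ℝ) < 1 by norm_num)
    exact ⟨m, fun n hn => (pow_le_pow_of_le_one (by norm_num) (by norm_num) hn).trans_lt hm⟩
  constructor
  · have h1 : Semidec fun x : ((List (RatCode × RatCode) × RatCode) × ℕ) × List NbhdCode =>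
        Q x.1.2 = x.2 ∧ ∀ N ∈ x.2, ∃ w ∈ x.1.1.1,
          |N.1.1.val - w.1.val| + N.2.val ≤ x.1.1.2.val ∧
          |N.1.2.val - w.2.val| + N.2.val ≤ x.1.1.2.val := by
      refine Semidec.and ((Semidec.graph hQc).comp
        (f := fun x : ((List (RatCode × RatCode) × RatCode) × ℕ) × List NbhdCode =>
          (x.1.2, x.2)) ((Primrec.snd.comp Primrec.fst).pair Primrec.snd)) ?_
      refine Semidec.forall_mem (p := fun (x : ((List (RatCode × RatCode) × RatCode) × ℕ) ×
        List NbhdCode) (N : NbhdCode) => ∃ w ∈ x.1.1.1,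
          |N.1.1.val - w.1.val| + N.2.val ≤ x.1.1.2.val ∧
          |N.1.2.val - w.2.val| + N.2.val ≤ x.1.1.2.val) ?_ Primrec.snd
      refine Semidec.exists_mem (p := fun (x : (((List (RatCode × RatCode) × RatCode) × ℕ) ×
        List NbhdCode) × NbhdCode) (w : RatCode × RatCode) =>
          |x.2.1.1.val - w.1.val| + x.2.2.val ≤ x.1.1.1.2.val ∧
          |x.2.1.2.val - w.2.val| + x.2.2.val ≤ x.1.1.1.2.val) ?_
        (Primrec.fst.comp (Primrec.fst.comp (Primrec.fst.comp Primrec.fst)))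
      refine PrimrecPred.semidec ?_
      have pN : Primrec fun x : ((((List (RatCode × RatCode) × RatCode) × ℕ) ×
        List NbhdCode) × NbhdCode) × (RatCode × RatCode) => x.1.2 := Primrec.snd.comp Primrec.fst
      have pr : Primrec fun x : ((((List (RatCode × RatCode) × RatCode) × ℕ) ×
        List NbhdCode) × NbhdCode) × (RatCode × RatCode) => x.1.1.1.1.2 :=
        Primrec.snd.comp (Primrec.fst.comp (Primrec.fst.comp (Primrec.fst.comp Primrec.fst)))
      have pN0 := primrecRat_val (Primrec.fst.comp (Primrec.fst.comp pN))
      have pN1 := primrecRat_val (Primrec.snd.comp (Primrec.fst.comp pN))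
      have pNr := primrecRat_val (Primrec.snd.comp pN)
      have pw0 := primrecRat_val ((Primrec.fst.comp Primrec.snd) : Primrec fun x :
        ((((List (RatCode × RatCode) × RatCode) × ℕ) × List NbhdCode) × NbhdCode) ×
        (RatCode × RatCode) => x.2.1)
      have pw1 := primrecRat_val ((Primrec.snd.comp Primrec.snd) : Primrec fun x :
        ((((List (RatCode × RatCode) × RatCode) × ℕ) × List NbhdCode) × NbhdCode) ×
        (RatCode × RatCode) => x.2.2)
      exact (((pN0.sub pw0).abs.add pNr).le (primrecRat_val pr)).and
        (((pN1.sub pw1).abs.add pNr).le (primrecRat_val pr))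
    have h2 := Semidec.exists (p := fun (x : (List (RatCode × RatCode) × RatCode) × ℕ)
        (L : List NbhdCode) => Q x.2 = L ∧ ∀ N ∈ L, ∃ w ∈ x.1.1,
          |N.1.1.val - w.1.val| + N.2.val ≤ x.1.2.val ∧
          |N.1.2.val - w.2.val| + N.2.val ≤ x.1.2.val) h1
    refine (Semidec.exists_nat (p := fun (x : List (RatCode × RatCode) × RatCode) (n : ℕ) =>
        ∃ L, Q n = L ∧ ∀ N ∈ L, ∃ w ∈ x.1,
          |N.1.1.val - w.1.val| + N.2.val ≤ x.2.val ∧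
          |N.1.2.val - w.2.val| + N.2.val ≤ x.2.val) h2).of_iff ?_
    rintro ⟨W, r⟩
    dsimp only
    constructor
    · intro hW
      obtain ⟨δ, hδ, hleb⟩ := lebesgue_number_lemma_of_metric (s := C)
        (c := fun w : {w // w ∈ W} => nbhd r.val (pt w.1)) hCc (fun w => isOpen_nbhd _ _)
        (fun z hz => by
          obtain ⟨w, hw, hzw⟩ := hW z hz
          exact mem_iUnion.2 ⟨⟨w, hw⟩, hzw⟩)
      obtain ⟨m₁, hm₁⟩ := hrad (δ / 4) (by positivity)
      obtain ⟨m₂, hm₂⟩ := hpow (δ / 4) (by positivity)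
      refine ⟨max m₁ m₂, _, rfl, fun N hN => ?_⟩
      have hN0 := hpos _ N hN
      have hNδ := hm₁ _ (le_max_left m₁ m₂) N hN
      obtain ⟨z, hz, hcz⟩ := mem_iUnion₂.1
        (hQn _ (mem_iUnion₂.2 ⟨N, hN, center_mem_toSet hN0⟩))
      have hcz' := dist_lt_of_mem_nbhd hcz
      have hpw := hm₂ _ (le_max_right m₁ m₂)
      obtain ⟨⟨w, hw⟩, hball⟩ := hleb z hz
      refine ⟨w, hw, ?_⟩
      -- The four points that are farthest from the center of `N` lie in the ball around `z`.
      have key : ∀ p q : ℝ, p ^ 2 + q ^ 2 = N.2.val ^ 2 →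
          !₂[N.1.1.val + p, N.1.2.val + q] ∈ nbhd r.val (pt w) := by
        intro p q hpq
        refine hball ?_
        have h1 : dist (!₂[N.1.1.val + p, N.1.2.val + q] : Plane) (pt N.1) = N.2.val := by
          rw [← abs_of_nonneg (dist_nonneg (x := (!₂[N.1.1.val + p, N.1.2.val + q] : Plane))),
            ← abs_of_pos hN0, ← sq_eq_sq_iff_abs_eq_abs, dist_sq_plane, ← hpq]
          simp
        have := dist_triangle (!₂[N.1.1.val + p, N.1.2.val + q] : Plane) (pt N.1) z
        rw [Metric.mem_ball]
        linarith
      have k1 := abs_lt.1 (key N.2.val 0 (by ring)).1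
      have k2 := abs_lt.1 (key (-N.2.val) 0 (by ring)).1
      have k3 := abs_lt.1 (key 0 N.2.val (by ring)).2
      have k4 := abs_lt.1 (key 0 (-N.2.val) (by ring)).2
      simp at k1 k2 k3 k4
      constructor
      · rcases abs_cases (N.1.1.val - w.1.val) with h | h <;> linarith
      · rcases abs_cases (N.1.2.val - w.2.val) with h | h <;> linarith
    · rintro ⟨n, L, rfl, hL⟩ z hz
      obtain ⟨N, hN, hzN⟩ := mem_iUnion₂.1 ((hQ n).1 hz)
      obtain ⟨w, hw, h0, h1⟩ := hL N hN
      refine ⟨w, hw, ?_, ?_⟩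
      · have : |z 0 - N.1.1.val| < N.2.val := hzN.1
        rw [pt_zero]
        linarith [abs_sub_le (z 0) N.1.1.val w.1.val]
      · have : |z 1 - N.1.2.val| < N.2.val := hzN.2
        rw [pt_one]
        linarith [abs_sub_le (z 1) N.1.2.val w.2.val]
  · have h1 : Semidec fun x : (((RatCode × RatCode) × RatCode) × ℕ) × List NbhdCode =>
        Q x.1.2 = x.2 ∧ ∃ N ∈ x.2,
          |N.1.1.val - x.1.1.1.1.val| + (1 / 2 : ℝ) ^ x.1.2 ≤ x.1.1.2.val ∧
          |N.1.2.val - x.1.1.1.2.val| + (1 / 2 : ℝ) ^ x.1.2 ≤ x.1.1.2.val := by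
      refine Semidec.and ((Semidec.graph hQc).comp
        (f := fun x : (((RatCode × RatCode) × RatCode) × ℕ) × List NbhdCode =>
          (x.1.2, x.2)) ((Primrec.snd.comp Primrec.fst).pair Primrec.snd)) ?_
      refine Semidec.exists_mem (p := fun (x : (((RatCode × RatCode) × RatCode) × ℕ) ×
        List NbhdCode) (N : NbhdCode) =>
          |N.1.1.val - x.1.1.1.1.val| + (1 / 2 : ℝ) ^ x.1.2 ≤ x.1.1.2.val ∧
          |N.1.2.val - x.1.1.1.2.val| + (1 / 2 : ℝ) ^ x.1.2 ≤ x.1.1.2.val) ?_ Primrec.snd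
      refine PrimrecPred.semidec ?_
      have pN : Primrec fun x : ((((RatCode × RatCode) × RatCode) × ℕ) ×
        List NbhdCode) × NbhdCode => x.2 := Primrec.snd
      have pn : Primrec fun x : ((((RatCode × RatCode) × RatCode) × ℕ) ×
        List NbhdCode) × NbhdCode => x.1.1.2 := Primrec.snd.comp (Primrec.fst.comp Primrec.fst)
      have pw : Primrec fun x : ((((RatCode × RatCode) × RatCode) × ℕ) ×
        List NbhdCode) × NbhdCode => x.1.1.1 := Primrec.fst.comp (Primrec.fst.comp Primrec.fst)
      have pN0 := primrecRat_val (Primrec.fst.comp (Primrec.fst.comp pN))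
      have pN1 := primrecRat_val (Primrec.snd.comp (Primrec.fst.comp pN))
      have pw0 := primrecRat_val (Primrec.fst.comp (Primrec.fst.comp pw))
      have pw1 := primrecRat_val (Primrec.snd.comp (Primrec.fst.comp pw))
      have pr := primrecRat_val (Primrec.snd.comp pw)
      exact (((pN0.sub pw0).abs.add (PrimrecRat.half_pow pn)).le pr).and
        (((pN1.sub pw1).abs.add (PrimrecRat.half_pow pn)).le pr)
    have h2 := Semidec.exists (p := fun (x : ((RatCode × RatCode) × RatCode) × ℕ)
        (L : List NbhdCode) => Q x.2 = L ∧ ∃ N ∈ L,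
          |N.1.1.val - x.1.1.1.val| + (1 / 2 : ℝ) ^ x.2 ≤ x.1.2.val ∧
          |N.1.2.val - x.1.1.2.val| + (1 / 2 : ℝ) ^ x.2 ≤ x.1.2.val) h1
    refine (Semidec.exists_nat (p := fun (x : (RatCode × RatCode) × RatCode) (n : ℕ) =>
        ∃ L, Q n = L ∧ ∃ N ∈ L,
          |N.1.1.val - x.1.1.val| + (1 / 2 : ℝ) ^ n ≤ x.2.val ∧
          |N.1.2.val - x.1.2.val| + (1 / 2 : ℝ) ^ n ≤ x.2.val) h2).of_iff ?_
    rintro ⟨w, r⟩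
    dsimp only
    constructor
    · rintro ⟨z, hz, hz0, hz1⟩
      rw [pt_zero] at hz0
      rw [pt_one] at hz1
      set s := min (r.val - |z 0 - w.1.val|) (r.val - |z 1 - w.2.val|) with hs
      have hs0 : 0 < s := lt_min (by linarith) (by linarith)
      have hs1 : s ≤ r.val - |z 0 - w.1.val| := min_le_left _ _
      have hs2 : s ≤ r.val - |z 1 - w.2.val| := min_le_right _ _
      obtain ⟨m₁, hm₁⟩ := hrad (s / 2) (by positivity)
      obtain ⟨m₂, hm₂⟩ := hpow (s / 2) (by positivity)
      obtain ⟨N, hN, hzN0, hzN1⟩ := mem_iUnion₂.1 ((hQ (max m₁ m₂)).1 hz)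
      have hzN0 : |z 0 - N.1.1.val| < N.2.val := hzN0
      have hzN1 : |z 1 - N.1.2.val| < N.2.val := hzN1
      have h3 := hm₁ _ (le_max_left _ _) N hN
      have h4 := hm₂ _ (le_max_right m₁ m₂)
      refine ⟨_, _, rfl, N, hN, ?_, ?_⟩
      · have := abs_sub_le N.1.1.val (z 0) w.1.val
        rw [abs_sub_comm N.1.1.val (z 0)] at this
        linarith
      · have := abs_sub_le N.1.2.val (z 1) w.2.val
        rw [abs_sub_comm N.1.2.val (z 1)] at this
        linarith
    · rintro ⟨n, L, rfl, N, hN, h0, h1⟩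
      obtain ⟨z, hz, hz0, hz1⟩ := mem_iUnion₂.1
        (hQn n (mem_iUnion₂.2 ⟨N, hN, center_mem_toSet (hpos n N hN)⟩))
      rw [pt_zero, abs_sub_comm] at hz0
      rw [pt_one, abs_sub_comm] at hz1
      refine ⟨z, hz, ?_, ?_⟩
      · rw [pt_zero]
        linarith [abs_sub_le (z 0) N.1.1.val w.1.val]
      · rw [pt_one]
        linarith [abs_sub_le (z 1) N.1.2.val w.2.val]

/-! ### `R`-computable curves -/

/-- The last term of a nonempty list of rational numbers. -/
noncomputable def lastVal (τ : List RatCode) : ℝ := (τ.getD (τ.length - 1) (0, 0)).val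

/-- A nonempty list that satisfies the inequalities required of the initial parts of names. -/
def IsNamePart (τ : List RatCode) : Prop :=
  0 < τ.length ∧ ∀ i ∈ List.range (τ.length - 1),
    |(τ.getD i (0, 0)).val - (τ.getD (i + 1) (0, 0)).val| ≤ (1 / 2 : ℝ) ^ i

/-- The initial part of a name extends to a name of each real number that is close to its last
term. -/
theorem exists_isName_of_isNamePart {τ : List RatCode} (hτ : IsNamePart τ) {x : ℝ}
    (hx : |x - lastVal τ| < (1 / 2 : ℝ) ^ τ.length) :
    ∃ a, IsName a x ∧ ∀ k, ∃ m, initialPart a m = τ.take k := by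
  obtain ⟨hpos, hτ⟩ := hτ
  choose c hc using fun n : ℕ => exists_ratCode_near x (ε := (1 / 2 : ℝ) ^ (n + 1)) (by positivity)
  set a : ℕ → RatCode := fun n => if n < τ.length then τ.getD n (0, 0) else c n with ha
  have ha1 : ∀ n, n < τ.length → a n = τ.getD n (0, 0) := fun n hn => by simp only [ha, if_pos hn]
  have ha2 : ∀ n, ¬ n < τ.length → a n = c n := fun n hn => by simp only [ha, if_neg hn]
  refine ⟨a, ⟨fun n => ?_, ?_⟩, fun k => ⟨min k τ.length, ?_⟩⟩
  · by_cases h1 : n + 1 < τ.length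
    · rw [ha1 n (by omega), ha1 (n + 1) h1]
      exact hτ n (List.mem_range.2 (by omega))
    · by_cases h2 : n < τ.length
      · have hn : n + 1 = τ.length := by omega
        rw [ha1 n h2, ha2 _ h1]
        have h3 : lastVal τ = (τ.getD n (0, 0)).val := by
          rw [lastVal, ← hn, Nat.add_sub_cancel]
        rw [h3, ← hn] at hx
        have h4 := abs_lt.1 (hc (n + 1))
        have h5 := abs_lt.1 hx
        have h6 : (1 / 2 : ℝ) ^ (n + 1 + 1) = (1 / 2) ^ n / 4 := by ring
        have h7 : (1 / 2 : ℝ) ^ (n + 1) = (1 / 2) ^ n / 2 := by ring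
        have h8 : 0 < (1 / 2 : ℝ) ^ n := by positivity
        rw [h6] at h4
        rw [h7] at h5
        exact abs_le.2 ⟨by linarith, by linarith⟩
      · rw [ha2 n h2, ha2 _ h1]
        have h4 := abs_lt.1 (hc (n + 1))
        have h5 := abs_lt.1 (hc n)
        have h6 : (1 / 2 : ℝ) ^ (n + 1 + 1) = (1 / 2) ^ n / 4 := by ring
        have h7 : (1 / 2 : ℝ) ^ (n + 1) = (1 / 2) ^ n / 2 := by ring
        have h8 : 0 < (1 / 2 : ℝ) ^ n := by positivity
        rw [h6] at h4
        rw [h7] at h5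
        exact abs_le.2 ⟨by linarith, by linarith⟩
  · rw [tendsto_iff_dist_tendsto_zero]
    have h1 : Tendsto (fun n : ℕ => (1 / 2 : ℝ) ^ (n + 1)) atTop (𝓝 0) :=
      (tendsto_pow_atTop_nhds_zero_of_lt_one (by norm_num) (by norm_num)).comp
        (tendsto_add_atTop_nat 1)
    refine squeeze_zero' (Eventually.of_forall fun _ => dist_nonneg) ?_ h1
    filter_upwards [eventually_ge_atTop τ.length] with n hn
    rw [ha2 n (not_lt.2 hn), Real.dist_eq]
    exact (hc n).le
  · refine List.ext_getElem (by simp [initialPart]) fun i h1 h2 => ?_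
    have h3 : i < τ.length := by
      rw [List.length_take] at h2; omega
    simp [initialPart, ha1 i h3, h3]

theorem isName_of_abs_sub_le {b : ℕ → RatCode} {y : ℝ}
    (h : ∀ n, |(b n).val - y| ≤ (1 / 2 : ℝ) ^ (n + 1)) : IsName b y := by
  refine ⟨fun n => ?_, ?_⟩
  · have h4 := abs_le.1 (h (n + 1))
    have h5 := abs_le.1 (h n)
    have h6 : (1 / 2 : ℝ) ^ (n + 1 + 1) = (1 / 2) ^ n / 4 := by ring
    have h7 : (1 / 2 : ℝ) ^ (n + 1) = (1 / 2) ^ n / 2 := by ring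
    have h8 : 0 < (1 / 2 : ℝ) ^ n := by positivity
    rw [h6] at h4
    rw [h7] at h5
    exact abs_le.2 ⟨by linarith, by linarith⟩
  · rw [tendsto_iff_dist_tendsto_zero]
    have h1 : Tendsto (fun n : ℕ => (1 / 2 : ℝ) ^ (n + 1)) atTop (𝓝 0) :=
      (tendsto_pow_atTop_nhds_zero_of_lt_one (by norm_num) (by norm_num)).comp
        (tendsto_add_atTop_nat 1)
    refine squeeze_zero (fun _ => dist_nonneg) (fun n => ?_) h1
    rw [Real.dist_eq]
    exact h n

theorem exists_isName_near (x : ℝ) :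
    ∃ a, IsName a x ∧ ∀ n, |(a n).val - x| < (1 / 2 : ℝ) ^ (n + 1) := by
  choose c hc using fun n : ℕ => exists_ratCode_near x (ε := (1 / 2 : ℝ) ^ (n + 1)) (by positivity)
  exact ⟨c, isName_of_abs_sub_le fun n => (hc n).le, hc⟩

/-- A record of finite computations of two machines: the part of the input that was provided, how
much of it each machine has read, the index of the output term, and the two answers. -/
abbrev Run : Type := (List RatCode × ℕ × ℕ) × ℕ × (RatCode × RatCode)

/-- The record describes actual computations of the machines `M₀` and `M₁` on an initial part of
a name. -/
def IsRun (M₀ M₁ : List RatCode → ℕ → Option RatCode) (d : Run) : Prop :=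
  IsNamePart d.1.1 ∧ M₀ (d.1.1.take d.1.2.1) d.2.1 = some d.2.2.1 ∧
    M₁ (d.1.1.take d.1.2.2) d.2.1 = some d.2.2.2

/-- All numbers in this interval have a name with the input part of the record. -/
def Run.inputs (d : Run) : Set ℝ := {x | |x - lastVal d.1.1| < (1 / 2 : ℝ) ^ d.1.1.length}

theorem isOpen_inputs (d : Run) : IsOpen d.inputs := by
  have : Continuous fun x : ℝ => |x - lastVal d.1.1| := by fun_prop
  exact isOpen_lt this continuous_const

theorem semidec_isRun {M₀ M₁ : List RatCode → ℕ → Option RatCode} (h₀ : Computable₂ M₀)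
    (h₁ : Computable₂ M₁) : Semidec fun d : Run => IsRun M₀ M₁ d := by
  have pτ : Primrec fun d : Run => d.1.1 := Primrec.fst.comp Primrec.fst
  have pk₀ : Primrec fun d : Run => d.1.2.1 := Primrec.fst.comp (Primrec.snd.comp Primrec.fst)
  have pk₁ : Primrec fun d : Run => d.1.2.2 := Primrec.snd.comp (Primrec.snd.comp Primrec.fst)
  have pn : Primrec fun d : Run => d.2.1 := Primrec.fst.comp Primrec.snd
  have pq₀ : Primrec fun d : Run => d.2.2.1 := Primrec.fst.comp (Primrec.snd.comp Primrec.snd)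
  have pq₁ : Primrec fun d : Run => d.2.2.2 := Primrec.snd.comp (Primrec.snd.comp Primrec.snd)
  refine Semidec.and (Semidec.and (PrimrecPred.semidec ?_) ?_) (Semidec.and ?_ ?_)
  · exact Primrec.nat_lt.comp (Primrec.const 0) (Primrec.list_length.comp pτ)
  · refine Semidec.forall_mem (p := fun (d : Run) i =>
      |(d.1.1.getD i (0, 0)).val - (d.1.1.getD (i + 1) (0, 0)).val| ≤ (1 / 2 : ℝ) ^ i)
      (PrimrecPred.semidec ?_) (Primrec.list_range.comp
        (Primrec.nat_sub.comp (Primrec.list_length.comp pτ) (Primrec.const 1)))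
    exact ((primrecRat_val ((Primrec.list_getD _).comp (pτ.comp Primrec.fst) Primrec.snd)).sub
      (primrecRat_val ((Primrec.list_getD _).comp (pτ.comp Primrec.fst)
        (Primrec.succ.comp Primrec.snd)))).abs.le (PrimrecRat.half_pow Primrec.snd)
  · exact (Semidec.graph h₀).comp (f := fun d : Run =>
      ((d.1.1.take d.1.2.1, d.2.1), some d.2.2.1))
      (((Primrec.list_take.comp pk₀ pτ).pair pn).pair (Primrec.option_some.comp pq₀))
  · exact (Semidec.graph h₁).comp (f := fun d : Run =>
      ((d.1.1.take d.1.2.2, d.2.1), some d.2.2.2))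
      (((Primrec.list_take.comp pk₁ pτ).pair pn).pair (Primrec.option_some.comp pq₁))

theorem primrecRat_lastVal : PrimrecRat lastVal :=
  primrecRat_val ((Primrec.list_getD _).comp Primrec.id
    (Primrec.nat_sub.comp Primrec.list_length (Primrec.const 1)))

/-- `M` is a machine that computes the function `f` on the unit interval. -/
def Computes (M : List RatCode → ℕ → Option RatCode) (f : ℝ → ℝ) : Prop :=
  ∀ x ∈ Icc (0 : ℝ) 1, ∀ a : ℕ → RatCode, IsName a x →
    ∃ b : ℕ → RatCode, IsName b (f x) ∧
      ∀ n, (∃ k, M (initialPart a k) n = some (b n)) ∧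
        ∀ k q, M (initialPart a k) n = some q → q = b n

/-- As each number in `d.inputs` has a name with the input part of the record, the answers are
approximations of the function values at all of them. -/
theorem IsRun.abs_sub_le {M₀ M₁ : List RatCode → ℕ → Option RatCode} {f₀ f₁ : ℝ → ℝ}
    (h₀ : Computes M₀ f₀) (h₁ : Computes M₁ f₁) {d : Run} (hd : IsRun M₀ M₁ d) {x : ℝ}
    (hx : x ∈ Icc (0 : ℝ) 1) (hxd : x ∈ d.inputs) :
    |f₀ x - d.2.2.1.val| ≤ 2 * (1 / 2 : ℝ) ^ d.2.1 ∧
      |f₁ x - d.2.2.2.val| ≤ 2 * (1 / 2 : ℝ) ^ d.2.1 := by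
  obtain ⟨hτ, r₀, r₁⟩ := hd
  obtain ⟨a, ha, hpart⟩ := exists_isName_of_isNamePart hτ hxd
  constructor
  · obtain ⟨b, hb, hM⟩ := h₀ x hx a ha
    obtain ⟨m, hm⟩ := hpart d.1.2.1
    have hq := (hM d.2.1).2 m d.2.2.1 (by rw [hm]; exact r₀)
    rw [hq, abs_sub_comm]
    exact hb.abs_sub_le _
  · obtain ⟨b, hb, hM⟩ := h₁ x hx a ha
    obtain ⟨m, hm⟩ := hpart d.1.2.2
    have hq := (hM d.2.1).2 m d.2.2.2 (by rw [hm]; exact r₁)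
    rw [hq, abs_sub_comm]
    exact hb.abs_sub_le _

theorem exists_isRun {M₀ M₁ : List RatCode → ℕ → Option RatCode} {f₀ f₁ : ℝ → ℝ}
    (h₀ : Computes M₀ f₀) (h₁ : Computes M₁ f₁) {x : ℝ} (hx : x ∈ Icc (0 : ℝ) 1) (n : ℕ) :
    ∃ d : Run, IsRun M₀ M₁ d ∧ d.2.1 = n ∧ x ∈ d.inputs := by
  obtain ⟨a, ha, hax⟩ := exists_isName_near x
  obtain ⟨b₀, -, hM₀⟩ := h₀ x hx a ha
  obtain ⟨b₁, -, hM₁⟩ := h₁ x hx a ha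
  obtain ⟨k₀, hk₀⟩ := (hM₀ n).1
  obtain ⟨k₁, hk₁⟩ := (hM₁ n).1
  set K := max k₀ k₁ with hK
  have htake : ∀ k ≤ K + 1, (initialPart a (K + 1)).take k = initialPart a k := by
    intro k hk
    rw [initialPart, initialPart, ← List.map_take, List.take_range, min_eq_left hk]
  have hget : ∀ i < K + 1, (initialPart a (K + 1)).getD i (0, 0) = a i := by
    intro i hi
    rw [List.getD_eq_getElem _ _ (by simpa [initialPart] using hi)]
    simp [initialPart]
  have hlen : (initialPart a (K + 1)).length = K + 1 := by simp [initialPart]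
  refine ⟨((initialPart a (K + 1), k₀, k₁), n, b₀ n, b₁ n), ⟨⟨?_, ?_⟩, ?_, ?_⟩, rfl, ?_⟩
  · simp [hlen]
  · intro i hi
    dsimp only at hi ⊢
    rw [hlen, List.mem_range] at hi
    rw [hget i (by omega), hget (i + 1) (by omega)]
    exact ha.1 i
  · rw [htake k₀ ((le_max_left _ _).trans (Nat.le_succ _))]; exact hk₀
  · rw [htake k₁ ((le_max_right _ _).trans (Nat.le_succ _))]; exact hk₁
  · change |x - lastVal _| < (1 / 2 : ℝ) ^ (initialPart a (K + 1)).length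
    rw [lastVal, hlen, Nat.add_sub_cancel, hget K (by omega), abs_sub_comm]
    exact hax K

/-- The points that the machines may output after the computations in the record lie in the
neighborhood with center `w` and radius `r`. -/
def Run.Within (d : Run) (w : RatCode × RatCode) (r : RatCode) : Prop :=
  |d.2.2.1.val - w.1.val| + 2 * (1 / 2 : ℝ) ^ d.2.1 < r.val ∧
    |d.2.2.2.val - w.2.val| + 2 * (1 / 2 : ℝ) ^ d.2.1 < r.val

theorem primrecPred_within :
    PrimrecPred fun x : Run × (RatCode × RatCode) × RatCode => x.1.Within x.2.1 x.2.2 := by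
  have pn : Primrec fun x : Run × (RatCode × RatCode) × RatCode => x.1.2.1 :=
    Primrec.fst.comp (Primrec.snd.comp Primrec.fst)
  have pq : Primrec fun x : Run × (RatCode × RatCode) × RatCode => x.1.2.2 :=
    Primrec.snd.comp (Primrec.snd.comp Primrec.fst)
  have pw : Primrec fun x : Run × (RatCode × RatCode) × RatCode => x.2.1 :=
    Primrec.fst.comp Primrec.snd
  have pr := primrecRat_val ((Primrec.snd.comp Primrec.snd) :
    Primrec fun x : Run × (RatCode × RatCode) × RatCode => x.2.2)
  have pe := (PrimrecRat.ofNat 2).mul (PrimrecRat.half_pow pn)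
  exact ((((primrecRat_val (Primrec.fst.comp pq)).sub
    (primrecRat_val (Primrec.fst.comp pw))).abs.add pe).lt pr).and
    ((((primrecRat_val (Primrec.snd.comp pq)).sub
    (primrecRat_val (Primrec.snd.comp pw))).abs.add pe).lt pr)

theorem Run.Within.mem_nbhd {M₀ M₁ : List RatCode → ℕ → Option RatCode} {f : ℝ → Plane}
    (h₀ : Computes M₀ fun t => f t 0) (h₁ : Computes M₁ fun t => f t 1) {d : Run}
    {w : RatCode × RatCode} {r : RatCode} (hw : d.Within w r) (hd : IsRun M₀ M₁ d)
    {x : ℝ} (hx : x ∈ Icc (0 : ℝ) 1) (hxd : x ∈ d.inputs) : f x ∈ nbhd r.val (pt w) := by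
  obtain ⟨a₀, a₁⟩ := hd.abs_sub_le h₀ h₁ hx hxd
  obtain ⟨b₀, b₁⟩ := hw
  constructor
  · rw [pt_zero]
    linarith [abs_sub_le (f x 0) d.2.2.1.val w.1.val]
  · rw [pt_one]
    linarith [abs_sub_le (f x 1) d.2.2.2.val w.2.val]

theorem exists_isRun_within {M₀ M₁ : List RatCode → ℕ → Option RatCode} {f : ℝ → Plane}
    (h₀ : Computes M₀ fun t => f t 0) (h₁ : Computes M₁ fun t => f t 1)
    {w : RatCode × RatCode} {r : RatCode} {x : ℝ} (hx : x ∈ Icc (0 : ℝ) 1)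
    (h : f x ∈ nbhd r.val (pt w)) :
    ∃ d : Run, IsRun M₀ M₁ d ∧ x ∈ d.inputs ∧ d.Within w r := by
  obtain ⟨hf₀, hf₁⟩ := h
  rw [pt_zero] at hf₀
  rw [pt_one] at hf₁
  obtain ⟨n, hn⟩ := exists_pow_lt_of_lt_one
    (show 0 < min (r.val - |f x 0 - w.1.val|) (r.val - |f x 1 - w.2.val|) / 4 from
      div_pos (lt_min (by linarith) (by linarith)) (by norm_num))
    (show (1 / 2 : ℝ) < 1 by norm_num)
  have hn₀ := min_le_left (r.val - |f x 0 - w.1.val|) (r.val - |f x 1 - w.2.val|)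
  have hn₁ := min_le_right (r.val - |f x 0 - w.1.val|) (r.val - |f x 1 - w.2.val|)
  obtain ⟨d, hd, rfl, hxd⟩ := exists_isRun h₀ h₁ hx n
  obtain ⟨a₀, a₁⟩ := hd.abs_sub_le h₀ h₁ hx hxd
  rw [abs_sub_comm] at a₀ a₁
  refine ⟨d, hd, hxd, ?_, ?_⟩
  · linarith [abs_sub_le d.2.2.1.val (f x 0) w.1.val]
  · linarith [abs_sub_le d.2.2.2.val (f x 1) w.2.val]

/-- A rational neighborhood meets the range of a computable path if and only if some run, on inputs
that some argument in the unit interval has, has outputs well within it. -/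
theorem effOvert_of_computablePath {f : ℝ → Plane} (hf : ComputablePath f) :
    EffOvert (f '' Icc 0 1) := by
  obtain ⟨M₀, c₀, h₀⟩ : ComputableOnUnit fun t => f t 0 := hf 0
  obtain ⟨M₁, c₁, h₁⟩ : ComputableOnUnit fun t => f t 1 := hf 1
  have pd : Primrec fun x : ((RatCode × RatCode) × RatCode) × Run => x.2 := Primrec.snd
  have pl : PrimrecRat fun x : ((RatCode × RatCode) × RatCode) × Run => lastVal x.2.1.1 :=
    primrecRat_lastVal.comp (Primrec.fst.comp (Primrec.fst.comp pd))
  have pp : PrimrecRat fun x : ((RatCode × RatCode) × RatCode) × Run =>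
      (1 / 2 : ℝ) ^ x.2.1.1.length :=
    PrimrecRat.half_pow (Primrec.list_length.comp (Primrec.fst.comp (Primrec.fst.comp pd)))
  have h : Semidec fun x : ((RatCode × RatCode) × RatCode) × Run =>
      IsRun M₀ M₁ x.2 ∧ x.2.Within x.1.1 x.1.2 ∧
        -(1 / 2 : ℝ) ^ x.2.1.1.length < lastVal x.2.1.1 ∧
        lastVal x.2.1.1 < 1 + (1 / 2 : ℝ) ^ x.2.1.1.length :=
    ((semidec_isRun c₀ c₁).comp pd).and
      ((primrecPred_within.comp (pd.pair Primrec.fst)).semidec.and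
        ((pp.neg.lt pl).and (pl.lt (PrimrecRat.one.add pp))).semidec)
  refine (Semidec.exists (p := fun (x : (RatCode × RatCode) × RatCode) (d : Run) =>
    IsRun M₀ M₁ d ∧ d.Within x.1 x.2 ∧ -(1 / 2 : ℝ) ^ d.1.1.length < lastVal d.1.1 ∧
      lastVal d.1.1 < 1 + (1 / 2 : ℝ) ^ d.1.1.length) h).of_iff ?_
  rintro ⟨w, r⟩
  dsimp only
  constructor
  · rintro ⟨_, ⟨x, hx, rfl⟩, hxw⟩
    obtain ⟨d, hd, hxd, hw⟩ := exists_isRun_within h₀ h₁ hx hxw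
    have := abs_lt.1 (show |x - lastVal d.1.1| < (1 / 2 : ℝ) ^ d.1.1.length from hxd)
    exact ⟨d, hd, hw, by linarith [hx.1], by linarith [hx.2]⟩
  · rintro ⟨d, hd, hw, hl, hr⟩
    set x := max 0 (min 1 (lastVal d.1.1)) with hx
    have hp : 0 < (1 / 2 : ℝ) ^ d.1.1.length := by positivity
    have hxI : x ∈ Icc (0 : ℝ) 1 := ⟨le_max_left _ _, max_le zero_le_one (min_le_left _ _)⟩
    have hxd : x ∈ d.inputs := by
      change |x - lastVal d.1.1| < _
      rw [hx, abs_lt]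
      rcases max_cases 0 (min 1 (lastVal d.1.1)) with h | h <;>
      rcases min_cases 1 (lastVal d.1.1) with h' | h' <;> constructor <;> linarith
    exact ⟨f x, mem_image_of_mem f hxI, hw.mem_nbhd h₀ h₁ hd hxI hxd⟩

/-- By compactness, finitely many runs decide for all arguments in the unit interval which
neighborhood of a cover contains the value; that their inputs exhaust the interval is checked on
a fine grid. -/
theorem effCompact_of_computablePath {f : ℝ → Plane} (hf : ComputablePath f) :
    EffCompact (f '' Icc 0 1) := by
  obtain ⟨M₀, c₀, h₀⟩ : ComputableOnUnit fun t => f t 0 := hf 0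
  obtain ⟨M₁, c₁, h₁⟩ : ComputableOnUnit fun t => f t 1 := hf 1
  let P : List (RatCode × RatCode) × RatCode → List Run × ℕ → Prop := fun x y =>
    (∀ d ∈ y.1, ∃ w ∈ x.1, IsRun M₀ M₁ d ∧ d.Within w x.2) ∧
    (∀ j ∈ List.range (y.2 + 1), ∃ d ∈ y.1,
      |(j : ℝ) * (1 / (y.2 + 1)) - lastVal d.1.1| < (1 / 2 : ℝ) ^ d.1.1.length ∧
      |((j : ℝ) + 1) * (1 / (y.2 + 1)) - lastVal d.1.1| < (1 / 2 : ℝ) ^ d.1.1.length)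
  have hP : Semidec fun x : (List (RatCode × RatCode) × RatCode) × List Run × ℕ => P x.1 x.2 := by
    refine Semidec.and ?_ ?_
    · refine Semidec.forall_mem (p := fun (x : (List (RatCode × RatCode) × RatCode) ×
        List Run × ℕ) (d : Run) => ∃ w ∈ x.1.1, IsRun M₀ M₁ d ∧ d.Within w x.1.2) ?_
        (Primrec.fst.comp Primrec.snd)
      refine Semidec.exists_mem (p := fun (x : ((List (RatCode × RatCode) × RatCode) ×
        List Run × ℕ) × Run) (w : RatCode × RatCode) =>
          IsRun M₀ M₁ x.2 ∧ x.2.Within w x.1.1.2) ?_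
        (Primrec.fst.comp (Primrec.fst.comp Primrec.fst))
      have pd : Primrec fun x : (((List (RatCode × RatCode) × RatCode) × List Run × ℕ) × Run) ×
        (RatCode × RatCode) => x.1.2 := Primrec.snd.comp Primrec.fst
      exact ((semidec_isRun c₀ c₁).comp pd).and (primrecPred_within.comp (pd.pair
        (Primrec.snd.pair (Primrec.snd.comp (Primrec.fst.comp
          (Primrec.fst.comp Primrec.fst)))))).semidec
    · refine Semidec.forall_mem (p := fun (x : (List (RatCode × RatCode) × RatCode) ×
        List Run × ℕ) (j : ℕ) => ∃ d ∈ x.2.1,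
        |(j : ℝ) * (1 / (x.2.2 + 1)) - lastVal d.1.1| < (1 / 2 : ℝ) ^ d.1.1.length ∧
        |((j : ℝ) + 1) * (1 / (x.2.2 + 1)) - lastVal d.1.1| < (1 / 2 : ℝ) ^ d.1.1.length) ?_
        (Primrec.list_range.comp (Primrec.succ.comp (Primrec.snd.comp Primrec.snd)))
      refine Semidec.exists_mem (p := fun (x : ((List (RatCode × RatCode) × RatCode) ×
        List Run × ℕ) × ℕ) (d : Run) =>
        |(x.2 : ℝ) * (1 / (x.1.2.2 + 1)) - lastVal d.1.1| < (1 / 2 : ℝ) ^ d.1.1.length ∧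
        |((x.2 : ℝ) + 1) * (1 / (x.1.2.2 + 1)) - lastVal d.1.1| < (1 / 2 : ℝ) ^ d.1.1.length) ?_
        (Primrec.fst.comp (Primrec.snd.comp Primrec.fst))
      refine PrimrecPred.semidec ?_
      have pτ : Primrec fun x : (((List (RatCode × RatCode) × RatCode) × List Run × ℕ) × ℕ) ×
        Run => x.2.1.1 := Primrec.fst.comp (Primrec.fst.comp Primrec.snd)
      have pj : PrimrecRat fun x : (((List (RatCode × RatCode) × RatCode) × List Run × ℕ) × ℕ) ×
        Run => (x.1.2 : ℝ) := PrimrecRat.natCast (Primrec.snd.comp Primrec.fst)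
      have pK : PrimrecRat fun x : (((List (RatCode × RatCode) × RatCode) × List Run × ℕ) × ℕ) ×
        Run => (1 : ℝ) / (x.1.1.2.2 + 1) := PrimrecRat.inv_succ
          (Primrec.snd.comp (Primrec.snd.comp (Primrec.fst.comp Primrec.fst)))
      have pp := PrimrecRat.half_pow (Primrec.list_length.comp pτ)
      exact (((pj.mul pK).sub (primrecRat_lastVal.comp pτ)).abs_lt pp).and
        ((((pj.add PrimrecRat.one).mul pK).sub (primrecRat_lastVal.comp pτ)).abs_lt pp)
  refine (Semidec.exists (p := P) hP).of_iff ?_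
  rintro ⟨W, r⟩
  constructor
  · intro hW
    have hex : ∀ x : ℝ, ∃ d : Run, x ∈ Icc (0 : ℝ) 1 →
        x ∈ d.inputs ∧ ∃ w ∈ W, IsRun M₀ M₁ d ∧ d.Within w r := by
      intro x
      by_cases hx : x ∈ Icc (0 : ℝ) 1
      · obtain ⟨w, hw, hfw⟩ := hW (f x) (mem_image_of_mem f hx)
        obtain ⟨d, hd, hxd, hdw⟩ := exists_isRun_within h₀ h₁ hx hfw
        exact ⟨d, fun _ => ⟨hxd, w, hw, hd, hdw⟩⟩
      · exact ⟨default, fun h => absurd h hx⟩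
    choose d hd using hex
    obtain ⟨T, hT⟩ := (isCompact_Icc (a := (0 : ℝ)) (b := 1)).elim_nhds_subcover'
      (fun x _ => (d x).inputs) (fun x hx => (isOpen_inputs _).mem_nhds (hd x hx).1)
    obtain ⟨δ, hδ, hleb⟩ := lebesgue_number_lemma_of_metric (s := Icc (0 : ℝ) 1)
      (c := fun x : {x // x ∈ T} => (d x.1).inputs) isCompact_Icc (fun x => isOpen_inputs _)
      (fun z hz => by
        obtain ⟨x, hx, hzx⟩ := mem_iUnion₂.1 (hT hz)
        exact mem_iUnion.2 ⟨⟨x, hx⟩, hzx⟩)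
    obtain ⟨K, hK⟩ := exists_nat_one_div_lt hδ
    refine ⟨(T.toList.map fun x => d x.1, K), ?_, ?_⟩
    · intro e he
      obtain ⟨x, -, rfl⟩ := List.mem_map.1 he
      exact (hd x.1 x.2).2
    · intro j hj
      rw [List.mem_range] at hj
      have hK0 : 0 < (K : ℝ) + 1 := by positivity
      have hj' : (j : ℝ) ≤ K + 1 := by exact_mod_cast hj.le
      obtain ⟨x, hball⟩ := hleb ((j : ℝ) * (1 / (K + 1)))
        ⟨by positivity, by rw [mul_one_div, div_le_one hK0]; exact hj'⟩
      refine ⟨d x.1, List.mem_map.2 ⟨x.1, Finset.mem_toList.2 x.2, rfl⟩,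
        hball (Metric.mem_ball_self hδ), hball ?_⟩
      rw [Metric.mem_ball, Real.dist_eq, add_mul, one_mul, add_sub_cancel_left,
        abs_of_pos (by positivity)]
      exact hK
  · rintro ⟨⟨D, K⟩, hD, hK⟩ _ ⟨x, hx, rfl⟩
    dsimp only at hD hK
    have hK0 : 0 < (K : ℝ) + 1 := by positivity
    obtain ⟨j, hj, hjx, hxj⟩ : ∃ j ∈ List.range (K + 1), (j : ℝ) * (1 / (K + 1)) ≤ x ∧
        x ≤ ((j : ℝ) + 1) * (1 / (K + 1)) := by
      simp only [mul_one_div, div_le_iff₀ hK0, le_div_iff₀ hK0, List.mem_range]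
      rcases hx.2.lt_or_eq with h | rfl
      · refine ⟨⌊x * (K + 1)⌋₊, ?_, Nat.floor_le (mul_nonneg hx.1 hK0.le),
          (Nat.lt_floor_add_one _).le⟩
        rw [Nat.floor_lt (mul_nonneg hx.1 hK0.le)]
        push_cast
        nlinarith
      · exact ⟨K, by omega, by linarith, by linarith⟩
    obtain ⟨d, hd, h1, h2⟩ := hK j hj
    obtain ⟨w, hw, hrun, hwithin⟩ := hD d hd
    refine ⟨w, hw, hwithin.mem_nbhd h₀ h₁ hrun hx ?_⟩
    change |x - lastVal d.1.1| < _
    rw [abs_lt] at h1 h2 ⊢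
    constructor <;> linarith

/-! ### The class of computable curves of computable length -/

/-- All that is needed of a computable curve of computable length. -/
theorem exists_param_of_mem_classC {C : Set Plane} (hC : C ∈ classC) :
    EffCompact C ∧ EffOvert C ∧ ∃ g, IsInjParam g C ∧ eVariationOn g (Icc 0 1) ≠ ∞ ∧
      Semidec fun q : RatCode => arcLen g 0 1 < q.val := by
  obtain ⟨hcomp, hrect, hlen⟩ := hC
  have hsimple : IsSimpleCurve C := by
    rcases hcomp with h | h | h | h <;> exact h.1
  obtain ⟨g, hg⟩ := hsimple
  rw [Rectifiable, curveLength_eq hg] at hrect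
  rw [curveLength_eq hg] at hlen
  have key : EffCompact C ∧ EffOvert C := by
    rcases hcomp with h | ⟨-, f, hf, rfl⟩ | ⟨-, f, hf, -, rfl⟩ | ⟨-, -, f, hf, rfl, -⟩
    · exact h.effCompact_and_effOvert hg hrect
    all_goals exact ⟨effCompact_of_computablePath hf, effOvert_of_computablePath hf⟩
  exact ⟨key.1, key.2, g, hg, hrect, hlen.semidec_lt⟩

/-- A compact set is contained in each closed set that has the same finite rational covers. -/
theorem subset_of_covers {C D : Set Plane} (hD : IsCompact D)
    (h : ∀ x : List (RatCode × RatCode) × RatCode,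
      (∀ z ∈ D, ∃ w ∈ x.1, z ∈ nbhd x.2.val (pt w)) →
      ∀ z ∈ C, ∃ w ∈ x.1, z ∈ nbhd x.2.val (pt w)) : C ⊆ D := by
  intro z hz
  by_contra hzD
  obtain ⟨ε, hε, hball⟩ := Metric.isOpen_iff.1 hD.isClosed.isOpen_compl z hzD
  obtain ⟨r, hr0, hr⟩ := exists_ratCode_btwn (show 0 < ε / 4 by positivity)
  choose w hw using fun y : Plane => exists_pt_near y hr0
  obtain ⟨T, hTD, hT⟩ := hD.elim_nhds_subcover (fun y => nbhd r.val (pt (w y)))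
    (fun y _ => (isOpen_nbhd _ _).mem_nhds (mem_nbhd_of_dist_lt (hw y)))
  obtain ⟨c, hc, hzc⟩ := h (T.toList.map w, r) (fun y hy => by
    obtain ⟨u, hu, hyu⟩ := mem_iUnion₂.1 (hT hy)
    exact ⟨w u, List.mem_map.2 ⟨u, Finset.mem_toList.2 hu, rfl⟩, hyu⟩) z hz
  obtain ⟨u, hu, rfl⟩ := List.mem_map.1 hc
  have h1 := dist_lt_of_mem_nbhd hzc
  have h2 := hw u
  have h3 := dist_triangle_right u z (pt (w u))
  have h1 : dist z (pt (w u)) < 2 * r.val := h1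
  exact hball (show dist u z < ε by linarith) (hTD u (Finset.mem_toList.1 hu))

/-- A curve in `classC` is determined by the semidecidable set of its finite rational covers. -/
theorem countable_classC : classC.Countable := by
  refine MapsTo.countable_of_injOn
    (t := {p : List (RatCode × RatCode) × RatCode → Prop | Semidec p})
    (f := fun C x => ∀ z ∈ C, ∃ w ∈ x.1, z ∈ nbhd x.2.val (pt w)) ?_ ?_ (countable_semidec _)
  · intro C hC
    exact (exists_param_of_mem_classC hC).1
  · intro C hC D hD hCD
    obtain ⟨-, -, g, hg, -⟩ := exists_param_of_mem_classC hC
    obtain ⟨-, -, k, hk, -⟩ := exists_param_of_mem_classC hD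
    have hiff := fun x => iff_of_eq (congrFun hCD x)
    exact Subset.antisymm (subset_of_covers hk.isCompact fun x => (hiff x).2)
      (subset_of_covers hg.isCompact fun x => (hiff x).1)

/-! ### Zigzag curves -/

open Complex in
/-- The zigzag curve with slopes `a₀, a₁, …`: the segment from `0` to `1` is replaced with the two
segments from `0` to `(1 + a₀ i) / 2` to `1`, both of them are bent in the same way with slope
`a₁`, and so on.  The parametrization has constant speed. -/
noncomputable def zig : List ℝ → ℝ → ℂ
  | [], x => x
  | a :: l, x => if x ≤ 1 / 2 then (1 + a * I) / 2 * zig l (2 * x)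
      else (1 + a * I) / 2 + (1 - a * I) / 2 * zig l (2 * x - 1)

/-- The speed of the zigzag curve with given slopes. -/
noncomputable def speed (l : List ℝ) : ℝ := (l.map fun a => √(1 + a ^ 2)).prod

/-- A bound for the Lipschitz constant of the difference of a zigzag curve and a segment, plus
one. -/
noncomputable def growth (l : List ℝ) : ℝ := (l.map fun a => 1 + |a|).prod

@[simp] theorem speed_nil : speed [] = 1 := rfl

@[simp] theorem speed_cons (a : ℝ) (l : List ℝ) : speed (a :: l) = √(1 + a ^ 2) * speed l := by
  simp [speed]

@[simp] theorem growth_nil : growth [] = 1 := rfl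

@[simp] theorem growth_cons (a : ℝ) (l : List ℝ) : growth (a :: l) = (1 + |a|) * growth l := by
  simp [growth]

theorem speed_append (l k : List ℝ) : speed (l ++ k) = speed l * speed k := by
  simp [speed]

theorem growth_append (l k : List ℝ) : growth (l ++ k) = growth l * growth k := by
  simp [growth]

theorem one_le_speed (l : List ℝ) : 1 ≤ speed l := by
  induction l with
  | nil => simp
  | cons a l ih =>
    rw [speed_cons]
    exact one_le_mul_of_one_le_of_one_le (Real.one_le_sqrt.2 (by nlinarith [sq_nonneg a])) ih

theorem one_le_growth (l : List ℝ) : 1 ≤ growth l := by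
  induction l with
  | nil => simp
  | cons a l ih =>
    rw [growth_cons]
    exact one_le_mul_of_one_le_of_one_le (by linarith [abs_nonneg a]) ih

theorem speed_le_growth (l : List ℝ) : speed l ≤ growth l := by
  induction l with
  | nil => simp
  | cons a l ih =>
    rw [speed_cons, growth_cons]
    have h1 : √(1 + a ^ 2) ≤ 1 + |a| := by
      rw [Real.sqrt_le_left (by positivity)]
      nlinarith [sq_abs a, abs_nonneg a]
    have := one_le_speed l
    gcongr

open Complex in
theorem norm_one_add_mul_I (a : ℝ) : ‖(1 + a * I) / 2‖ = √(1 + a ^ 2) / 2 := by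
  have : (1 + a * I : ℂ) = (1 : ℝ) + a * I := by simp
  rw [norm_div, this, Complex.norm_add_mul_I]
  simp

open Complex in
theorem norm_one_sub_mul_I (a : ℝ) : ‖(1 - a * I) / 2‖ = √(1 + a ^ 2) / 2 := by
  have := norm_one_add_mul_I (-a)
  rw [neg_sq] at this
  rw [← this]
  congr 2
  push_cast
  ring

@[simp] theorem zig_zero (l : List ℝ) : zig l 0 = 0 := by
  induction l with
  | nil => simp [zig]
  | cons a l ih => simp [zig, ih]

@[simp] theorem zig_one (l : List ℝ) : zig l 1 = 1 := by
  induction l with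
  | nil => simp [zig]
  | cons a l ih =>
    have h : ¬ (1 : ℝ) ≤ 1 / 2 := by norm_num
    have h2 : (2 * 1 - 1 : ℝ) = 1 := by norm_num
    rw [zig, if_neg h, h2, ih]
    ring

open Complex in
theorem zig_left (a : ℝ) (l : List ℝ) {x : ℝ} (hx : x ≤ 1 / 2) :
    zig (a :: l) x = (1 + a * I) / 2 * zig l (2 * x) := by
  rw [zig, if_pos hx]

open Complex in
theorem zig_right (a : ℝ) (l : List ℝ) {x : ℝ} (hx : 1 / 2 ≤ x) :
    zig (a :: l) x = (1 + a * I) / 2 + (1 - a * I) / 2 * zig l (2 * x - 1) := by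
  rcases hx.lt_or_eq with h | rfl
  · rw [zig, if_neg (not_le.2 h)]
  · rw [zig, if_pos le_rfl]
    simp

/-- Lipschitz bounds on the two sides of a point can be glued. -/
theorem norm_sub_le_of_halves {E : Type*} [SeminormedAddCommGroup E] {F : ℝ → E} {c m : ℝ}
    (h₁ : ∀ x y, x ≤ m → y ≤ m → ‖F x - F y‖ ≤ c * |x - y|)
    (h₂ : ∀ x y, m ≤ x → m ≤ y → ‖F x - F y‖ ≤ c * |x - y|) (x y : ℝ) :
    ‖F x - F y‖ ≤ c * |x - y| := by
  have key : ∀ x y, x ≤ m → m ≤ y → ‖F x - F y‖ ≤ c * |x - y| := by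
    intro x y hx hy
    have h3 := h₁ x m hx le_rfl
    have h4 := h₂ m y le_rfl hy
    have h5 : |x - y| = |x - m| + |m - y| := by
      rw [abs_of_nonpos (by linarith), abs_of_nonpos (by linarith), abs_of_nonpos (by linarith)]
      ring
    rw [h5, mul_add]
    exact (norm_sub_le_norm_sub_add_norm_sub _ _ _).trans (add_le_add h3 h4)
  rcases le_total x m with hx | hx <;> rcases le_total y m with hy | hy
  · exact h₁ x y hx hy
  · exact key x y hx hy
  · rw [norm_sub_rev, abs_sub_comm]
    exact key y x hy hx
  · exact h₂ x y hx hy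

theorem norm_zig_sub_le (l : List ℝ) : ∀ x y, ‖zig l x - zig l y‖ ≤ speed l * |x - y| := by
  induction l with
  | nil =>
    intro x y
    rw [zig, zig, ← Complex.ofReal_sub, Complex.norm_real, speed_nil, one_mul, Real.norm_eq_abs]
  | cons a l ih =>
    refine norm_sub_le_of_halves (m := 1 / 2) (fun x y hx hy => ?_) fun x y hx hy => ?_
    · rw [zig_left a l hx, zig_left a l hy, ← mul_sub, norm_mul, norm_one_add_mul_I, speed_cons]
      have h1 := ih (2 * x) (2 * y)
      rw [← mul_sub, abs_mul, abs_two] at h1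
      calc √(1 + a ^ 2) / 2 * ‖zig l (2 * x) - zig l (2 * y)‖
          ≤ √(1 + a ^ 2) / 2 * (speed l * (2 * |x - y|)) := by gcongr
        _ = √(1 + a ^ 2) * speed l * |x - y| := by ring
    · rw [zig_right a l hx, zig_right a l hy, add_sub_add_left_eq_sub, ← mul_sub, norm_mul,
        norm_one_sub_mul_I, speed_cons]
      have h1 := ih (2 * x - 1) (2 * y - 1)
      rw [sub_sub_sub_cancel_right, ← mul_sub, abs_mul, abs_two] at h1
      calc √(1 + a ^ 2) / 2 * ‖zig l (2 * x - 1) - zig l (2 * y - 1)‖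
          ≤ √(1 + a ^ 2) / 2 * (speed l * (2 * |x - y|)) := by gcongr
        _ = √(1 + a ^ 2) * speed l * |x - y| := by ring

/-- The increments of a zigzag curve are close to those of a segment.  This makes the curve
injective if `growth l < 2`. -/
theorem norm_zig_sub_id_le (l : List ℝ) :
    ∀ x y, ‖(zig l x - x) - (zig l y - y)‖ ≤ (growth l - 1) * |x - y| := by
  induction l with
  | nil => intro x y; simp [zig]
  | cons a l ih =>
    have hsq : √(1 + a ^ 2) ≤ 1 + |a| := by
      rw [Real.sqrt_le_left (by positivity)]
      nlinarith [sq_abs a, abs_nonneg a]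
    have hg : 0 ≤ growth l - 1 := by linarith [one_le_growth l]
    have hI : ∀ t : ℝ, ‖(a * Complex.I : ℂ) * t‖ = |a| * |t| := fun t => by simp
    have hsum : ∀ t : ℝ, (√(1 + a ^ 2) / 2) * ((growth l - 1) * (2 * |t|)) + |a| * |t|
        ≤ (growth (a :: l) - 1) * |t| := by
      intro t
      rw [growth_cons]
      have : (√(1 + a ^ 2) / 2) * ((growth l - 1) * (2 * |t|))
          ≤ ((1 + |a|) / 2) * ((growth l - 1) * (2 * |t|)) := by gcongr
      linarith
    refine norm_sub_le_of_halves (F := fun x => zig (a :: l) x - x) (m := 1 / 2)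
      (fun x y hx hy => ?_) fun x y hx hy => ?_
    · have h1 := ih (2 * x) (2 * y)
      rw [← mul_sub, abs_mul, abs_two] at h1
      have e : (zig (a :: l) x - x) - (zig (a :: l) y - y) =
          (1 + a * Complex.I) / 2 * ((zig l (2 * x) - (2 * x : ℝ)) - (zig l (2 * y) - (2 * y : ℝ)))
          + (a * Complex.I) * ((x - y : ℝ) : ℂ) := by
        rw [zig_left a l hx, zig_left a l hy]
        push_cast
        ring
      rw [e]
      refine (norm_add_le _ _).trans (le_trans ?_ (hsum (x - y)))
      rw [norm_mul, norm_one_add_mul_I, hI]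
      gcongr
    · have h1 := ih (2 * x - 1) (2 * y - 1)
      rw [sub_sub_sub_cancel_right, ← mul_sub, abs_mul, abs_two] at h1
      have e : (zig (a :: l) x - x) - (zig (a :: l) y - y) =
          (1 - a * Complex.I) / 2 * ((zig l (2 * x - 1) - (2 * x - 1 : ℝ)) -
            (zig l (2 * y - 1) - (2 * y - 1 : ℝ)))
          + -((a * Complex.I) * ((x - y : ℝ) : ℂ)) := by
        rw [zig_right a l hx, zig_right a l hy]
        push_cast
        ring
      rw [e]
      refine (norm_add_le _ _).trans (le_trans ?_ (hsum (x - y)))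
      rw [norm_mul, norm_one_sub_mul_I, norm_neg, hI]
      gcongr

theorem norm_zig_sub_self_le (l : List ℝ) {x : ℝ} (hx : x ∈ Icc (0 : ℝ) 1) :
    ‖zig l x - x‖ ≤ growth l - 1 := by
  have h1 := norm_zig_sub_id_le l x 0
  have h2 := one_le_growth l
  rw [zig_zero, sub_zero, Complex.ofReal_zero, sub_zero, sub_zero, abs_of_nonneg hx.1] at h1
  nlinarith [hx.2]

/-- Bending a zigzag curve further moves its points only by the length of its segments. -/
theorem norm_zig_append_sub_le (p l : List ℝ) :
    ∀ x ∈ Icc (0 : ℝ) 1, ‖zig (p ++ l) x - zig p x‖ ≤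
      speed p * (1 / 2) ^ p.length * (growth l - 1) := by
  induction p with
  | nil =>
    intro x hx
    simpa [zig] using norm_zig_sub_self_le l hx
  | cons a p ih =>
    intro x hx
    have hr : ∀ c : ℝ, √(1 + a ^ 2) / 2 * c = √(1 + a ^ 2) * (1 / 2) * c := fun c => by ring
    have e : speed (a :: p) * (1 / 2) ^ (a :: p).length * (growth l - 1) =
        √(1 + a ^ 2) / 2 * (speed p * (1 / 2) ^ p.length * (growth l - 1)) := by
      rw [speed_cons, List.length_cons, pow_succ]
      ring
    rw [e, List.cons_append]
    rcases le_total x (1 / 2) with h | h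
    · rw [zig_left a _ h, zig_left a _ h, ← mul_sub, norm_mul, norm_one_add_mul_I]
      gcongr
      exact ih _ ⟨by linarith [hx.1], by linarith⟩
    · rw [zig_right a _ h, zig_right a _ h, add_sub_add_left_eq_sub, ← mul_sub, norm_mul,
        norm_one_sub_mul_I]
      gcongr
      exact ih _ ⟨by linarith, by linarith [hx.2]⟩

/-- Bending a zigzag curve further does not move its corners. -/
theorem zig_append_dyadic (p l : List ℝ) : ∀ j : ℕ, j ≤ 2 ^ p.length →
    zig (p ++ l) (j / 2 ^ p.length) = zig p (j / 2 ^ p.length) := by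
  induction p with
  | nil =>
    intro j hj
    have : j = 0 ∨ j = 1 := by simp at hj; omega
    rcases this with rfl | rfl <;> simp
  | cons a p ih =>
    intro j hj
    rw [List.length_cons, List.cons_append]
    rw [List.length_cons, pow_succ] at hj
    have h2 : (0 : ℝ) < 2 ^ p.length := by positivity
    rcases le_total j (2 ^ p.length) with h | h
    · have hx : (j : ℝ) / 2 ^ (p.length + 1) ≤ 1 / 2 := by
        rw [pow_succ, div_le_div_iff₀ (by positivity) (by norm_num)]
        have : (j : ℝ) ≤ 2 ^ p.length := by exact_mod_cast h
        linarith
      have e : 2 * ((j : ℝ) / 2 ^ (p.length + 1)) = j / 2 ^ p.length := by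
        rw [pow_succ]; field_simp
      rw [zig_left a _ hx, zig_left a _ hx, e, ih j h]
    · have hx : 1 / 2 ≤ (j : ℝ) / 2 ^ (p.length + 1) := by
        rw [pow_succ, div_le_div_iff₀ (by norm_num) (by positivity)]
        have : (2 : ℝ) ^ p.length ≤ j := by exact_mod_cast h
        linarith
      have e : 2 * ((j : ℝ) / 2 ^ (p.length + 1)) - 1 = ((j - 2 ^ p.length : ℕ) : ℝ) /
          2 ^ p.length := by
        rw [Nat.cast_sub h, pow_succ]; push_cast; field_simp
      rw [zig_right a _ hx, zig_right a _ hx, e, ih _ (by omega)]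

/-- Consecutive corners of a zigzag curve are equally far apart. -/
theorem norm_zig_step (p : List ℝ) : ∀ j : ℕ, j < 2 ^ p.length →
    ‖zig p (((j + 1 : ℕ) : ℝ) / 2 ^ p.length) - zig p (j / 2 ^ p.length)‖ =
      speed p / 2 ^ p.length := by
  induction p with
  | nil =>
    intro j hj
    have : j = 0 := by simpa using hj
    subst this
    simp
  | cons a p ih =>
    intro j hj
    rw [List.length_cons] at hj ⊢
    have h2 : (0 : ℝ) < 2 ^ p.length := by positivity
    have e0 : ∀ i : ℕ, 2 * ((i : ℝ) / 2 ^ (p.length + 1)) = i / 2 ^ p.length := fun i => by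
      rw [pow_succ]; field_simp
    have e1 : ∀ i : ℕ, 2 ^ p.length ≤ i → 2 * ((i : ℝ) / 2 ^ (p.length + 1)) - 1 =
        ((i - 2 ^ p.length : ℕ) : ℝ) / 2 ^ p.length := fun i hi => by
      rw [Nat.cast_sub hi, pow_succ]; push_cast; field_simp
    have e2 : speed (a :: p) / 2 ^ (p.length + 1) =
        √(1 + a ^ 2) / 2 * (speed p / 2 ^ p.length) := by
      rw [speed_cons, pow_succ 2 p.length]; field_simp
    have l0 : ∀ i : ℕ, i ≤ 2 ^ p.length → (i : ℝ) / 2 ^ (p.length + 1) ≤ 1 / 2 := fun i hi => by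
      rw [pow_succ, div_le_div_iff₀ (by positivity) (by norm_num)]
      have : (i : ℝ) ≤ 2 ^ p.length := by exact_mod_cast hi
      linarith
    have l1 : ∀ i : ℕ, 2 ^ p.length ≤ i → 1 / 2 ≤ (i : ℝ) / 2 ^ (p.length + 1) := fun i hi => by
      rw [pow_succ, div_le_div_iff₀ (by norm_num) (by positivity)]
      have : (2 : ℝ) ^ p.length ≤ i := by exact_mod_cast hi
      linarith
    rw [e2]
    rw [pow_succ] at hj
    rcases Nat.lt_or_ge j (2 ^ p.length) with h | h
    · rw [zig_left a _ (l0 _ h), zig_left a _ (l0 _ h.le), ← mul_sub, norm_mul,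
        norm_one_add_mul_I, e0, e0, ih j h]
    · rw [zig_right a _ (l1 _ (h.trans (Nat.le_succ _))), zig_right a _ (l1 _ h),
        add_sub_add_left_eq_sub, ← mul_sub, norm_mul,
        norm_one_sub_mul_I, e1 _ h, e1 _ (h.trans (Nat.le_succ _)),
        ← ih (j - 2 ^ p.length) (by omega)]
      rw [show j + 1 - 2 ^ p.length = j - 2 ^ p.length + 1 by omega]

/-! ### The limit of zigzag curves -/

/-- The first `n` terms of a sequence of slopes. -/
noncomputable def slopes (a : ℕ → ℝ) (n : ℕ) : List ℝ := (List.range n).map a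

@[simp] theorem length_slopes (a : ℕ → ℝ) (n : ℕ) : (slopes a n).length = n := by simp [slopes]

theorem slopes_succ (a : ℕ → ℝ) (n : ℕ) : slopes a (n + 1) = slopes a n ++ [a n] := by
  simp [slopes, List.range_succ]

theorem exists_slopes_append (a : ℕ → ℝ) {m n : ℕ} (h : m ≤ n) :
    ∃ l, slopes a n = slopes a m ++ l := by
  obtain ⟨k, rfl⟩ := Nat.exists_eq_add_of_le h
  exact ⟨((List.range k).map (m + ·)).map a, by simp [slopes, List.range_add]⟩

/-- The infinitely often bent curve.  On the unit interval the limit exists if the values of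
`growth` are at most `2`. -/
noncomputable def zigLim (a : ℕ → ℝ) (x : ℝ) : ℂ := limUnder atTop fun n => zig (slopes a n) x

/-- The speed of the infinitely often bent curve, if the values of `growth` are bounded. -/
noncomputable def speedLim (a : ℕ → ℝ) : ℝ := ⨆ n, speed (slopes a n)

section Limit

variable {a : ℕ → ℝ} {Γ : ℝ}

theorem speed_slopes_mono : Monotone fun n => speed (slopes a n) := by
  intro m n h
  obtain ⟨l, hl⟩ := exists_slopes_append a h
  beta_reduce
  rw [hl, speed_append]
  exact le_mul_of_one_le_right (zero_le_one.trans (one_le_speed _)) (one_le_speed _)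

theorem speed_slopes_tendsto (hΓ : ∀ n, growth (slopes a n) ≤ Γ) :
    Tendsto (fun n => speed (slopes a n)) atTop (𝓝 (speedLim a)) :=
  tendsto_atTop_ciSup speed_slopes_mono
    ⟨Γ, by rintro _ ⟨n, rfl⟩; exact (speed_le_growth _).trans (hΓ n)⟩

theorem speed_le_speedLim (hΓ : ∀ n, growth (slopes a n) ≤ Γ) (n : ℕ) :
    speed (slopes a n) ≤ speedLim a :=
  speed_slopes_mono.ge_of_tendsto (speed_slopes_tendsto hΓ) n

theorem norm_zig_slopes_sub_le (hΓ : ∀ n, growth (slopes a n) ≤ Γ) (hΓ2 : Γ ≤ 2) {m n : ℕ}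
    (h : m ≤ n) {x : ℝ} (hx : x ∈ Icc (0 : ℝ) 1) :
    ‖zig (slopes a n) x - zig (slopes a m) x‖ ≤ 2 * (1 / 2) ^ m := by
  obtain ⟨l, hl⟩ := exists_slopes_append a h
  have h1 := norm_zig_append_sub_le (slopes a m) l x hx
  rw [← hl, length_slopes] at h1
  have h2 : speed (slopes a m) ≤ 2 := (speed_le_growth _).trans ((hΓ m).trans hΓ2)
  have h3 : growth l ≤ 2 := by
    have := hΓ n
    rw [hl, growth_append] at this
    nlinarith [one_le_growth (slopes a m), one_le_growth l]
  have h4 := one_le_growth l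
  have h5 := one_le_speed (slopes a m)
  calc _ ≤ speed (slopes a m) * (1 / 2) ^ m * (growth l - 1) := h1
    _ ≤ 2 * (1 / 2) ^ m * 1 := by
      gcongr
      linarith
    _ = _ := mul_one _

theorem zig_tendsto (hΓ : ∀ n, growth (slopes a n) ≤ Γ) (hΓ2 : Γ ≤ 2) {x : ℝ}
    (hx : x ∈ Icc (0 : ℝ) 1) :
    Tendsto (fun n => zig (slopes a n) x) atTop (𝓝 (zigLim a x)) := by
  refine CauchySeq.tendsto_limUnder ?_
  refine cauchySeq_of_le_geometric_two (C := 4) fun n => ?_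
  rw [dist_comm, dist_eq_norm]
  refine (norm_zig_slopes_sub_le hΓ hΓ2 n.le_succ hx).trans_eq ?_
  rw [one_div, inv_pow]
  ring

theorem norm_zigLim_sub_zig_le (hΓ : ∀ n, growth (slopes a n) ≤ Γ) (hΓ2 : Γ ≤ 2) {x : ℝ}
    (hx : x ∈ Icc (0 : ℝ) 1) (m : ℕ) :
    ‖zigLim a x - zig (slopes a m) x‖ ≤ 2 * (1 / 2) ^ m :=
  le_of_tendsto ((zig_tendsto hΓ hΓ2 hx).sub_const _).norm
    (by filter_upwards [eventually_ge_atTop m] with n hn using norm_zig_slopes_sub_le hΓ hΓ2 hn hx)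

theorem norm_zigLim_sub_le (hΓ : ∀ n, growth (slopes a n) ≤ Γ) (hΓ2 : Γ ≤ 2) {x y : ℝ}
    (hx : x ∈ Icc (0 : ℝ) 1) (hy : y ∈ Icc (0 : ℝ) 1) :
    ‖zigLim a x - zigLim a y‖ ≤ speedLim a * |x - y| :=
  le_of_tendsto ((zig_tendsto hΓ hΓ2 hx).sub (zig_tendsto hΓ hΓ2 hy)).norm
    (Eventually.of_forall fun n => (norm_zig_sub_le _ x y).trans
      (mul_le_mul_of_nonneg_right (speed_le_speedLim hΓ n) (abs_nonneg _)))

theorem zigLim_injOn (hΓ : ∀ n, growth (slopes a n) ≤ Γ) (hΓ2 : Γ < 2) :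
    InjOn (zigLim a) (Icc 0 1) := by
  intro x hx y hy hxy
  have h1 : ‖(zigLim a x - x) - (zigLim a y - y)‖ ≤ (Γ - 1) * |x - y| :=
    le_of_tendsto (((zig_tendsto hΓ hΓ2.le hx).sub_const _).sub
      ((zig_tendsto hΓ hΓ2.le hy).sub_const _)).norm
      (Eventually.of_forall fun n => (norm_zig_sub_id_le _ x y).trans
        (mul_le_mul_of_nonneg_right (by linarith [hΓ n]) (abs_nonneg _)))
  rw [hxy, sub_sub_sub_cancel_left, ← Complex.ofReal_sub, Complex.norm_real, Real.norm_eq_abs,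
    abs_sub_comm] at h1
  have h2 : |x - y| = 0 := by nlinarith [abs_nonneg (x - y)]
  exact sub_eq_zero.1 (abs_eq_zero.1 h2)

theorem zigLim_dyadic (hΓ : ∀ n, growth (slopes a n) ≤ Γ) (hΓ2 : Γ ≤ 2) {m j : ℕ}
    (hj : j ≤ 2 ^ m) : zigLim a (j / 2 ^ m) = zig (slopes a m) (j / 2 ^ m) := by
  have hx : (j : ℝ) / 2 ^ m ∈ Icc (0 : ℝ) 1 :=
    ⟨by positivity, by rw [div_le_one (by positivity)]; exact_mod_cast hj⟩
  refine tendsto_nhds_unique (zig_tendsto hΓ hΓ2 hx) ?_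
  refine tendsto_const_nhds.congr' ?_
  filter_upwards [eventually_ge_atTop m] with n hn
  obtain ⟨l, hl⟩ := exists_slopes_append a hn
  have := zig_append_dyadic (slopes a m) l j
  rw [length_slopes] at this
  rw [hl, this hj]

end Limit

/-- The identification of the complex numbers with the plane. -/
noncomputable def toPlane : ℂ ≃ₗᵢ[ℝ] Plane := Complex.orthonormalBasisOneI.repr

@[simp] theorem toPlane_zero (z : ℂ) : toPlane z 0 = z.re := by
  simp [toPlane]

@[simp] theorem toPlane_one (z : ℂ) : toPlane z 1 = z.im := by
  simp [toPlane]

/-- The infinitely often bent curve, in the plane. -/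
noncomputable def zigPath (a : ℕ → ℝ) (x : ℝ) : Plane := toPlane (zigLim a x)

section Path

variable {a : ℕ → ℝ} {Γ : ℝ}

theorem dist_zigPath (x y : ℝ) : dist (zigPath a x) (zigPath a y) = ‖zigLim a x - zigLim a y‖ := by
  rw [zigPath, zigPath, LinearIsometryEquiv.dist_map, dist_eq_norm]

theorem speedLim_pos (hΓ : ∀ n, growth (slopes a n) ≤ Γ) : 0 < speedLim a :=
  zero_lt_one.trans_le ((one_le_speed _).trans (speed_le_speedLim hΓ 0))

theorem zigPath_lipschitz (hΓ : ∀ n, growth (slopes a n) ≤ Γ) (hΓ2 : Γ ≤ 2) :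
    LipschitzOnWith (speedLim a).toNNReal (zigPath a) (Icc 0 1) := by
  refine LipschitzOnWith.of_dist_le_mul fun x hx y hy => ?_
  rw [dist_zigPath, Real.coe_toNNReal _ (speedLim_pos hΓ).le, Real.dist_eq]
  exact norm_zigLim_sub_le hΓ hΓ2 hx hy

theorem variation_zigPath_le (hΓ : ∀ n, growth (slopes a n) ≤ Γ) (hΓ2 : Γ ≤ 2) {s t : ℝ}
    (hs : 0 ≤ s) (ht : t ≤ 1) :
    eVariationOn (zigPath a) (Icc s t) ≤ ENNReal.ofReal (speedLim a * (t - s)) := by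
  have h1 := ((zigPath_lipschitz hΓ hΓ2).mono (Icc_subset_Icc hs ht)).comp_eVariationOn_le
    (f := zigPath a) (g := (id : ℝ → ℝ)) (s := Icc s t) (mapsTo_id _)
  rw [Function.comp_id, eVariationOn_id_Icc] at h1
  rwa [ENNReal.ofReal_mul (speedLim_pos hΓ).le]

theorem le_variation_zigPath (hΓ : ∀ n, growth (slopes a n) ≤ Γ) (hΓ2 : Γ ≤ 2) :
    ENNReal.ofReal (speedLim a) ≤ eVariationOn (zigPath a) (Icc 0 1) := by
  refine le_of_tendsto ((ENNReal.continuous_ofReal.tendsto _).comp (speed_slopes_tendsto hΓ))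
    (Eventually.of_forall fun m => ?_)
  have h2 : (0 : ℝ) < 2 ^ m := by positivity
  have h1 := eVariationOn.sum_le_of_monotoneOn_Iic (f := zigPath a) (s := Icc 0 1) (n := 2 ^ m)
    (u := fun j => (j : ℝ) / 2 ^ m) (fun i _ j _ hij => by
      beta_reduce
      gcongr) (fun i hi => ⟨by positivity, by
        rw [div_le_one h2]; exact_mod_cast hi⟩)
  refine le_trans (le_of_eq ?_) h1
  have h3 : ∀ j ∈ Finset.range (2 ^ m), edist (zigPath a (((j + 1 : ℕ) : ℝ) / 2 ^ m))
      (zigPath a ((j : ℝ) / 2 ^ m)) = ENNReal.ofReal (speed (slopes a m) / 2 ^ m) := by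
    intro j hj
    rw [Finset.mem_range] at hj
    rw [edist_dist, dist_zigPath, zigLim_dyadic hΓ hΓ2 hj.le, zigLim_dyadic hΓ hΓ2 hj]
    have := norm_zig_step (slopes a m) j
    rw [length_slopes] at this
    rw [this hj]
  rw [Finset.sum_congr rfl h3, Finset.sum_const, Finset.card_range, nsmul_eq_mul, Function.comp,
    ← ENNReal.ofReal_natCast, ← ENNReal.ofReal_mul (by positivity)]
  congr 1
  push_cast
  field_simp

/-- The curve has constant speed: the pieces have at most the expected lengths, and the lengths
add up to that of the whole curve. -/
theorem variation_zigPath (hΓ : ∀ n, growth (slopes a n) ≤ Γ) (hΓ2 : Γ ≤ 2) {s t : ℝ}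
    (hs : 0 ≤ s) (hst : s ≤ t) (ht : t ≤ 1) :
    eVariationOn (zigPath a) (Icc s t) = ENNReal.ofReal (speedLim a * (t - s)) := by
  have hL := (speedLim_pos hΓ).le
  refine le_antisymm (variation_zigPath_le hΓ hΓ2 hs ht) ?_
  have h1 := eVariationOn.Icc_add_Icc (zigPath a) (s := univ) hs hst (mem_univ _)
  have h2 := eVariationOn.Icc_add_Icc (zigPath a) (s := univ) (hs.trans hst) ht (mem_univ _)
  simp only [univ_inter] at h1 h2
  have h3 := variation_zigPath_le hΓ hΓ2 le_rfl (hst.trans ht)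
  have h4 := variation_zigPath_le hΓ hΓ2 (hs.trans hst) le_rfl
  have h5 := le_variation_zigPath hΓ hΓ2
  have h6 : ENNReal.ofReal (speedLim a * (s - 0)) + ENNReal.ofReal (speedLim a * (1 - t)) +
      ENNReal.ofReal (speedLim a * (t - s)) ≤
      ENNReal.ofReal (speedLim a * (s - 0)) + ENNReal.ofReal (speedLim a * (1 - t)) +
      eVariationOn (zigPath a) (Icc s t) := by
    have hs' : 0 ≤ speedLim a * (s - 0) := mul_nonneg hL (by linarith)
    have ht' : 0 ≤ speedLim a * (1 - t) := mul_nonneg hL (by linarith)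
    rw [← ENNReal.ofReal_add hs' ht', ← ENNReal.ofReal_add (add_nonneg hs' ht')
      (mul_nonneg hL (by linarith)), ENNReal.ofReal_add hs' ht',
      show speedLim a * (s - 0) + speedLim a * (1 - t) + speedLim a * (t - s) = speedLim a by ring]
    rw [← h2, ← h1] at h5
    refine h5.trans ?_
    rw [add_right_comm]
    gcongr
  exact (ENNReal.add_le_add_iff_left (by finiteness)).1 h6

theorem isInjParam_zigPath (hΓ : ∀ n, growth (slopes a n) ≤ Γ) (hΓ2 : Γ < 2) {t : ℝ}
    (ht : t ∈ Ioc (0 : ℝ) 1) :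
    IsInjParam (fun u => zigPath a (t * u)) (zigPath a '' Icc 0 t) := by
  have himg : (fun u => t * u) '' Icc 0 1 = Icc 0 t := by
    rw [image_mul_left_Icc ht.1.le zero_le_one, mul_zero, mul_one]
  have hmaps : MapsTo (fun u => t * u) (Icc 0 1) (Icc 0 1) := fun u hu =>
    ⟨mul_nonneg ht.1.le hu.1, mul_le_one₀ ht.2 hu.1 hu.2⟩
  refine ⟨?_, ?_, ?_⟩
  · exact (zigPath_lipschitz hΓ hΓ2.le).continuousOn.comp (by fun_prop) hmaps
  · intro u hu v hv huv
    have := zigLim_injOn hΓ hΓ2 (hmaps hu) (hmaps hv) (toPlane.injective huv)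
    exact mul_left_cancel₀ ht.1.ne' this
  · rw [← himg, image_image]

theorem curveLength_zigPath (hΓ : ∀ n, growth (slopes a n) ≤ Γ) (hΓ2 : Γ < 2) {t : ℝ}
    (ht : t ∈ Ioc (0 : ℝ) 1) :
    curveLength (zigPath a '' Icc 0 t) = ENNReal.ofReal (speedLim a * t) := by
  rw [curveLength_eq (isInjParam_zigPath hΓ hΓ2 ht)]
  have himg : (fun u => t * u) '' Icc 0 1 = Icc 0 t := by
    rw [image_mul_left_Icc ht.1.le zero_le_one, mul_zero, mul_one]
  have := eVariationOn.comp_eq_of_monotoneOn (zigPath a) (fun u => t * u) (t := Icc 0 1)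
    (fun u _ v _ huv => mul_le_mul_of_nonneg_left huv ht.1.le)
  rw [himg, variation_zigPath hΓ hΓ2.le le_rfl ht.1.le ht.2, sub_zero] at this
  exact this

theorem nComputable_zigPath (hΓ : ∀ n, growth (slopes a n) ≤ Γ) (hΓ2 : Γ < 2)
    (hcomp : ComputablePath (zigPath a)) : NComputable (zigPath a '' Icc 0 1) := by
  have h1 : (1 : ℝ) ∈ Ioc (0 : ℝ) 1 := by simp
  refine ⟨⟨_, isInjParam_zigPath hΓ hΓ2 h1⟩, ?_, _, hcomp, rfl, fun t ht => ?_⟩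
  · rw [Rectifiable, curveLength_zigPath hΓ hΓ2 h1]
    exact ENNReal.ofReal_ne_top
  · rw [curveLength_zigPath hΓ hΓ2 h1, curveLength_zigPath hΓ hΓ2 ht,
      ← ENNReal.ofReal_mul ht.1.le]
    congr 1
    ring

end Path

/-! ### Computing zigzag curves -/

/-- States of the evaluation of a zigzag curve: two complex numbers and a real number, all of them
rational. -/
abbrev ZigState : Type := (RatCode × RatCode) × (RatCode × RatCode) × RatCode

/-- The complex number with given rational real and imaginary part. -/
noncomputable def cval (w : RatCode × RatCode) : ℂ := ⟨w.1.val, w.2.val⟩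

/-- One step of the evaluation by a primitive recursive function: the point that is to be computed
is `z + m * zig l x` in the state `(z, m, x)`. -/
theorem exists_zigStep : ∃ S : ZigState → RatCode → ZigState, Primrec₂ S ∧ ∀ s q l,
    cval (S s q).1 + cval (S s q).2.1 * zig l (S s q).2.2.val =
      cval s.1 + cval s.2.1 * zig (q.val :: l) s.2.2.val := by
  have h1 : Primrec fun p : ZigState × RatCode => p.1 := Primrec.fst
  have hzr := primrecRat_val (Primrec.fst.comp (Primrec.fst.comp h1))
  have hzi := primrecRat_val (Primrec.snd.comp (Primrec.fst.comp h1))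
  have hmr := primrecRat_val (Primrec.fst.comp (Primrec.fst.comp (Primrec.snd.comp h1)))
  have hmi := primrecRat_val (Primrec.snd.comp (Primrec.fst.comp (Primrec.snd.comp h1)))
  have hx := primrecRat_val (Primrec.snd.comp (Primrec.snd.comp h1))
  have ha := primrecRat_val ((Primrec.snd) : Primrec fun p : ZigState × RatCode => p.2)
  have half : PrimrecRat fun _ : ZigState × RatCode => (1 / 2 : ℝ) ^ 1 :=
    PrimrecRat.half_pow (Primrec.const 1)
  have hc := hx.le half
  classical
  have two := PrimrecRat.ofNat (α := ZigState × RatCode) 2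
  have pr := (hmr.sub (ha.mul hmi)).mul half
  have pi := (hmi.add (ha.mul hmr)).mul half
  have nr := (hmr.add (ha.mul hmi)).mul half
  have ni := (hmi.sub (ha.mul hmr)).mul half
  obtain ⟨f₁, p₁, e₁⟩ := PrimrecRat.ite hc hzr (hzr.add pr)
  obtain ⟨f₂, p₂, e₂⟩ := PrimrecRat.ite hc hzi (hzi.add pi)
  obtain ⟨f₃, p₃, e₃⟩ := PrimrecRat.ite hc pr nr
  obtain ⟨f₄, p₄, e₄⟩ := PrimrecRat.ite hc pi ni
  obtain ⟨f₅, p₅, e₅⟩ := PrimrecRat.ite hc (two.mul hx) ((two.mul hx).sub PrimrecRat.one)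
  refine ⟨fun s q => ((f₁ (s, q), f₂ (s, q)), (f₃ (s, q), f₄ (s, q)), f₅ (s, q)),
    (p₁.pair p₂).pair ((p₃.pair p₄).pair p₅), ?_⟩
  rintro ⟨z, m, x⟩ q l
  dsimp only
  rw [cval, cval, ← e₁, ← e₂, ← e₃, ← e₄, ← e₅]
  dsimp only
  by_cases h : x.val ≤ (1 / 2 : ℝ) ^ 1
  · simp only [if_pos h]
    rw [zig_left q.val l (by simpa using h)]
    apply Complex.ext <;> simp [cval] <;> ring
  · simp only [if_neg h]
    rw [zig_right q.val l (by simp at h; linarith)]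
    apply Complex.ext <;> simp [cval] <;> ring

/-- Zigzag curves with rational slopes can be evaluated at rational points. -/
theorem exists_zigEval : ∃ Z : List RatCode → RatCode → RatCode × RatCode, Primrec₂ Z ∧
    ∀ l x, cval (Z l x) = zig (l.map RatCode.val) x.val := by
  obtain ⟨S, hS, hSval⟩ := exists_zigStep
  have hfold : ∀ (l : List RatCode) (s : ZigState),
      cval (l.foldl S s).1 + cval (l.foldl S s).2.1 * (l.foldl S s).2.2.val =
        cval s.1 + cval s.2.1 * zig (l.map RatCode.val) s.2.2.val := by
    intro l
    induction l with
    | nil => intro s; simp [zig]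
    | cons q l ih =>
      intro s
      rw [List.foldl_cons, ih, hSval, List.map_cons]
  have pS : Primrec fun p : List RatCode × RatCode =>
      p.1.foldl S (((0, 0), (0, 0)), ((1, 0), (0, 0)), p.2) :=
    Primrec.list_foldl Primrec.fst
      ((Primrec.const _).pair ((Primrec.const _).pair Primrec.snd))
      ((hS.comp (Primrec.fst.comp Primrec.snd) (Primrec.snd.comp Primrec.snd)).to₂)
  have hzr := primrecRat_val (Primrec.fst.comp (Primrec.fst.comp pS))
  have hzi := primrecRat_val (Primrec.snd.comp (Primrec.fst.comp pS))
  have hmr := primrecRat_val (Primrec.fst.comp (Primrec.fst.comp (Primrec.snd.comp pS)))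
  have hmi := primrecRat_val (Primrec.snd.comp (Primrec.fst.comp (Primrec.snd.comp pS)))
  have hx := primrecRat_val (Primrec.snd.comp (Primrec.snd.comp pS))
  obtain ⟨f₁, p₁, e₁⟩ := hzr.add (hmr.mul hx)
  obtain ⟨f₂, p₂, e₂⟩ := hzi.add (hmi.mul hx)
  refine ⟨fun l x => (f₁ (l, x), f₂ (l, x)), p₁.pair p₂, fun l x => ?_⟩
  have h := hfold l (((0, 0), (0, 0)), ((1, 0), (0, 0)), x)
  have h0 : cval ((0, 0), (0, 0)) = 0 := by apply Complex.ext <;> simp [cval, RatCode.val]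
  have h1 : cval ((1, 0), (0, 0)) = 1 := by apply Complex.ext <;> simp [cval, RatCode.val]
  rw [h0, h1, zero_add, one_mul] at h
  rw [← h]
  apply Complex.ext
  · have := e₁ (l, x)
    simp only [cval] at this ⊢
    simp [← this]
  · have := e₂ (l, x)
    simp only [cval] at this ⊢
    simp [← this]

/-- To compute a term of a name of a function value, it is enough to read one term of a name of
the argument and to evaluate there a function that can be evaluated exactly. -/
theorem computableOnUnit_of_approx {f : ℝ → ℝ} {A : ℕ → RatCode → RatCode} (hA : Primrec₂ A)
    (c : ℕ) (h : ∀ x ∈ Icc (0 : ℝ) 1, ∀ n q, |RatCode.val q - x| ≤ 2 * (1 / 2 : ℝ) ^ (n + c) →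
      |(A n q).val - f x| ≤ (1 / 2 : ℝ) ^ (n + 1)) : ComputableOnUnit f := by
  refine ⟨fun σ n => (σ[n + c]?).map (A n), ?_, fun x hx a ha => ?_⟩
  · have h1 : Primrec fun p : List RatCode × ℕ => (p.1[p.2 + c]?).map (A p.2) :=
      Primrec.option_map (Primrec.list_getElem?.comp Primrec.fst
        (Primrec.nat_add.comp Primrec.snd (Primrec.const c)))
        (hA.comp (Primrec.snd.comp Primrec.fst) Primrec.snd).to₂
    exact h1.to_comp
  · have hM : ∀ k n, ((initialPart a k)[n + c]?).map (A n) =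
        if n + c < k then some (A n (a (n + c))) else none := by
      intro k n
      split_ifs with hk <;> simp [initialPart, hk]
    refine ⟨fun n => A n (a (n + c)),
      isName_of_abs_sub_le fun n => h x hx n _ (ha.abs_sub_le _), fun n => ⟨⟨n + c + 1, ?_⟩, ?_⟩⟩
    · beta_reduce
      rw [hM, if_pos (Nat.lt_succ_self _)]
    · intro k q hq
      beta_reduce at hq
      rw [hM] at hq
      split_ifs at hq
      exact (Option.some_inj.1 hq).symm

/-- A machine evaluates a zigzag curve with finitely many slopes at a rational approximation of
the argument. -/
theorem computablePath_zigPath {a : ℕ → ℝ} {Γ : ℝ} (ha : PrimrecRat a)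
    (hΓ : ∀ n, growth (slopes a n) ≤ Γ) (hΓ2 : Γ ≤ 2) : ComputablePath (zigPath a) := by
  obtain ⟨α, hα, haα⟩ := ha
  obtain ⟨Z, hZ, hZval⟩ := exists_zigEval
  have hlist : Primrec fun n : ℕ => (List.range n).map α :=
    Primrec.list_map Primrec.list_range (hα.comp Primrec.snd).to₂
  have hmap : ∀ n, ((List.range n).map α).map RatCode.val = slopes a n := by
    intro n
    rw [List.map_map, slopes]
    exact List.map_congr_left fun k _ => (haα k).symm
  have hW : Primrec₂ fun (n : ℕ) (q : RatCode) => Z ((List.range (n + 4)).map α) q :=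
    hZ.comp (hlist.comp (Primrec.nat_add.comp Primrec.fst (Primrec.const 4))) Primrec.snd
  have hdist : ∀ x ∈ Icc (0 : ℝ) 1, ∀ n q, |RatCode.val q - x| ≤ 2 * (1 / 2 : ℝ) ^ (n + 4) →
      ‖cval (Z ((List.range (n + 4)).map α) q) - zigLim a x‖ ≤ (1 / 2 : ℝ) ^ (n + 1) := by
    intro x hx n q hq
    rw [hZval, hmap]
    have h1 := norm_zig_sub_le (slopes a (n + 4)) q.val x
    have h2 := norm_zigLim_sub_zig_le hΓ hΓ2 hx (n + 4)
    have h3 : speed (slopes a (n + 4)) ≤ 2 := (speed_le_growth _).trans ((hΓ _).trans hΓ2)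
    -- The errors of the argument and of the approximating curve are at most `4 / 16` and `2 / 16`
    -- of `(1 / 2) ^ n`.
    have h4 : speed (slopes a (n + 4)) * |q.val - x| ≤ 2 * (2 * (1 / 2 : ℝ) ^ (n + 4)) := by
      gcongr
    rw [norm_sub_rev] at h2
    have h5 := norm_sub_le_norm_sub_add_norm_sub (zig (slopes a (n + 4)) q.val)
      (zig (slopes a (n + 4)) x) (zigLim a x)
    have h6 : (1 / 2 : ℝ) ^ (n + 4) = (1 / 2) ^ n / 16 := by ring
    have h7 : (1 / 2 : ℝ) ^ (n + 1) = (1 / 2) ^ n / 2 := by ring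
    have h8 : 0 < (1 / 2 : ℝ) ^ n := by positivity
    rw [h6] at h2 h4
    rw [h7]
    linarith
  intro i
  fin_cases i
  · refine computableOnUnit_of_approx (Primrec.fst.comp₂ hW) 4 fun x hx n q hq => ?_
    refine le_trans ?_ (hdist x hx n q hq)
    have := Complex.abs_re_le_norm (cval (Z ((List.range (n + 4)).map α) q) - zigLim a x)
    simpa [zigPath, cval] using this
  · refine computableOnUnit_of_approx (Primrec.snd.comp₂ hW) 4 fun x hx n q hq => ?_
    refine le_trans ?_ (hdist x hx n q hq)
    have := Complex.abs_im_le_norm (cval (Z ((List.range (n + 4)).map α) q) - zigLim a x)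
    simpa [zigPath, cval] using this

/-- The corners of the zigzag curves have rational coordinates. -/
theorem exists_zigPath_eq_pt {a : ℕ → ℝ} {Γ : ℝ} (ha : PrimrecRat a)
    (hΓ : ∀ n, growth (slopes a n) ≤ Γ) (hΓ2 : Γ ≤ 2) {m j : ℕ} (hj : j ≤ 2 ^ m) :
    ∃ w, zigPath a (j / 2 ^ m) = pt w := by
  obtain ⟨α, -, haα⟩ := ha
  obtain ⟨Z, -, hZval⟩ := exists_zigEval
  have hmap : ((List.range m).map α).map RatCode.val = slopes a m := by
    rw [List.map_map, slopes]
    exact List.map_congr_left fun k _ => (haα k).symm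
  have hx : RatCode.val ((j : ℤ), 2 ^ m - 1) = (j : ℝ) / 2 ^ m := by
    have : 1 ≤ 2 ^ m := Nat.one_le_two_pow
    rw [RatCode.val]
    push_cast [Nat.cast_sub this]
    ring
  refine ⟨Z ((List.range m).map α) ((j : ℤ), 2 ^ m - 1), ?_⟩
  have h := hZval ((List.range m).map α) ((j : ℤ), 2 ^ m - 1)
  rw [hmap, hx, ← zigLim_dyadic hΓ hΓ2 hj] at h
  rw [zigPath, ← h]
  ext i
  fin_cases i <;> simp [cval]

/-! ### A zigzag curve whose length encodes a set of natural numbers -/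

theorem PrimrecRat.prod_range {F : ℕ → ℝ} (hF : PrimrecRat F) :
    PrimrecRat fun n => ∏ k ∈ Finset.range n, F k := by
  obtain ⟨m, hm, hmval⟩ := (primrecRat_val (Primrec.fst (α := RatCode) (β := ℕ))).mul
    (hF.comp (Primrec.snd (α := RatCode) (β := ℕ)))
  refine ⟨Nat.rec (1, 0) fun n q => m (q, n),
    Primrec.nat_rec₁ _ (hm.comp (Primrec.snd.pair Primrec.fst)).to₂, fun n => ?_⟩
  induction n with
  | zero => simp [RatCode.val]
  | succ n ih =>
    exact (Finset.prod_range_succ F n).trans ((congrArg (· * F n) ih).trans (hmval (_, n)))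

theorem speed_slopes_sq (a : ℕ → ℝ) (n : ℕ) :
    speed (slopes a n) ^ 2 = ∏ k ∈ Finset.range n, (1 + a k ^ 2) := by
  induction n with
  | zero => simp [slopes]
  | succ n ih =>
    rw [slopes_succ, speed_append, mul_pow, ih, Finset.prod_range_succ]
    simp only [speed_cons, speed_nil, mul_one]
    rw [Real.sq_sqrt (by positivity)]

theorem growth_le_exp (l : List ℝ) : growth l ≤ Real.exp (l.map fun a => |a|).sum := by
  induction l with
  | nil => simp
  | cons a l ih =>
    rw [growth_cons, List.map_cons, List.sum_cons, Real.exp_add]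
    have h1 := Real.add_one_le_exp |a|
    have h2 := one_le_growth l
    exact mul_le_mul (by linarith) ih (by linarith) (Real.exp_pos _).le

theorem exp_half_lt_two : Real.exp (1 / 2) < 2 := by
  have h1 : Real.exp (1 / 2) * Real.exp (1 / 2) = Real.exp 1 := by
    rw [← Real.exp_add]; norm_num
  have h2 := Real.exp_one_lt_d9
  have h3 := Real.exp_pos (1 / 2)
  nlinarith

section Encode

variable (R : ℕ → ℕ → Prop)

/-- The index `k` codes a pair `(j, s)` such that `s` is the least witness of `R j s`. -/
def IsFirstWitness (k : ℕ) : Prop :=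
  R k.unpair.1 k.unpair.2 ∧ ∀ s < k.unpair.2, ¬ R k.unpair.1 s

open Classical in
/-- The slopes of a zigzag curve whose length encodes the set of all `j` with a witness: the
slope `2 ^ (-j - 2)` occurs, just once, if and only if `j` is in the set. -/
noncomputable def slope (k : ℕ) : ℝ :=
  if IsFirstWitness R k then (1 / 2) ^ (k.unpair.1 + 2) else 0

variable {R}

theorem exists_isFirstWitness {j : ℕ} (h : ∃ s, R j s) :
    ∃ k, IsFirstWitness R k ∧ k.unpair.1 = j := by
  classical
  refine ⟨Nat.pair j (Nat.find h), ⟨?_, fun s hs => ?_⟩, by simp⟩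
  · simpa using Nat.find_spec h
  · rw [Nat.unpair_pair] at hs ⊢
    exact Nat.find_min h hs

theorem IsFirstWitness.inj {k l : ℕ} (hk : IsFirstWitness R k) (hl : IsFirstWitness R l)
    (h : k.unpair.1 = l.unpair.1) : k = l := by
  have h2 : k.unpair.2 = l.unpair.2 := by
    refine le_antisymm (not_lt.1 fun hlt => ?_) (not_lt.1 fun hlt => ?_)
    · exact hk.2 _ hlt (h ▸ hl.1)
    · exact hl.2 _ hlt (h ▸ hk.1)
  rw [← Nat.pair_unpair k, ← Nat.pair_unpair l, h, h2]

theorem slope_nonneg (k : ℕ) : 0 ≤ slope R k := by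
  unfold slope
  split_ifs <;> positivity

theorem primrecPred_isFirstWitness (hR : PrimrecRel R) : PrimrecPred (IsFirstWitness R) := by
  have h1 : Primrec fun k : ℕ => k.unpair.1 := Primrec.fst.comp Primrec.unpair
  have h2 : Primrec fun k : ℕ => k.unpair.2 := Primrec.snd.comp Primrec.unpair
  have h3 : PrimrecRel fun n y => ∀ s < n, ¬ R y s :=
    PrimrecRel.forall_lt (R := fun s y => ¬ R y s) hR.swap.not
  exact (hR.comp h1 h2).and (h3.comp h2 h1)

theorem primrecRat_slope (hR : PrimrecRel R) : PrimrecRat (slope R) := by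
  classical
  refine (PrimrecRat.ite (primrecPred_isFirstWitness hR) (PrimrecRat.half_pow
    (Primrec.nat_add.comp (Primrec.fst.comp Primrec.unpair) (Primrec.const 2)))
    PrimrecRat.zero).of_eq fun k => ?_
  unfold slope
  congr

theorem sum_slope_le (n : ℕ) : ∑ k ∈ Finset.range n, slope R k ≤ 1 / 2 := by
  classical
  have h1 : ∑ k ∈ Finset.range n, slope R k =
      ∑ k ∈ (Finset.range n).filter (IsFirstWitness R), (1 / 2 : ℝ) ^ (k.unpair.1 + 2) := by
    rw [Finset.sum_filter]
    refine Finset.sum_congr rfl fun k _ => ?_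
    unfold slope
    congr
  have h2 : ∑ k ∈ (Finset.range n).filter (IsFirstWitness R), (1 / 2 : ℝ) ^ (k.unpair.1 + 2) =
      ∑ j ∈ ((Finset.range n).filter (IsFirstWitness R)).image fun k => k.unpair.1,
        (1 / 2 : ℝ) ^ (j + 2) := by
    rw [Finset.sum_image]
    intro k hk l hl hkl
    exact ((Finset.mem_filter.1 hk).2).inj (Finset.mem_filter.1 hl).2 hkl
  have h3 : ∑ j ∈ ((Finset.range n).filter (IsFirstWitness R)).image (fun k => k.unpair.1),
        (1 / 2 : ℝ) ^ (j + 2) ≤ ∑ j ∈ Finset.range n, (1 / 2 : ℝ) ^ (j + 2) := by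
    refine Finset.sum_le_sum_of_subset_of_nonneg ?_ fun _ _ _ => by positivity
    intro j hj
    obtain ⟨k, hk, rfl⟩ := Finset.mem_image.1 hj
    rw [Finset.mem_range]
    exact (Nat.unpair_left_le k).trans_lt (Finset.mem_range.1 (Finset.mem_filter.1 hk).1)
  have h4 : ∑ j ∈ Finset.range n, (1 / 2 : ℝ) ^ (j + 2) ≤ 1 / 2 := by
    have h5 := sum_geometric_two_le n
    have : ∑ j ∈ Finset.range n, (1 / 2 : ℝ) ^ (j + 2) =
        (∑ j ∈ Finset.range n, (1 / 2 : ℝ) ^ j) * (1 / 4) := by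
      rw [Finset.sum_mul]
      exact Finset.sum_congr rfl fun j _ => by ring
    rw [this]
    linarith
  linarith

theorem growth_slopes_slope_le (n : ℕ) : growth (slopes (slope R) n) ≤ Real.exp (1 / 2) := by
  refine (growth_le_exp _).trans (Real.exp_le_exp.2 ?_)
  have : ((slopes (slope R) n).map fun a => |a|).sum = ∑ k ∈ Finset.range n, slope R k := by
    induction n with
    | zero => simp [slopes]
    | succ n ih =>
      rw [slopes_succ, List.map_append, List.sum_append, ih, Finset.sum_range_succ]
      simp [abs_of_nonneg (slope_nonneg (R := R) n)]
  rw [this]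
  exact sum_slope_le n

/-- Upper bounds for the length of a piece of the curve can be used to enumerate the complement of
the encoded set: once the length of an approximation is nearly that of the curve, large slopes
can no longer occur. -/
theorem semidec_not_of_semidec_speedLim (hR : PrimrecRel R) {c : ℝ} (hc : 0 < c)
    (hcr : PrimrecRat fun _ : (ℕ × RatCode) × ℕ => c)
    (h : Semidec fun q : RatCode => c * speedLim (slope R) < q.val) :
    Semidec fun j => ¬ ∃ s, R j s := by
  have hΓ := growth_slopes_slope_le (R := R)
  set L := speedLim (slope R) with hL
  have hL0 : 0 < L := speedLim_pos hΓ
  have hP : Semidec fun x : (ℕ × RatCode) × ℕ => c * L < x.1.2.val ∧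
      x.1.2.val * x.1.2.val < c * c * ((∏ k ∈ Finset.range x.2, (1 + slope R k * slope R k)) *
        (1 + (1 / 2 : ℝ) ^ (x.1.1 + 2) * (1 / 2 : ℝ) ^ (x.1.1 + 2))) ∧
      ∀ k ∈ List.range x.2, ¬ (IsFirstWitness R k ∧ k.unpair.1 = x.1.1) := by
    have pj : Primrec fun x : (ℕ × RatCode) × ℕ => x.1.1 := Primrec.fst.comp Primrec.fst
    have pq : Primrec fun x : (ℕ × RatCode) × ℕ => x.1.2 := Primrec.snd.comp Primrec.fst
    have hs := primrecRat_slope hR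
    have hε := PrimrecRat.half_pow (Primrec.nat_add.comp pj (Primrec.const 2))
    have hprod := (PrimrecRat.one.add (hs.mul hs)).prod_range
    refine (h.comp pq).and (Semidec.and (PrimrecPred.semidec ?_) ?_)
    · exact ((primrecRat_val pq).mul (primrecRat_val pq)).lt ((hcr.mul hcr).mul
        ((hprod.comp Primrec.snd).mul (PrimrecRat.one.add (hε.mul hε))))
    · refine Semidec.forall_mem (p := fun (x : (ℕ × RatCode) × ℕ) k =>
        ¬ (IsFirstWitness R k ∧ k.unpair.1 = x.1.1)) (PrimrecPred.semidec ?_)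
        (Primrec.list_range.comp Primrec.snd)
      exact (((primrecPred_isFirstWitness hR).comp Primrec.snd).and
        (Primrec.eq.comp (Primrec.fst.comp (Primrec.unpair.comp Primrec.snd))
          (pj.comp Primrec.fst))).not
  have hP' := Semidec.exists_nat (p := fun (x : ℕ × RatCode) n => c * L < x.2.val ∧
      x.2.val * x.2.val < c * c * ((∏ k ∈ Finset.range n, (1 + slope R k * slope R k)) *
        (1 + (1 / 2 : ℝ) ^ (x.1 + 2) * (1 / 2 : ℝ) ^ (x.1 + 2))) ∧
      ∀ k ∈ List.range n, ¬ (IsFirstWitness R k ∧ k.unpair.1 = x.1)) hP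
  refine (Semidec.exists (p := fun (j : ℕ) (q : RatCode) => ∃ n, c * L < q.val ∧
      q.val * q.val < c * c * ((∏ k ∈ Finset.range n, (1 + slope R k * slope R k)) *
        (1 + (1 / 2 : ℝ) ^ (j + 2) * (1 / 2 : ℝ) ^ (j + 2))) ∧
      ∀ k ∈ List.range n, ¬ (IsFirstWitness R k ∧ k.unpair.1 = j)) hP').of_iff fun j => ?_
  have hsq : ∀ n, (∏ k ∈ Finset.range n, (1 + slope R k * slope R k)) =
      speed (slopes (slope R) n) ^ 2 := fun n => by
    rw [speed_slopes_sq]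
    exact Finset.prod_congr rfl fun k _ => by rw [sq]
  simp only [hsq]
  set ε : ℝ := (1 / 2 : ℝ) ^ (j + 2) with hε
  have hε0 : 0 < ε := by positivity
  constructor
  · intro hj
    have hlim : Tendsto (fun n => speed (slopes (slope R) n) * √(1 + ε * ε)) atTop
        (𝓝 (L * √(1 + ε * ε))) := (speed_slopes_tendsto hΓ).mul_const _
    have h1 : 1 < √(1 + ε * ε) := by
      rw [Real.lt_sqrt zero_le_one]
      nlinarith
    obtain ⟨n, hn⟩ :=
      (hlim.eventually (lt_mem_nhds (show L < L * √(1 + ε * ε) by nlinarith))).exists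
    obtain ⟨q, hq1, hq2⟩ := exists_ratCode_btwn (mul_lt_mul_of_pos_left hn hc)
    refine ⟨q, n, hq1, ?_, fun k _ hk => hj ⟨_, hk.2 ▸ hk.1.1⟩⟩
    have hq0 : 0 < q.val := (mul_pos hc hL0).trans hq1
    calc q.val * q.val < (c * (speed (slopes (slope R) n) * √(1 + ε * ε))) *
          (c * (speed (slopes (slope R) n) * √(1 + ε * ε))) :=
          mul_self_lt_mul_self hq0.le hq2
      _ = c * c * (speed (slopes (slope R) n) ^ 2 * √(1 + ε * ε) ^ 2) := by ring
      _ = _ := by rw [Real.sq_sqrt (by positivity)]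
  · rintro ⟨q, n, hq1, hq2, hno⟩ hj
    obtain ⟨k, hk, rfl⟩ := exists_isFirstWitness hj
    have hnk : n ≤ k := by
      by_contra hlt
      exact hno k (List.mem_range.2 (not_le.1 hlt)) ⟨hk, rfl⟩
    have hslope : slope R k = ε := by
      unfold slope
      rw [if_pos hk]
    have h1 : speed (slopes (slope R) (k + 1)) = speed (slopes (slope R) k) * √(1 + ε ^ 2) := by
      rw [slopes_succ, speed_append, hslope]
      simp
    have h2 := speed_le_speedLim hΓ (k + 1)
    have h3 : speed (slopes (slope R) n) ≤ speed (slopes (slope R) k) := speed_slopes_mono hnk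
    have h4 : speed (slopes (slope R) n) * √(1 + ε ^ 2) ≤ L := by
      rw [h1] at h2
      refine le_trans ?_ h2
      gcongr
    have h5 : speed (slopes (slope R) n) ^ 2 * (1 + ε * ε) ≤ L * L := by
      have h6 := zero_le_one.trans (one_le_speed (slopes (slope R) n))
      have h7 := mul_self_le_mul_self (by positivity) h4
      have h8 : √(1 + ε ^ 2) * √(1 + ε ^ 2) = 1 + ε * ε := by
        rw [Real.mul_self_sqrt (by positivity), sq]
      calc _ = speed (slopes (slope R) n) ^ 2 * (√(1 + ε ^ 2) * √(1 + ε ^ 2)) := by rw [h8]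
        _ = _ := by ring
        _ ≤ _ := h7
    have h6 : (c * L) * (c * L) < q.val * q.val := mul_self_lt_mul_self (mul_pos hc hL0).le hq1
    have h7 : c * c * (speed (slopes (slope R) n) ^ 2 * (1 + ε * ε)) ≤ c * c * (L * L) := by
      gcongr
    linarith

end Encode

/-- The set of halting programs is semidecidable but its complement is not. -/
theorem exists_primrecRel_not_semidec : ∃ R : ℕ → ℕ → Prop, PrimrecRel R ∧
    ¬ Semidec fun j => ¬ ∃ s, R j s := by
  refine ⟨fun j s => (Nat.Partrec.Code.evaln s (Denumerable.ofNat Nat.Partrec.Code j) 0).isSome,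
    ?_, fun h => ?_⟩
  · have h1 : Primrec fun p : ℕ × ℕ =>
        (Nat.Partrec.Code.evaln p.2 (Denumerable.ofNat Nat.Partrec.Code p.1) 0).isSome :=
      Primrec.option_isSome.comp (Nat.Partrec.Code.primrec_evaln.comp
        ((Primrec.snd.pair ((Primrec.ofNat _).comp Primrec.fst)).pair (Primrec.const 0)))
    exact (Primrec.eq.comp h1 (Primrec.const true)).of_eq fun p => Iff.rfl
  · refine ComputablePred.halting_problem_not_re 0 ?_
    refine ((h.comp (f := (Encodable.encode : Nat.Partrec.Code → ℕ))
      Primrec.encode).of_iff fun c => ?_).rePred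
    simp only [Denumerable.ofNat_encode]
    refine not_congr ?_
    constructor
    · intro hd
      obtain ⟨s, hs⟩ := Nat.Partrec.Code.evaln_complete.1 (Part.get_mem hd)
      exact ⟨s, Option.isSome_iff_exists.2 ⟨_, hs⟩⟩
    · rintro ⟨s, hs⟩
      obtain ⟨x, hx⟩ := Option.isSome_iff_exists.1 hs
      exact Part.dom_iff_mem.2 ⟨x, Nat.Partrec.Code.evaln_sound hx⟩

/-! ### Arcs in arcs -/

/-- A piece of an arc that is contained in another arc is a piece of the other arc. -/
theorem exists_subarc {f g : ℝ → Plane} {C : Set Plane} (hg : IsInjParam g C) {s t : ℝ}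
    (hst : s ≤ t) (hf : ContinuousOn f (Icc s t)) (hfi : InjOn f (Icc s t))
    (hfC : ∀ r ∈ Icc s t, f r ∈ C) :
    ∃ a b, 0 ≤ a ∧ a ≤ b ∧ b ≤ 1 ∧ eVariationOn g (Icc a b) = eVariationOn f (Icc s t) ∧
      ((g a = f s ∧ g b = f t) ∨ (g a = f t ∧ g b = f s)) := by
  obtain ⟨gc, gi, rfl⟩ := hg
  set φ : ℝ → ℝ := fun r => Function.invFunOn g (Icc 0 1) (f r) with hφ
  have hmem : ∀ r ∈ Icc s t, φ r ∈ Icc (0 : ℝ) 1 := fun r hr => Function.invFunOn_mem (hfC r hr)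
  have heq : ∀ r ∈ Icc s t, g (φ r) = f r := fun r hr => Function.invFunOn_eq (hfC r hr)
  have hinj : InjOn φ (Icc s t) := by
    intro r hr q hq hrq
    apply hfi hr hq
    rw [← heq r hr, ← heq q hq, hrq]
  have hcont : ContinuousOn φ (Icc s t) := by
    have hemb : IsClosedEmbedding ((Icc (0 : ℝ) 1).domRestrict g) :=
      (continuousOn_iff_continuous_domRestrict.1 gc).isClosedEmbedding (injOn_iff_injective.1 gi)
    have h1 : Continuous (fun r : Icc s t => (⟨φ r, hmem r r.2⟩ : Icc (0 : ℝ) 1)) := by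
      rw [hemb.isInducing.continuous_iff]
      exact (continuousOn_iff_continuous_domRestrict.1 hf).congr fun r => (heq r r.2).symm
    rw [continuousOn_iff_continuous_domRestrict]
    exact continuous_subtype_val.comp h1
  have hvar : eVariationOn f (Icc s t) = eVariationOn (g ∘ φ) (Icc s t) :=
    eVariationOn.congr fun r hr => (heq r hr).symm
  have hs := left_mem_Icc.2 hst
  have ht := right_mem_Icc.2 hst
  rcases hcont.strictMonoOn_of_injOn_Icc' hst hinj with h | h
  · have himg : φ '' Icc s t = Icc (φ s) (φ t) :=
      Subset.antisymm (image_subset_iff.2 fun r hr =>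
        ⟨h.monotoneOn hs hr hr.1, h.monotoneOn hr ht hr.2⟩) (intermediate_value_Icc hst hcont)
    refine ⟨φ s, φ t, (hmem s hs).1, h.monotoneOn hs ht hst, (hmem t ht).2, ?_,
      Or.inl ⟨heq s hs, heq t ht⟩⟩
    rw [hvar, eVariationOn.comp_eq_of_monotoneOn g φ h.monotoneOn, himg]
  · have himg : φ '' Icc s t = Icc (φ t) (φ s) :=
      Subset.antisymm (image_subset_iff.2 fun r hr =>
        ⟨h.antitoneOn hr ht hr.2, h.antitoneOn hs hr hr.1⟩) (intermediate_value_Icc' hst hcont)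
    refine ⟨φ t, φ s, (hmem t ht).1, h.antitoneOn hs ht hst, (hmem s hs).2, ?_,
      Or.inr ⟨heq t ht, heq s hs⟩⟩
    rw [hvar, eVariationOn.comp_eq_of_antitoneOn g φ h.antitoneOn, himg]

/-- A cover of an arc by countably many closed sets has a member that contains a dyadic piece. -/
theorem exists_dyadic_subset {f : ℝ → Plane} (hf : ContinuousOn f (Icc 0 1))
    {𝒞 : Set (Set Plane)} (h𝒞 : 𝒞.Countable) (hclosed : ∀ C ∈ 𝒞, IsClosed C)
    (hcover : ∀ t ∈ Icc (0 : ℝ) 1, ∃ C ∈ 𝒞, f t ∈ C) :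
    ∃ C ∈ 𝒞, ∃ m j : ℕ, j + 1 ≤ 2 ^ m ∧
      ∀ t ∈ Icc ((j : ℝ) / 2 ^ m) (((j + 1 : ℕ) : ℝ) / 2 ^ m), f t ∈ C := by
  have : Countable 𝒞 := h𝒞.to_subtype
  have hcont := continuousOn_iff_continuous_domRestrict.1 hf
  obtain ⟨C, t₀, ht₀⟩ := nonempty_interior_of_iUnion_of_closed
    (f := fun C : 𝒞 => {t : Icc (0 : ℝ) 1 | f t ∈ C.1})
    (fun C => (hclosed C.1 C.2).preimage hcont)
    (by
      refine eq_univ_of_forall fun t => ?_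
      obtain ⟨C, hC, htC⟩ := hcover t t.2
      exact mem_iUnion.2 ⟨⟨C, hC⟩, htC⟩)
  obtain ⟨ε, hε, hball⟩ := Metric.mem_nhds_iff.1 (mem_interior_iff_mem_nhds.1 ht₀)
  obtain ⟨m, hm⟩ := exists_pow_lt_of_lt_one hε (show (1 / 2 : ℝ) < 1 by norm_num)
  rw [one_div, inv_pow] at hm
  have h2 : (0 : ℝ) < 2 ^ m := by positivity
  have ht0 := t₀.2.1
  have ht1 := t₀.2.2
  obtain ⟨j, hj, hjt, htj⟩ : ∃ j : ℕ, j + 1 ≤ 2 ^ m ∧ (j : ℝ) ≤ t₀.1 * 2 ^ m ∧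
      t₀.1 * 2 ^ m ≤ j + 1 := by
    rcases ht1.lt_or_eq with h | h
    · refine ⟨⌊t₀.1 * 2 ^ m⌋₊, ?_, Nat.floor_le (by positivity), (Nat.lt_floor_add_one _).le⟩
      rw [Nat.succ_le_iff, Nat.floor_lt (by positivity)]
      push_cast
      nlinarith
    · refine ⟨2 ^ m - 1, ?_, ?_, ?_⟩
      · have : 1 ≤ 2 ^ m := Nat.one_le_two_pow
        omega
      · rw [h, Nat.cast_sub Nat.one_le_two_pow]; push_cast; linarith
      · rw [h, Nat.cast_sub Nat.one_le_two_pow]; push_cast; linarith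
  refine ⟨C.1, C.2, m, j, hj, fun t ht => ?_⟩
  have hj' : ((j + 1 : ℕ) : ℝ) ≤ 2 ^ m := by exact_mod_cast hj
  have htI : t ∈ Icc (0 : ℝ) 1 :=
    ⟨le_trans (by positivity) ht.1, ht.2.trans ((div_le_one h2).2 hj')⟩
  refine @hball ⟨t, htI⟩ ?_
  rw [Metric.mem_ball, Subtype.dist_eq, Real.dist_eq]
  refine lt_of_le_of_lt ?_ hm
  have h3 := (div_le_iff₀ h2).1 ht.1
  have h4 := (le_div_iff₀ h2).1 ht.2
  push_cast at h4
  rw [inv_eq_one_div, le_div_iff₀ h2, ← abs_of_pos h2, ← abs_mul, sub_mul]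
  exact abs_le.2 ⟨by linarith, by linarith⟩

/-- If the zigzag curve encodes a set with a complement that is not semidecidable, then no curve in
`classC` contains a dyadic piece of it: upper bounds for the length of this piece could be
enumerated.  By the category argument the curves in `classC` miss a point. -/
theorem exists_not_mem_classC {R : ℕ → ℕ → Prop} (hR : PrimrecRel R)
    (hnot : ¬ Semidec fun j => ¬ ∃ s, R j s) :
    ∃ x ∈ zigPath (slope R) '' Icc 0 1, ∀ C ∈ classC, x ∉ C := by
  have hΓ := growth_slopes_slope_le (R := R)
  have hΓ2 := exp_half_lt_two
  have hcont := (zigPath_lipschitz hΓ hΓ2.le).continuousOn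
  by_contra! hcon
  obtain ⟨C, hC, m, j, hj, hsub⟩ := exists_dyadic_subset hcont countable_classC
    (fun C hC => by
      obtain ⟨-, -, g, hg, -⟩ := exists_param_of_mem_classC hC
      exact hg.isCompact.isClosed)
    (fun t ht => hcon _ (mem_image_of_mem _ ht))
  obtain ⟨hcov, hov, g, hg, hv, hlen⟩ := exists_param_of_mem_classC hC
  set s : ℝ := (j : ℝ) / 2 ^ m with hs
  set t : ℝ := ((j + 1 : ℕ) : ℝ) / 2 ^ m with ht
  have h2 : (0 : ℝ) < 2 ^ m := by positivity
  have hs0 : 0 ≤ s := by positivity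
  have hts : t - s = 1 / 2 ^ m := by
    rw [hs, ht]; push_cast; ring
  have hc : 0 < t - s := by rw [hts]; positivity
  have ht1 : t ≤ 1 := by
    rw [ht, div_le_one h2]; exact_mod_cast hj
  have hIcc : Icc s t ⊆ Icc 0 1 := Icc_subset_Icc hs0 ht1
  obtain ⟨A, hA⟩ := exists_zigPath_eq_pt (primrecRat_slope hR) hΓ hΓ2.le
    (m := m) ((Nat.le_succ j).trans hj)
  obtain ⟨B, hB⟩ := exists_zigPath_eq_pt (primrecRat_slope hR) hΓ hΓ2.le (m := m) hj
  obtain ⟨a, b, ha, hab, hb, hvar, hends⟩ := exists_subarc hg (sub_nonneg.1 hc.le)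
    (hcont.mono hIcc) (fun x hx y hy hxy =>
      zigLim_injOn hΓ hΓ2 (hIcc hx) (hIcc hy) (toPlane.injective hxy)) hsub
  have key : Semidec fun q : RatCode => arcLen g a b < q.val := by
    rcases hends with ⟨h1, h2⟩ | ⟨h1, h2⟩
    · exact semidec_arcLen_lt hg hv hcov hov hlen ha hab hb (h1.trans hA) (h2.trans hB)
    · exact semidec_arcLen_lt hg hv hcov hov hlen ha hab hb (h1.trans hB) (h2.trans hA)
  have harc : arcLen g a b = (t - s) * speedLim (slope R) := by
    rw [arcLen, hvar, variation_zigPath hΓ hΓ2.le hs0 (sub_nonneg.1 hc.le) ht1,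
      ENNReal.toReal_ofReal (mul_nonneg (speedLim_pos hΓ).le hc.le), mul_comm]
  rw [harc] at key
  refine hnot (semidec_not_of_semidec_speedLim hR hc ?_ key)
  exact (PrimrecRat.half_pow (Primrec.const m)).of_eq fun _ => by rw [hts]; simp

end CompCurve


theorem theorem4p2 :
    (∃ K : Set CompCurve.Plane, CompCurve.NComputable K ∧
      ∃ x ∈ K, ∀ C ∈ CompCurve.classC, x ∉ C) ∧
    CompCurve.PointSeparable CompCurve.classN CompCurve.classC ∧
    CompCurve.PointSeparable CompCurve.classR CompCurve.classC := by
  obtain ⟨R, hR, hnot⟩ := CompCurve.exists_primrecRel_not_semidec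
  have hΓ := CompCurve.growth_slopes_slope_le (R := R)
  have hΓ2 := CompCurve.exp_half_lt_two
  have hN := CompCurve.nComputable_zigPath hΓ hΓ2
    (CompCurve.computablePath_zigPath (CompCurve.primrecRat_slope hR) hΓ hΓ2.le)
  obtain ⟨x, hxK, hx⟩ := CompCurve.exists_not_mem_classC hR hnot
  have hunreach : ¬ CompCurve.Reachable CompCurve.classC x := fun ⟨C, hC, hxC⟩ => hx C hC hxC
  obtain ⟨f, hf, hfK, -⟩ := hN.2.2
  exact ⟨⟨_, hN, x, hxK, hx⟩, ⟨x, ⟨_, ⟨hN, hN.2.1⟩, hxK⟩, hunreach⟩,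
    ⟨x, ⟨_, ⟨⟨hN.1, f, hf, hfK⟩, hN.2.1⟩, hxK⟩, hunreach⟩⟩
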